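/- Let $z\in\mathbb{C}$ and $b>0$. Let $\langle f,g\rangle=\int_{\mathbb{R}} f\overline{g}\,dx$ on $L^2(\mathbb{R})$, and on the form domain $\mathcal{D}=\{f\in H^1(\mathbb{R}) : xf(x)\in L^2(\mathbb{R})\}$ consider $$t_{z,b}(f,g)=\langle f',g'\rangle+\tfrac14\langle xf,xg\rangle-\tfrac12\langle f,g\rangle+z\big(f(b)\overline{g(b)}-f(-b)\overline{g(-b)}\big),$$ where $f(\pm b)$, $g(\pm b)$ are the values of the continuous representatives. Let $L_{z,b}$ be the operator $$L_{z,b}\,y=-y''+\Big(\frac{x^2}{4}-\frac12\Big)y+z\big(\delta(x-b)-\delta(x+b)\big)y$$ on $L^2(\mathbb{R})$ associated with this form: $f$ lies in the domain of $L_{z,b}$ with $L_{z,b}f=h$ if and only if $f\in\mathcal{D}$, $h\in L^2(\mathbb{R})$ and $t_{z,b}(f,g)=\langle h,g\rangle$ for all $g\in\mathcal{D}$. For $\nu,x\in\mathbb{C}$ let $$y_{\mathrm{even}}(\nu,x)=e^{-x^2/4}\sum_{k\ge 0}\Big(\prod_{j=0}^{k-1}(-\nu+2j)\Big)\frac{x^{2k}}{(2k)!},\qquad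 y_{\mathrm{odd}}(\nu,x)=e^{-x^2/4}\sum_{k\ge 0}\Big(\prod_{j=0}^{k-1}(-\nu+1+2j)\Big)\frac{x^{2k+1}}{(2k+1)!}$$ be the even and odd solutions of $-y''+(x^2/4-1/2)y=\nu y$, and let $$D_\nu(x)=\frac{2^{\nu/2}\sqrt{\pi}}{\Gamma(\frac12-\frac{\nu}{2})}\,y_{\mathrm{even}}(\nu,x)-\frac{2^{(\nu+1)/2}\sqrt{\pi}}{\Gamma(-\frac{\nu}{2})}\,y_{\mathrm{odd}}(\nu,x)$$ be the parabolic cylinder function; here $1/\Gamma$ is the entire reciprocal Gamma function, which vanishes at $0,-1,-2,\dots$. Then, for every $\nu\in\mathbb{C}$, $\nu$ belongs to the spectrum of $L_{z,b}$ if and only if $$\frac{\sqrt{\pi}}{\sqrt{2}\,\Gamma(-\nu)}-z^2\,D_\nu(b)^2\,y_{\mathrm{even}}(\nu,b)\,y_{\mathrm{odd}}(\nu,b)=0.$$ -/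

import Mathlib

open MeasureTheory
open scoped ContDiff ComplexConjugate

namespace OddPair

noncomputable section

/-! ### Parabolic cylinder functions -/

/-- The even solution
`exp(-x²/4) (1 + (-ν) x²/2! + (-ν)(-ν+2) x⁴/4! + ⋯)` of `-y'' + (x²/4 - 1/2) y = ν y`. -/
def yEven (ν x : ℂ) : ℂ :=
  Complex.exp (-x ^ 2 / 4) *
    ∑' k : ℕ, (∏ j ∈ Finset.range k, (-ν + 2 * (j : ℂ))) * x ^ (2 * k) / ((2 * k).factorial : ℂ)

/-- The odd solution
`exp(-x²/4) (x + (-ν+1) x³/3! + (-ν+1)(-ν+3) x⁵/5! + ⋯)` of `-y'' + (x²/4 - 1/2) y = ν y`. -/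
def yOdd (ν x : ℂ) : ℂ :=
  Complex.exp (-x ^ 2 / 4) *
    ∑' k : ℕ, (∏ j ∈ Finset.range k, (-ν + 1 + 2 * (j : ℂ))) * x ^ (2 * k + 1) /
      ((2 * k + 1).factorial : ℂ)

/-- The entire function `1 / Γ`. Mathlib's `Γ` takes the value `0` at its poles, so that the
inverse vanishes there. -/
def recipGamma (s : ℂ) : ℂ := (Complex.Gamma s)⁻¹

/-- The parabolic cylinder function `D_ν`: the solution of `-y'' + (x²/4 - 1/2) y = ν y` with
`D_ν(0) = 2^{ν/2} √π / Γ(1/2 - ν/2)` and `D_ν'(0) = -2^{(ν+1)/2} √π / Γ(-ν/2)`. -/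
def parabolicD (ν x : ℂ) : ℂ :=
  (2 : ℂ) ^ (ν / 2) * (√Real.pi : ℂ) * recipGamma (-ν / 2 + 1 / 2) * yEven ν x -
    (2 : ℂ) ^ ((ν + 1) / 2) * (√Real.pi : ℂ) * recipGamma (-ν / 2) * yOdd ν x

/-! ### The spectrum of an unbounded operator -/

/-- The resolvent set of an unbounded operator `A` on `E`: those `ν` for which `A - ν` is a
bijection from its domain onto `E` with bounded inverse `R`. -/
def resolventSet {E : Type*} [NormedAddCommGroup E] [NormedSpace ℂ E] (A : E →ₗ.[ℂ] E) : Set ℂ :=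
  {ν | ∃ R : E →L[ℂ] E,
    (∀ h : E, ∃ hR : R h ∈ A.domain, A ⟨R h, hR⟩ - ν • R h = h) ∧
    (∀ f : A.domain, R (A f - ν • (f : E)) = f)}

/-- The spectrum of an unbounded operator. -/
def opSpectrum {E : Type*} [NormedAddCommGroup E] [NormedSpace ℂ E] (A : E →ₗ.[ℂ] E) : Set ℂ :=
  (resolventSet A)ᶜ

/-! ### The Sobolev space `H¹(ℝ)` and the form domain -/

/-- The Hilbert space `L²(ℝ)` of complex valued functions. -/
abbrev L2 : Type := Lp ℂ 2 (volume : Measure ℝ)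

/-- `g ∈ L²(ℝ)` is the weak derivative of `f ∈ L²(ℝ)`. -/
def HasWeakDeriv (f g : L2) : Prop :=
  ∀ φ : ℝ → ℝ, ContDiff ℝ ∞ φ → HasCompactSupport φ →
    ∫ x, deriv φ x • f x = -∫ x, φ x • g x

theorem L2.locallyIntegrable (f : L2) : LocallyIntegrable f volume :=
  (Lp.memLp f).locallyIntegrable (by norm_num)

theorem L2.integrable_smul (f : L2) {φ : ℝ → ℝ} (hφ : Continuous φ) (hc : HasCompactSupport φ) :
    Integrable (fun x => φ x • f x) :=
  (L2.locallyIntegrable f).integrable_smul_left_of_hasCompactSupport hφ hc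

theorem continuous_deriv_of_smooth {φ : ℝ → ℝ} (hφ : ContDiff ℝ ∞ φ) : Continuous (deriv φ) :=
  hφ.continuous_deriv (by simp)

theorem HasWeakDeriv.unique {f g g₁ : L2} (h : HasWeakDeriv f g) (h₁ : HasWeakDeriv f g₁) :
    g = g₁ := by
  apply Lp.ext
  refine ae_eq_of_integral_contDiff_smul_eq (L2.locallyIntegrable g) (L2.locallyIntegrable g₁) ?_
  intro φ hφ hc
  exact neg_injective ((h φ hφ hc).symm.trans (h₁ φ hφ hc))

theorem HasWeakDeriv.add {f g f₁ g₁ : L2} (h : HasWeakDeriv f g) (h₁ : HasWeakDeriv f₁ g₁) :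
    HasWeakDeriv (f + f₁) (g + g₁) := by
  intro φ hφ hc
  have e1 : ∫ x, deriv φ x • (f + f₁) x = ∫ x, (deriv φ x • f x + deriv φ x • f₁ x) := by
    apply integral_congr_ae
    filter_upwards [Lp.coeFn_add f f₁] with x hx
    rw [hx, Pi.add_apply, smul_add]
  have e2 : ∫ x, φ x • (g + g₁) x = ∫ x, (φ x • g x + φ x • g₁ x) := by
    apply integral_congr_ae
    filter_upwards [Lp.coeFn_add g g₁] with x hx
    rw [hx, Pi.add_apply, smul_add]
  have hd := continuous_deriv_of_smooth hφ
  rw [e1, e2, integral_add (L2.integrable_smul f hd hc.deriv) (L2.integrable_smul f₁ hd hc.deriv),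
    integral_add (L2.integrable_smul g hφ.continuous hc) (L2.integrable_smul g₁ hφ.continuous hc),
    h φ hφ hc, h₁ φ hφ hc]
  ring

theorem HasWeakDeriv.smul (c : ℂ) {f g : L2} (h : HasWeakDeriv f g) :
    HasWeakDeriv (c • f) (c • g) := by
  intro φ hφ hc
  have e1 : ∫ x, deriv φ x • (c • f) x = ∫ x, c • (deriv φ x • f x) := by
    apply integral_congr_ae
    filter_upwards [Lp.coeFn_smul c f] with x hx
    rw [hx, Pi.smul_apply, smul_comm]
  have e2 : ∫ x, φ x • (c • g) x = ∫ x, c • (φ x • g x) := by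
    apply integral_congr_ae
    filter_upwards [Lp.coeFn_smul c g] with x hx
    rw [hx, Pi.smul_apply, smul_comm]
  rw [e1, e2, integral_smul, integral_smul, h φ hφ hc, smul_neg]

theorem hasWeakDeriv_zero : HasWeakDeriv 0 0 := by
  simpa using HasWeakDeriv.smul 0 (f := 0) (g := 0) (by
    intro φ hφ hc
    have e : ∀ ψ : ℝ → ℝ, ∫ x, ψ x • (0 : L2) x = 0 := by
      intro ψ
      rw [← integral_zero ℝ ℂ (μ := volume)]
      apply integral_congr_ae
      filter_upwards [Lp.coeFn_zero ℂ 2 (volume : Measure ℝ)] with x hx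
      rw [hx]; simp
    rw [e, e, neg_zero])

/-- The Sobolev space `H¹(ℝ)`. -/
def sobolevH1 : Submodule ℂ L2 where
  carrier := {f | ∃ g : L2, HasWeakDeriv f g}
  zero_mem' := ⟨0, hasWeakDeriv_zero⟩
  add_mem' := by
    rintro f f₁ ⟨g, hg⟩ ⟨g₁, hg₁⟩
    exact ⟨g + g₁, hg.add hg₁⟩
  smul_mem' := by
    rintro c f ⟨g, hg⟩
    exact ⟨c • g, hg.smul c⟩

/-- The form domain `{f ∈ H¹(ℝ) : x f(x) ∈ L²(ℝ)}`. -/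
def formDomain : Submodule ℂ L2 where
  carrier := {f | f ∈ sobolevH1 ∧ MemLp (fun x : ℝ => (x : ℂ) * f x) 2 volume}
  zero_mem' := by
    refine ⟨sobolevH1.zero_mem, (MemLp.zero' (ε := ℂ)).ae_eq ?_⟩
    filter_upwards [Lp.coeFn_zero ℂ 2 (volume : Measure ℝ)] with x hx
    rw [hx]; simp
  add_mem' := by
    rintro f f₁ ⟨h, hm⟩ ⟨h₁, hm₁⟩
    refine ⟨sobolevH1.add_mem h h₁, (hm.add hm₁).ae_eq ?_⟩
    filter_upwards [Lp.coeFn_add f f₁] with x hx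
    rw [hx]; simp [mul_add]
  smul_mem' := by
    rintro c f ⟨h, hm⟩
    refine ⟨sobolevH1.smul_mem c h, (hm.const_smul c).ae_eq ?_⟩
    filter_upwards [Lp.coeFn_smul c f] with x hx
    rw [hx]; simp [mul_left_comm]

open Classical in
/-- The weak derivative `f'` of `f ∈ H¹(ℝ)` (and `0` for other `f`). -/
def weakDeriv (f : L2) : L2 :=
  if h : ∃ g : L2, HasWeakDeriv f g then h.choose else 0

theorem HasWeakDeriv.weakDeriv_eq {f g : L2} (h : HasWeakDeriv f g) : weakDeriv f = g := by
  have hex : ∃ g : L2, HasWeakDeriv f g := ⟨g, h⟩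
  rw [weakDeriv, dif_pos hex]
  exact hex.choose_spec.unique h

theorem hasWeakDeriv_weakDeriv {f : L2} (h : f ∈ sobolevH1) : HasWeakDeriv f (weakDeriv f) := by
  obtain ⟨g, hg⟩ := h
  rwa [hg.weakDeriv_eq]

open Classical in
/-- The continuous representative of `f ∈ H¹(ℝ)` (and `0` if `f` has none). -/
def contRep (f : L2) : ℝ → ℂ :=
  if h : ∃ u : ℝ → ℂ, Continuous u ∧ f =ᵐ[volume] u then h.choose else 0

theorem contRep_eq {f : L2} {u : ℝ → ℂ} (hu : Continuous u) (h : f =ᵐ[volume] u) :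
    contRep f = u := by
  have hex : ∃ u : ℝ → ℂ, Continuous u ∧ f =ᵐ[volume] u := ⟨u, hu, h⟩
  rw [contRep, dif_pos hex]
  exact (Continuous.ae_eq_iff_eq volume hex.choose_spec.1 hu).1 (hex.choose_spec.2.symm.trans h)

/-- Integration by parts against a primitive, real valued case. -/
theorem integral_deriv_mul_primitive {g φ : ℝ → ℝ} (hg : LocallyIntegrable g volume)
    (hφ : ContDiff ℝ ∞ φ) (hc : HasCompactSupport φ) :
    ∫ x, deriv φ x * (∫ t in (0 : ℝ)..x, g t) = -∫ x, φ x * g x := by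
  obtain ⟨M, hM0, hM⟩ : ∃ M : ℝ, 0 < M ∧ tsupport φ ⊆ Set.Ioo (-M) M := by
    obtain ⟨M, hM0, hM⟩ := hc.isCompact.isBounded.subset_ball_lt 0 0
    refine ⟨M, hM0, hM.trans ?_⟩
    rw [Real.ball_eq_Ioo]; simp
  have hMM : Set.Ioo (-M) M ⊆ Set.Ioc (-M) M := Set.Ioo_subset_Ioc_self
  have s1 : Function.support (fun x => deriv φ x * (∫ t in (0 : ℝ)..x, g t)) ⊆ Set.Ioc (-M) M := by
    refine (Function.support_mul_subset_left _ _).trans ?_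
    exact (support_deriv_subset.trans hM).trans hMM
  have s2 : Function.support (fun x => φ x * g x) ⊆ Set.Ioc (-M) M := by
    refine (Function.support_mul_subset_left _ _).trans ?_
    exact ((subset_tsupport φ).trans hM).trans hMM
  have z1 : φ M = 0 := by
    by_contra h
    exact lt_irrefl _ (hM (subset_tsupport φ h)).2
  have z2 : φ (-M) = 0 := by
    by_contra h
    exact lt_irrefl _ (hM (subset_tsupport φ h)).1
  rw [← intervalIntegral.integral_eq_integral_of_support_subset s1,
    ← intervalIntegral.integral_eq_integral_of_support_subset s2]
  have hi : IntervalIntegrable g volume (-M) M := (hg.integrableOn_isCompact isCompact_uIcc).intervalIntegrable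
  have hU := hi.absolutelyContinuousOnInterval_intervalIntegral (c := 0)
    (by rw [Set.uIcc_of_le (by linarith)]; constructor <;> linarith)
  have hφa : AbsolutelyContinuousOnInterval φ (-M) M :=
    (hφ.of_le (by simp)).contDiffOn.absolutelyContinuousOnInterval
  have key := hU.integral_mul_deriv_eq_deriv_mul hφa
  simp only [z1, z2, mul_zero, sub_zero, zero_sub] at key
  simp_rw [mul_comm (deriv φ _)]
  rw [key]
  congr 1
  apply intervalIntegral.integral_congr_ae
  filter_upwards [LocallyIntegrable.ae_hasDerivAt_integral hg] with x hx _
  rw [(hx 0).deriv, mul_comm]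

theorem integral_deriv_smul_primitive {g : ℝ → ℂ} {φ : ℝ → ℝ} (hg : LocallyIntegrable g volume)
    (hφ : ContDiff ℝ ∞ φ) (hc : HasCompactSupport φ) :
    ∫ x, deriv φ x • (∫ t in (0 : ℝ)..x, g t) = -∫ x, φ x • g x := by
  have hu : Continuous (fun x => ∫ t in (0 : ℝ)..x, g t) :=
    intervalIntegral.continuous_primitive (fun a b => (hg.integrableOn_isCompact isCompact_uIcc).intervalIntegrable) 0
  have i1 : Integrable (fun x => deriv φ x • (∫ t in (0 : ℝ)..x, g t)) :=
    ((continuous_deriv_of_smooth hφ).smul hu).integrable_of_hasCompactSupport hc.deriv.smul_right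
  have i2 : Integrable (fun x => φ x • g x) :=
    hg.integrable_smul_left_of_hasCompactSupport hφ.continuous hc
  have gen : ∀ L : ℂ →L[ℝ] ℝ, L (∫ x, deriv φ x • (∫ t in (0 : ℝ)..x, g t)) =
      L (-∫ x, φ x • g x) := by
    intro L
    have hLg : LocallyIntegrable (fun x => L (g x)) volume := by
      intro x
      obtain ⟨s, hs, hgs⟩ := hg x
      exact ⟨s, hs, L.integrable_comp hgs⟩
    rw [map_neg, ← L.integral_comp_comm i1, ← L.integral_comp_comm i2]
    simp only [map_smul, smul_eq_mul]
    rw [← integral_deriv_mul_primitive hLg hφ hc]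
    congr 1
    ext x
    rw [L.intervalIntegral_comp_comm (hg.integrableOn_isCompact isCompact_uIcc).intervalIntegrable]
  apply Complex.ext
  · exact gen Complex.reCLM
  · exact gen Complex.imCLM

/-- A locally integrable function with zero weak derivative is almost everywhere constant. -/
theorem ae_const_of_weakDeriv_zero {v : ℝ → ℂ} (hv : LocallyIntegrable v volume)
    (h : ∀ φ : ℝ → ℝ, ContDiff ℝ ∞ φ → HasCompactSupport φ → ∫ x, deriv φ x • v x = 0) :
    ∃ c : ℂ, v =ᵐ[volume] fun _ => c := by
  let β : ContDiffBump (0 : ℝ) := default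
  let ψ : ℝ → ℝ := β.normed volume
  have hψ : ContDiff ℝ ∞ ψ := β.contDiff_normed
  have hψc : HasCompactSupport ψ := β.hasCompactSupport_normed
  have hψi : ∫ x, ψ x = 1 := β.integral_normed
  refine ⟨∫ x, ψ x • v x, ?_⟩
  refine ae_eq_of_integral_contDiff_smul_eq hv (locallyIntegrable_const _) ?_
  intro φ hφ hc
  let m : ℝ := ∫ x, φ x
  let η : ℝ → ℝ := fun x => φ x - m * ψ x
  have hη : ContDiff ℝ ∞ η := hφ.sub (contDiff_const.mul hψ)
  have hηc : HasCompactSupport η := hc.sub hψc.mul_left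
  have iφ : Integrable φ := hφ.continuous.integrable_of_hasCompactSupport hc
  have iψ : Integrable ψ := hψ.continuous.integrable_of_hasCompactSupport hψc
  have iη : Integrable η := hη.continuous.integrable_of_hasCompactSupport hηc
  have hη0 : ∫ x, η x = 0 := by
    change ∫ x, (φ x - m * ψ x) = 0
    rw [integral_sub iφ (iψ.const_mul m), integral_const_mul, hψi]
    simp [m]
  obtain ⟨M, hM0, hM⟩ : ∃ M : ℝ, 0 < M ∧ tsupport η ⊆ Set.Ioo (-M) M := by
    obtain ⟨M, hM0, hM⟩ := hηc.isCompact.isBounded.subset_ball_lt 0 0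
    refine ⟨M, hM0, hM.trans ?_⟩
    rw [Real.ball_eq_Ioo]; simp
  let H : ℝ → ℝ := fun x => ∫ t in (-M)..x, η t
  have hHd : ∀ x, HasDerivAt H (η x) x := fun x =>
    intervalIntegral.integral_hasDerivAt_right (hη.continuous.intervalIntegrable _ _)
      (hη.continuous.stronglyMeasurableAtFilter _ _) hη.continuous.continuousAt
  have hder : deriv H = η := funext fun x => (hHd x).deriv
  have hH : ContDiff ℝ ∞ H := by
    rw [contDiff_infty_iff_deriv]
    exact ⟨fun x => (hHd x).differentiableAt, by rwa [hder]⟩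
  have hHc : HasCompactSupport H := by
    refine HasCompactSupport.intro (isCompact_Icc (a := -M) (b := M)) ?_
    intro x hx
    have zero_of : ∀ t, t ∉ Set.Ioo (-M) M → η t = 0 := fun t ht => by
      by_contra h0
      exact ht (hM (subset_tsupport η h0))
    rcases lt_or_ge x (-M) with hlt | hge
    · change ∫ t in (-M)..x, η t = 0
      rw [intervalIntegral.integral_congr (g := fun _ => (0 : ℝ))]
      · simp
      · intro t ht
        rw [Set.uIcc_of_ge hlt.le] at ht
        exact zero_of t (fun h' => absurd h'.1 (not_lt.2 ht.2))
    · have hgt : M < x := by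
        by_contra hle
        exact hx ⟨hge, not_lt.1 hle⟩
      change ∫ t in (-M)..x, η t = 0
      rw [intervalIntegral.integral_eq_integral_of_support_subset, hη0]
      intro t ht
      have := hM (subset_tsupport η ht)
      exact ⟨this.1, by linarith [this.2]⟩
  have key := h H hH hHc
  rw [hder] at key
  have j1 : Integrable (fun x => φ x • v x) :=
    hv.integrable_smul_left_of_hasCompactSupport hφ.continuous hc
  have j2 : Integrable (fun x => ψ x • v x) :=
    hv.integrable_smul_left_of_hasCompactSupport hψ.continuous hψc
  have e : ∀ x, η x • v x = φ x • v x - m • (ψ x • v x) := fun x => by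
    simp only [η, sub_smul, mul_smul]
  simp_rw [e] at key
  have j3 : Integrable (fun x => m • (ψ x • v x)) := j2.smul m
  rw [integral_sub j1 j3, integral_smul] at key
  rw [integral_smul_const]
  exact sub_eq_zero.1 key

/-- Every `f ∈ H¹(ℝ)` has a continuous representative. -/
theorem exists_contRep {f : L2} (h : f ∈ sobolevH1) :
    ∃ u : ℝ → ℂ, Continuous u ∧ f =ᵐ[volume] u := by
  obtain ⟨g, hg⟩ := h
  have hgl := L2.locallyIntegrable g
  have hu : Continuous (fun x => ∫ t in (0 : ℝ)..x, g t) :=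
    intervalIntegral.continuous_primitive (fun a b => (hgl.integrableOn_isCompact isCompact_uIcc).intervalIntegrable) 0
  obtain ⟨c, hc⟩ := ae_const_of_weakDeriv_zero
    (v := fun x => f x - ∫ t in (0 : ℝ)..x, g t)
    ((L2.locallyIntegrable f).sub hu.locallyIntegrable) (by
      intro φ hφ hc
      have hd := continuous_deriv_of_smooth hφ
      have j : Integrable (fun x => deriv φ x • (∫ t in (0 : ℝ)..x, g t)) :=
        (hd.smul hu).integrable_of_hasCompactSupport hc.deriv.smul_right
      simp_rw [smul_sub]
      rw [integral_sub (L2.integrable_smul f hd hc.deriv) j, hg φ hφ hc,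
        integral_deriv_smul_primitive hgl hφ hc, sub_self])
  refine ⟨fun x => c + ∫ t in (0 : ℝ)..x, g t, continuous_const.add hu, ?_⟩
  filter_upwards [hc] with x hx
  rw [← hx]; ring

theorem contRep_spec {f : L2} (h : f ∈ sobolevH1) :
    Continuous (contRep f) ∧ f =ᵐ[volume] contRep f := by
  obtain ⟨u, hu, hfu⟩ := exists_contRep h
  rw [contRep_eq hu hfu]
  exact ⟨hu, hfu⟩

/-! ### The form and the operator -/

/-- The sesquilinear form
`t(f, g) = ⟨f', g'⟩ + (1/4) ⟨x f, x g⟩ - (1/2) ⟨f, g⟩ + z (f(b) conj g(b) - f(-b) conj g(-b))`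
with `⟨f, g⟩ = ∫ f conj g`. Mathlib's inner product is conjugate linear in its first argument,
so that `⟨f, g⟩` is `inner ℂ g f`. -/
def form (z : ℂ) (b : ℝ) (f g : L2) : ℂ :=
  inner ℂ (weakDeriv g) (weakDeriv f)
    + 1 / 4 * (∫ x : ℝ, ((x : ℂ) * f x) * conj ((x : ℂ) * g x))
    - 1 / 2 * inner ℂ g f
    + z * (contRep f b * conj (contRep g b) - contRep f (-b) * conj (contRep g (-b)))

theorem integrable_weight {f g : L2} (hf : f ∈ formDomain) (hg : g ∈ formDomain) :
    Integrable (fun x : ℝ => ((x : ℂ) * f x) * conj ((x : ℂ) * g x)) :=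
  MemLp.integrable_mul hf.2 hg.2.star

theorem form_add (z : ℂ) (b : ℝ) {f f₁ g : L2} (hf : f ∈ formDomain) (hf₁ : f₁ ∈ formDomain)
    (hg : g ∈ formDomain) : form z b (f + f₁) g = form z b f g + form z b f₁ g := by
  have w := ((hasWeakDeriv_weakDeriv hf.1).add (hasWeakDeriv_weakDeriv hf₁.1)).weakDeriv_eq
  have hc := contRep_spec hf.1
  have hc₁ := contRep_spec hf₁.1
  have c : contRep (f + f₁) = contRep f + contRep f₁ :=
    contRep_eq (hc.1.add hc₁.1) ((Lp.coeFn_add f f₁).trans (hc.2.add hc₁.2))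
  have i : ∫ x : ℝ, ((x : ℂ) * (f + f₁) x) * conj ((x : ℂ) * g x) =
      ∫ x : ℝ, (((x : ℂ) * f x) * conj ((x : ℂ) * g x) +
        ((x : ℂ) * f₁ x) * conj ((x : ℂ) * g x)) := by
    apply integral_congr_ae
    filter_upwards [Lp.coeFn_add f f₁] with x hx
    rw [hx, Pi.add_apply]; ring
  rw [form, w, c, i, integral_add (integrable_weight hf hg) (integrable_weight hf₁ hg),
    inner_add_right, inner_add_right, form, form, Pi.add_apply, Pi.add_apply]
  ring

theorem form_smul (z : ℂ) (b : ℝ) (a : ℂ) {f g : L2} (hf : f ∈ formDomain) :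
    form z b (a • f) g = a * form z b f g := by
  have w := ((hasWeakDeriv_weakDeriv hf.1).smul a).weakDeriv_eq
  have hc := contRep_spec hf.1
  have c : contRep (a • f) = a • contRep f :=
    contRep_eq (hc.1.const_smul a) ((Lp.coeFn_smul a f).trans (hc.2.const_smul a))
  have i : ∫ x : ℝ, ((x : ℂ) * (a • f) x) * conj ((x : ℂ) * g x) =
      ∫ x : ℝ, a * (((x : ℂ) * f x) * conj ((x : ℂ) * g x)) := by
    apply integral_congr_ae
    filter_upwards [Lp.coeFn_smul a f] with x hx
    rw [hx, Pi.smul_apply, smul_eq_mul]; ring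
  rw [form, w, c, i, integral_const_mul, inner_smul_right, inner_smul_right, form,
    Pi.smul_apply, Pi.smul_apply, smul_eq_mul, smul_eq_mul]
  ring

/-- The graph of the operator associated with the form: the pairs `(f, h)` with `f` in the form
domain, `h ∈ L²(ℝ)`, and `t(f, g) = ⟨h, g⟩` for all `g` in the form domain. -/
def operatorGraph (z : ℂ) (b : ℝ) : Submodule ℂ (L2 × L2) where
  carrier := {p | p.1 ∈ formDomain ∧ ∀ g ∈ formDomain, form z b p.1 g = inner ℂ g p.2}
  zero_mem' := by
    refine ⟨formDomain.zero_mem, fun g _ => ?_⟩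
    have := form_smul z b 0 (f := 0) (g := g) formDomain.zero_mem
    simpa using this
  add_mem' := by
    rintro p q ⟨hp, hp'⟩ ⟨hq, hq'⟩
    refine ⟨formDomain.add_mem hp hq, fun g hg => ?_⟩
    rw [Prod.fst_add, Prod.snd_add, form_add z b hp hq hg, hp' g hg, hq' g hg, inner_add_right]
  smul_mem' := by
    rintro a p ⟨hp, hp'⟩
    refine ⟨formDomain.smul_mem a hp, fun g hg => ?_⟩
    rw [Prod.smul_fst, Prod.smul_snd, form_smul z b a hp, hp' g hg, inner_smul_right]

/-- The operator `-y'' + (x²/4 - 1/2) y + z (δ(x - b) - δ(x + b)) y` on `L²(ℝ)`, defined by the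
quadratic form method. -/
def pcOperator (z : ℂ) (b : ℝ) : L2 →ₗ.[ℂ] L2 := (operatorGraph z b).toLinearPMap

/-- Test functions lie in the form domain. -/
theorem exists_mem_formDomain {φ : ℝ → ℝ} (hφ : ContDiff ℝ ∞ φ) (hc : HasCompactSupport φ) :
    ∃ f ∈ formDomain, f =ᵐ[volume] fun x => (φ x : ℂ) := by
  have mem : ∀ ψ : ℝ → ℝ, Continuous ψ → HasCompactSupport ψ →
      MemLp (fun x => (ψ x : ℂ)) 2 volume := fun ψ hψ hψc =>
    (Complex.continuous_ofReal.comp hψ).memLp_of_hasCompactSupport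
      (hψc.comp_left Complex.ofReal_zero)
  have hd := continuous_deriv_of_smooth hφ
  have m0 := mem φ hφ.continuous hc
  have m1 := mem (deriv φ) hd hc.deriv
  refine ⟨m0.toLp _, ⟨⟨m1.toLp _, ?_⟩, ?_⟩, m0.coeFn_toLp⟩
  · intro χ hχ hχc
    have e1 : ∫ x, deriv χ x • (m0.toLp _ : L2) x = ((∫ x, φ x * deriv χ x : ℝ) : ℂ) := by
      rw [← integral_complex_ofReal]
      apply integral_congr_ae
      filter_upwards [m0.coeFn_toLp] with x hx
      rw [hx, Complex.real_smul]; push_cast; ring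
    have e2 : ∫ x, χ x • (m1.toLp _ : L2) x = ((∫ x, deriv φ x * χ x : ℝ) : ℂ) := by
      rw [← integral_complex_ofReal]
      apply integral_congr_ae
      filter_upwards [m1.coeFn_toLp] with x hx
      rw [hx, Complex.real_smul]; push_cast; ring
    have hdχ := continuous_deriv_of_smooth hχ
    rw [e1, e2, ← Complex.ofReal_neg]
    congr 1
    refine integral_mul_deriv_eq_deriv_mul_of_integrable
      (fun x _ => (hφ.differentiable (by simp) x).hasDerivAt)
      (fun x _ => (hχ.differentiable (by simp) x).hasDerivAt) ?_ ?_ ?_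
    · exact (hφ.continuous.mul hdχ).integrable_of_hasCompactSupport hc.mul_right
    · exact (hd.mul hχ.continuous).integrable_of_hasCompactSupport hc.deriv.mul_right
    · exact (hφ.continuous.mul hχ.continuous).integrable_of_hasCompactSupport hc.mul_right
  · refine (mem (fun x => x * φ x) (continuous_id.mul hφ.continuous) hc.mul_left).ae_eq ?_
    filter_upwards [m0.coeFn_toLp] with x hx
    rw [hx]; push_cast; ring

/-- The graph of `pcOperator z b` is `operatorGraph z b`, because the form domain is dense. -/
theorem pcOperator_graph (z : ℂ) (b : ℝ) : (pcOperator z b).graph = operatorGraph z b := by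
  refine Submodule.toLinearPMap_graph_eq _ ?_
  rintro ⟨f, h⟩ ⟨hf, hh⟩ (hf0 : f = 0)
  subst hf0
  have hz : ∀ g ∈ formDomain, inner ℂ g h = 0 := fun g hg => by
    have h1 := form_smul z b 0 (f := 0) (g := g) formDomain.zero_mem
    rw [zero_mul, smul_zero] at h1
    rw [← hh g hg, h1]
  change h = 0
  apply Lp.ext
  refine Filter.EventuallyEq.trans ?_ (Lp.coeFn_zero ℂ 2 (volume : Measure ℝ)).symm
  refine ae_eq_zero_of_integral_contDiff_smul_eq_zero (L2.locallyIntegrable h) ?_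
  intro φ hφ hc
  obtain ⟨g, hg, hgφ⟩ := exists_mem_formDomain hφ hc
  rw [← hz g hg, L2.inner_def]
  apply integral_congr_ae
  filter_upwards [hgφ] with x hx
  rw [hx, RCLike.inner_apply, Complex.conj_ofReal, Complex.real_smul, mul_comm]

end

end OddPair

/-! Off the points `±b`, an equation `(L - ν) f = h` is an ordinary differential equation. The
interactions keep `f` continuous and force its derivative to jump by `z f(b)` at `b` and by `-z
f(-b)` at `-b`. Write `A = coefA ν`, `B = coefB ν`, so that `D_ν = A y_even - B y_odd`. With middle
piece `α y_even + β y_odd` and `h = 0`, the unit Wronskian shows that the jump at `b` adds `z f(b)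
(-y_odd(b), y_even(b))` to `(α, β)`; passing `-b` to the left adds `z f(-b) (y_odd(b), y_even(b))`.
The outer pieces must be multiples of `D_ν(x)` and `D_ν(-x)`. These are two linear conditions on
`(α, β)`, `matchRight` and `matchLeft`, with determinant `2 (A B - z² D_ν(b)² y_even(b) y_odd(b))`.
Legendre duplication evaluates `A B` (`coefA_mul_coefB`).

If the determinant vanishes, a kernel vector glues to an eigenfunction (`exists_eigenfunction`, by
`mem_operatorGraph_of_glue`). This needs `D_ν` to decay (`rapidDecay_parabolicD`): an integral
representation covers `Re ν < 0` and the three-term recurrence carries decay to all `ν`.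

If it does not vanish, injectivity needs no growth estimate for a second solution. The Wronskian of
an eigenfunction with `D_ν` is constant on each outer half-line and is integrable there, hence zero,
and the matching conditions follow (`eq_zero_of_mem_operatorGraph`). For surjectivity, add a large
compactly supported cutoff `χ`: then `t - ν + χ` is coercive on the form domain and has a bounded
solution operator `S` (`exists_cutoff_resolvent`). Since `(L - ν) S h = h - χ S h`, it remains to
solve with the continuous compactly supported source `χ S h`, where variation of parameters and the
same 2×2 system apply (`exists_solution`). The closed graph theorem bounds the inverse
(`exists_resolvent`). -/

namespace OddPair

noncomputable section

/-! ### The power series -/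

/-- The product `μ (μ + 2) ⋯ (μ + 2 (k - 1))`. -/
def stepProd (μ : ℂ) (k : ℕ) : ℂ := ∏ j ∈ Finset.range k, (μ + 2 * (j : ℂ))

theorem stepProd_zero (μ : ℂ) : stepProd μ 0 = 1 := by simp [stepProd]

theorem stepProd_succ (μ : ℂ) (k : ℕ) : stepProd μ (k + 1) = stepProd μ k * (μ + 2 * k) := by
  simp [stepProd, Finset.prod_range_succ]

/-- Peeling off the first factor shifts the base by 2. This is why differentiating the even series
with parameter `ν` gives the odd series with parameter `ν - 1`. -/
theorem stepProd_succ_left (μ : ℂ) (k : ℕ) : stepProd μ (k + 1) = μ * stepProd (μ + 2) k := by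
  induction k with
  | zero => simp [stepProd]
  | succ k ih =>
    rw [stepProd_succ, ih, stepProd_succ]; push_cast; ring

/-- The terms of the even series. -/
def evenTerm (ν x : ℂ) (k : ℕ) : ℂ := stepProd (-ν) k * x ^ (2 * k) / ((2 * k).factorial : ℂ)

/-- The terms of the odd series. -/
def oddTerm (ν x : ℂ) (k : ℕ) : ℂ :=
  stepProd (-ν + 1) k * x ^ (2 * k + 1) / ((2 * k + 1).factorial : ℂ)

theorem yEven_eq (ν x : ℂ) : yEven ν x = Complex.exp (-x ^ 2 / 4) * ∑' k, evenTerm ν x k := rfl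

theorem yOdd_eq (ν x : ℂ) : yOdd ν x = Complex.exp (-x ^ 2 / 4) * ∑' k, oddTerm ν x k := rfl

theorem summable_norm_of_ratio_tendsto_zero {f r : ℕ → ℂ} (h : ∀ k, f (k + 1) = f k * r k)
    (hr : Filter.Tendsto r Filter.atTop (nhds 0)) : Summable (fun k => ‖f k‖) := by
  have hf : Summable f := by
    refine summable_of_ratio_norm_eventually_le (r := 1 / 2) (by norm_num) ?_
    have h0 : Filter.Tendsto (fun k => ‖r k‖) Filter.atTop (nhds 0) := by simpa using hr.norm
    filter_upwards [h0.eventually_le_const (u := 1 / 2) (by norm_num)] with k hk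
    rw [h, norm_mul, mul_comm]
    gcongr
  exact hf.norm

/-- The quotient `(μ + 2k) / (2k + a) = 1 + (μ - a) / (2k + a)` tends to 1, and the remaining `(2k +
b)⁻¹` tends to 0. -/
theorem tendsto_ratio_zero (μ x a b : ℂ) :
    Filter.Tendsto (fun k : ℕ => (μ + 2 * k) * x ^ 2 * ((2 * k + a)⁻¹ * (2 * k + b)⁻¹))
      Filter.atTop (nhds 0) := by
  have hk : ∀ c : ℂ, Filter.Tendsto (fun k : ℕ => 2 * (k : ℂ) + c) Filter.atTop
      (Bornology.cobounded ℂ) := fun c => by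
    rw [← tendsto_norm_atTop_iff_cobounded]
    have h : Filter.Tendsto (fun k : ℕ => 2 * (k : ℝ) + -‖c‖) Filter.atTop Filter.atTop :=
      Filter.tendsto_atTop_add_const_right _ _
        (tendsto_natCast_atTop_atTop.const_mul_atTop two_pos)
    refine Filter.tendsto_atTop_mono (fun k => ?_) h
    have := norm_sub_le (2 * (k : ℂ) + c) c
    rw [add_sub_cancel_right, norm_mul, Complex.norm_natCast, Complex.norm_two] at this
    linarith
  have hi : ∀ c : ℂ, Filter.Tendsto (fun k : ℕ => (2 * (k : ℂ) + c)⁻¹) Filter.atTop (nhds 0) :=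
    fun c => Filter.tendsto_inv₀_cobounded.comp (hk c)
  have h1 : Filter.Tendsto (fun k : ℕ => 1 + (μ - a) * (2 * (k : ℂ) + a)⁻¹) Filter.atTop
      (nhds (1 + (μ - a) * 0)) := ((hi a).const_mul _).const_add _
  have h2 := (h1.mul (hi b)).mul_const (x ^ 2)
  rw [mul_zero, zero_mul] at h2
  refine h2.congr' ?_
  have hne : ∀ᶠ k : ℕ in Filter.atTop, 2 * (k : ℂ) + a ≠ 0 :=
    (hk a).eventually (Bornology.eventually_ne_cobounded 0)
  filter_upwards [hne] with k h
  have : (μ + 2 * k) * (2 * k + a)⁻¹ = 1 + (μ - a) * (2 * (k : ℂ) + a)⁻¹ := by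
    field_simp; ring
  rw [← this]; ring

theorem evenTerm_succ (ν x : ℂ) (k : ℕ) : evenTerm ν x (k + 1) =
    evenTerm ν x k * ((-ν + 2 * k) * x ^ 2 * ((2 * (k : ℂ) + 1)⁻¹ * (2 * (k : ℂ) + 2)⁻¹)) := by
  rw [evenTerm, evenTerm, stepProd_succ, show 2 * (k + 1) = 2 * k + 1 + 1 by ring,
    Nat.factorial_succ, Nat.factorial_succ]
  push_cast
  have h1 : (2 * (k : ℂ) + 1) ≠ 0 := by exact_mod_cast Nat.succ_ne_zero (2 * k)
  have h2 : (2 * (k : ℂ) + 2) ≠ 0 := by exact_mod_cast Nat.succ_ne_zero (2 * k + 1)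
  have h2' : (2 * (k : ℂ) + 1 + 1) ≠ 0 := by exact_mod_cast Nat.succ_ne_zero (2 * k + 1)
  have h3 : ((2 * k).factorial : ℂ) ≠ 0 := by exact_mod_cast Nat.factorial_ne_zero _
  field_simp
  ring

theorem oddTerm_succ (ν x : ℂ) (k : ℕ) : oddTerm ν x (k + 1) =
    oddTerm ν x k * ((-ν + 1 + 2 * k) * x ^ 2 * ((2 * (k : ℂ) + 2)⁻¹ * (2 * (k : ℂ) + 3)⁻¹)) := by
  rw [oddTerm, oddTerm, stepProd_succ, show 2 * (k + 1) + 1 = 2 * k + 1 + 1 + 1 by ring,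
    Nat.factorial_succ, Nat.factorial_succ]
  push_cast
  have h1 : (2 * (k : ℂ) + 3) ≠ 0 := by exact_mod_cast Nat.succ_ne_zero (2 * k + 2)
  have h2 : (2 * (k : ℂ) + 2) ≠ 0 := by exact_mod_cast Nat.succ_ne_zero (2 * k + 1)
  have h3 : ((2 * k + 1).factorial : ℂ) ≠ 0 := by exact_mod_cast Nat.factorial_ne_zero _
  rw [show 2 * (k : ℂ) + 2 + 1 = 2 * k + 3 by ring, show 2 * (k : ℂ) + 1 + 1 = 2 * k + 2 by ring]
  field_simp
  ring

theorem summable_norm_evenTerm (ν x : ℂ) : Summable (fun k => ‖evenTerm ν x k‖) :=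
  summable_norm_of_ratio_tendsto_zero (evenTerm_succ ν x) (tendsto_ratio_zero _ _ _ _)

theorem summable_norm_oddTerm (ν x : ℂ) : Summable (fun k => ‖oddTerm ν x k‖) :=
  summable_norm_of_ratio_tendsto_zero (oddTerm_succ ν x) (tendsto_ratio_zero _ _ _ _)

theorem hasSum_evenTerm (ν x : ℂ) : HasSum (evenTerm ν x) (∑' k, evenTerm ν x k) :=
  (summable_norm_evenTerm ν x).of_norm.hasSum

theorem hasSum_oddTerm (ν x : ℂ) : HasSum (oddTerm ν x) (∑' k, oddTerm ν x k) :=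
  (summable_norm_oddTerm ν x).of_norm.hasSum

/-- Each term is a monomial in `x`, so its value at radius `r` is a Weierstrass majorant on the
disc, which justifies termwise differentiation. -/
theorem norm_evenTerm_le {ν w : ℂ} {r : ℝ} (hw : ‖w‖ ≤ r) (k : ℕ) :
    ‖evenTerm ν w k‖ ≤ ‖evenTerm ν r k‖ := by
  simp only [evenTerm, norm_div, norm_mul, norm_pow]
  have : ‖w‖ ≤ ‖(r : ℂ)‖ := by
    rw [Complex.norm_real]; exact hw.trans (le_abs_self r)
  gcongr

theorem norm_oddTerm_le {ν w : ℂ} {r : ℝ} (hw : ‖w‖ ≤ r) (k : ℕ) :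
    ‖oddTerm ν w k‖ ≤ ‖oddTerm ν r k‖ := by
  simp only [oddTerm, norm_div, norm_mul, norm_pow]
  have : ‖w‖ ≤ ‖(r : ℂ)‖ := by
    rw [Complex.norm_real]; exact hw.trans (le_abs_self r)
  gcongr

theorem hasDerivAt_evenTerm_succ (ν x : ℂ) (k : ℕ) :
    HasDerivAt (fun w => evenTerm ν w (k + 1)) (-ν * oddTerm (ν - 1) x k) x := by
  have h := ((hasDerivAt_pow (2 * (k + 1)) x).const_mul (stepProd (-ν) (k + 1))).div_const
    ((2 * (k + 1)).factorial : ℂ)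
  refine h.congr_deriv ?_
  rw [oddTerm, stepProd_succ_left, show 2 * (k + 1) - 1 = 2 * k + 1 by omega,
    show 2 * (k + 1) = 2 * k + 1 + 1 by ring, Nat.factorial_succ (2 * k + 1),
    show -(ν - 1) + 1 = -ν + 2 by ring]
  have h2 : ((2 * k + 1 + 1 : ℕ) : ℂ) ≠ 0 := by exact_mod_cast Nat.succ_ne_zero (2 * k + 1)
  have h3 : ((2 * k + 1).factorial : ℂ) ≠ 0 := by exact_mod_cast Nat.factorial_ne_zero _
  rw [Nat.cast_mul]
  field_simp

theorem hasDerivAt_oddTerm (ν x : ℂ) (k : ℕ) :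
    HasDerivAt (fun w => oddTerm ν w k) (evenTerm (ν - 1) x k) x := by
  have h := ((hasDerivAt_pow (2 * k + 1) x).const_mul (stepProd (-ν + 1) k)).div_const
    ((2 * k + 1).factorial : ℂ)
  refine h.congr_deriv ?_
  rw [evenTerm, Nat.add_sub_cancel, Nat.factorial_succ (2 * k), show -(ν - 1) = -ν + 1 by ring]
  have h2 : ((2 * k + 1 : ℕ) : ℂ) ≠ 0 := by exact_mod_cast Nat.succ_ne_zero (2 * k)
  have h3 : ((2 * k).factorial : ℂ) ≠ 0 := by exact_mod_cast Nat.factorial_ne_zero _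
  rw [Nat.cast_mul]
  field_simp

theorem evenTerm_zero (ν x : ℂ) : evenTerm ν x 0 = 1 := by simp [evenTerm, stepProd_zero]

theorem hasDerivAt_tsum_evenTerm (ν x : ℂ) :
    HasDerivAt (fun w => ∑' k, evenTerm ν w k) (-ν * ∑' k, oddTerm (ν - 1) x k) x := by
  have hd : ∀ k, Differentiable ℂ (fun w => evenTerm ν w k) := fun k => by
    unfold evenTerm; fun_prop
  have hx : x ∈ Metric.ball (0 : ℂ) (‖x‖ + 1) := by simp
  have hle : ∀ (k : ℕ) (w : ℂ), w ∈ Metric.ball (0 : ℂ) (‖x‖ + 1) →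
      ‖evenTerm ν w k‖ ≤ ‖evenTerm ν (‖x‖ + 1 : ℝ) k‖ := fun k w hw =>
    norm_evenTerm_le (by simpa using (mem_ball_zero_iff.1 hw).le) k
  have h1 := Complex.hasSum_deriv_of_summable_norm
    (summable_norm_evenTerm ν (‖x‖ + 1 : ℝ)) (fun k => (hd k).differentiableOn)
    Metric.isOpen_ball hle hx
  have h2 := (Complex.differentiableOn_tsum_of_summable_norm
    (summable_norm_evenTerm ν (‖x‖ + 1 : ℝ)) (fun k => (hd k).differentiableOn)
    Metric.isOpen_ball hle).differentiableAt (Metric.isOpen_ball.mem_nhds hx)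
  refine h2.hasDerivAt.congr_deriv ?_
  refine h1.unique ?_
  -- The constant term differentiates to zero, so the derived series starts one index later.
  rw [← hasSum_nat_add_iff' 1]
  simp only [(hasDerivAt_evenTerm_succ ν x _).deriv, Finset.range_one, Finset.sum_singleton,
    evenTerm_zero, deriv_const, sub_zero]
  exact (hasSum_oddTerm (ν - 1) x).mul_left _

theorem hasDerivAt_tsum_oddTerm (ν x : ℂ) :
    HasDerivAt (fun w => ∑' k, oddTerm ν w k) (∑' k, evenTerm (ν - 1) x k) x := by
  have hd : ∀ k, Differentiable ℂ (fun w => oddTerm ν w k) := fun k => by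
    unfold oddTerm; fun_prop
  have hx : x ∈ Metric.ball (0 : ℂ) (‖x‖ + 1) := by simp
  have hle : ∀ (k : ℕ) (w : ℂ), w ∈ Metric.ball (0 : ℂ) (‖x‖ + 1) →
      ‖oddTerm ν w k‖ ≤ ‖oddTerm ν (‖x‖ + 1 : ℝ) k‖ := fun k w hw =>
    norm_oddTerm_le (by simpa using (mem_ball_zero_iff.1 hw).le) k
  have h1 := Complex.hasSum_deriv_of_summable_norm
    (summable_norm_oddTerm ν (‖x‖ + 1 : ℝ)) (fun k => (hd k).differentiableOn)
    Metric.isOpen_ball hle hx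
  have h2 := (Complex.differentiableOn_tsum_of_summable_norm
    (summable_norm_oddTerm ν (‖x‖ + 1 : ℝ)) (fun k => (hd k).differentiableOn)
    Metric.isOpen_ball hle).differentiableAt (Metric.isOpen_ball.mem_nhds hx)
  refine h2.hasDerivAt.congr_deriv ?_
  refine h1.unique ?_
  simp only [(hasDerivAt_oddTerm ν x _).deriv]
  exact hasSum_evenTerm (ν - 1) x

/-! ### Ladder relations and the differential equation -/

theorem hasDerivAt_exp_neg_sq (x : ℂ) : HasDerivAt (fun w : ℂ => Complex.exp (-w ^ 2 / 4))
    (-(x / 2) * Complex.exp (-x ^ 2 / 4)) x := by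
  have h : HasDerivAt (fun w : ℂ => -w ^ 2 / 4) (-(x / 2)) x := by
    refine ((hasDerivAt_pow 2 x).neg.div_const 4).congr_deriv ?_
    norm_num; ring
  exact h.cexp.congr_deriv (mul_comm _ _)

/-- The derivative of `yEven ν`. -/
def yEven' (ν x : ℂ) : ℂ := -(x / 2) * yEven ν x - ν * yOdd (ν - 1) x

/-- The derivative of `yOdd ν`. -/
def yOdd' (ν x : ℂ) : ℂ := -(x / 2) * yOdd ν x + yEven (ν - 1) x

theorem hasDerivAt_yEven (ν x : ℂ) : HasDerivAt (yEven ν) (yEven' ν x) x := by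
  refine ((hasDerivAt_exp_neg_sq x).mul (hasDerivAt_tsum_evenTerm ν x)).congr_deriv ?_
  rw [yEven', yEven_eq, yOdd_eq]; ring

theorem hasDerivAt_yOdd (ν x : ℂ) : HasDerivAt (yOdd ν) (yOdd' ν x) x := by
  refine ((hasDerivAt_exp_neg_sq x).mul (hasDerivAt_tsum_oddTerm ν x)).congr_deriv ?_
  rw [yOdd', yEven_eq, yOdd_eq]; ring

/-- A ladder relation, by comparing coefficients. With the first-derivative formulas it yields the
differential equation without a second termwise differentiation, and later the recurrence for `D_ν`.
-/
theorem mul_yEven_add (ν x : ℂ) :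
    x * yEven ν x + ν * yOdd (ν - 1) x = (1 + ν) * yOdd (ν + 1) x := by
  have h : x * ∑' k, evenTerm ν x k + ν * ∑' k, oddTerm (ν - 1) x k =
      (1 + ν) * ∑' k, oddTerm (ν + 1) x k := by
    refine (((hasSum_evenTerm ν x).mul_left x).add
      ((hasSum_oddTerm (ν - 1) x).mul_left ν)).unique ?_
    convert! (hasSum_oddTerm (ν + 1) x).mul_left (1 + ν) using 2 with k
    -- The same product with `k + 1` factors, peeled from its two ends.
    have e : ν * stepProd (-ν + 2) k = (ν - 2 * k) * stepProd (-ν) k := by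
      have h1 := stepProd_succ (-ν) k
      rw [stepProd_succ_left] at h1
      linear_combination -h1
    rw [evenTerm, oddTerm, oddTerm, Nat.factorial_succ (2 * k),
      show -(ν - 1) + 1 = -ν + 2 by ring, show -(ν + 1) + 1 = -ν by ring]
    have h2 : (2 * (k : ℂ) + 1) ≠ 0 := by exact_mod_cast Nat.succ_ne_zero (2 * k)
    have h3 : ((2 * k).factorial : ℂ) ≠ 0 := by exact_mod_cast Nat.factorial_ne_zero _
    push_cast
    field_simp
    linear_combination x ^ (2 * k + 1) * e
  rw [yEven_eq, yOdd_eq, yOdd_eq]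
  linear_combination Complex.exp (-x ^ 2 / 4) * h

theorem mul_yOdd_sub (ν x : ℂ) : x * yOdd ν x - yEven (ν - 1) x = -yEven (ν + 1) x := by
  have h : ∑' k, evenTerm (ν - 1) x k - ∑' k, evenTerm (ν + 1) x k =
      x * ∑' k, oddTerm ν x k := by
    refine ((hasSum_evenTerm (ν - 1) x).sub (hasSum_evenTerm (ν + 1) x)).unique ?_
    rw [← hasSum_nat_add_iff' 1]
    simp only [Finset.range_one, Finset.sum_singleton, evenTerm_zero, sub_self, sub_zero]
    convert! (hasSum_oddTerm ν x).mul_left x using 2 with k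
    rw [evenTerm, evenTerm, oddTerm, show 2 * (k + 1) = 2 * k + 1 + 1 by ring,
      Nat.factorial_succ (2 * k + 1), stepProd_succ, stepProd_succ_left (-(ν + 1)),
      show -(ν - 1) = -ν + 1 by ring, show -(ν + 1) + 2 = -ν + 1 by ring]
    have h2 : (2 * (k : ℂ) + 1 + 1) ≠ 0 := by exact_mod_cast Nat.succ_ne_zero (2 * k + 1)
    have h3 : ((2 * k + 1).factorial : ℂ) ≠ 0 := by exact_mod_cast Nat.factorial_ne_zero _
    push_cast
    field_simp
    ring
  rw [yEven_eq, yEven_eq, yOdd_eq]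
  linear_combination -Complex.exp (-x ^ 2 / 4) * h

/-- Differentiating the ladder form of `yEven'` lowers the parameter to `ν - 2`; the ladder relation
at `ν - 1` brings it back to `ν`. -/
theorem hasDerivAt_yEven' (ν x : ℂ) :
    HasDerivAt (yEven' ν) ((x ^ 2 / 4 - 1 / 2 - ν) * yEven ν x) x := by
  refine ((((hasDerivAt_id x).div_const 2).neg.mul (hasDerivAt_yEven ν x)).sub
    ((hasDerivAt_yOdd (ν - 1) x).const_mul ν)).congr_deriv ?_
  have h := mul_yOdd_sub (ν - 1) x
  rw [sub_add_cancel] at h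
  simp only [Pi.neg_apply, id, yEven', yOdd']
  linear_combination ν * h

theorem hasDerivAt_yOdd' (ν x : ℂ) :
    HasDerivAt (yOdd' ν) ((x ^ 2 / 4 - 1 / 2 - ν) * yOdd ν x) x := by
  refine ((((hasDerivAt_id x).div_const 2).neg.mul (hasDerivAt_yOdd ν x)).add
    (hasDerivAt_yEven (ν - 1) x)).congr_deriv ?_
  have h := mul_yEven_add (ν - 1) x
  rw [sub_add_cancel] at h
  simp only [Pi.neg_apply, id, yEven', yOdd']
  linear_combination -h

theorem yEven_zero (ν : ℂ) : yEven ν 0 = 1 := by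
  rw [yEven_eq, tsum_eq_single 0 (fun k hk => by simp [evenTerm, hk])]
  simp [evenTerm_zero]

theorem yOdd_zero (ν : ℂ) : yOdd ν 0 = 0 := by
  rw [yOdd_eq]; simp [oddTerm]

theorem yEven_neg (ν x : ℂ) : yEven ν (-x) = yEven ν x := by
  simp only [yEven_eq, evenTerm, pow_mul, neg_sq]

theorem yOdd_neg (ν x : ℂ) : yOdd ν (-x) = -yOdd ν x := by
  have h : ∀ k, oddTerm ν (-x) k = -oddTerm ν x k := fun k => by
    rw [oddTerm, oddTerm, Odd.neg_pow ⟨k, rfl⟩]; ring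
  rw [yOdd_eq, yOdd_eq, neg_sq, tsum_congr h, tsum_neg, mul_neg]

theorem yEven'_neg (ν x : ℂ) : yEven' ν (-x) = -yEven' ν x := by
  rw [yEven', yEven', yEven_neg, yOdd_neg]; ring

theorem yOdd'_neg (ν x : ℂ) : yOdd' ν (-x) = yOdd' ν x := by
  rw [yOdd', yOdd', yEven_neg, yOdd_neg]; ring

/-- The equation has no first-order term, so the Wronskian is constant; its value is read off at the
origin. -/
theorem wronskian_yEven_yOdd (ν x : ℂ) :
    yEven ν x * yOdd' ν x - yEven' ν x * yOdd ν x = 1 := by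
  have hd : ∀ w, HasDerivAt (fun w => yEven ν w * yOdd' ν w - yEven' ν w * yOdd ν w) 0 w := by
    intro w
    refine (((hasDerivAt_yEven ν w).mul (hasDerivAt_yOdd' ν w)).sub
      ((hasDerivAt_yEven' ν w).mul (hasDerivAt_yOdd ν w))).congr_deriv ?_
    ring
  have := is_const_of_deriv_eq_zero (fun w => (hd w).differentiableAt) (fun w => (hd w).deriv) x 0
  rw [this]
  simp [yEven', yOdd', yEven_zero, yOdd_zero]

/-! ### The coefficients of the parabolic cylinder function -/

/-- The coefficient of `yEven` in `parabolicD`. -/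
def coefA (ν : ℂ) : ℂ := (2 : ℂ) ^ (ν / 2) * (√Real.pi : ℂ) * recipGamma (-ν / 2 + 1 / 2)

/-- The negative of the coefficient of `yOdd` in `parabolicD`. -/
def coefB (ν : ℂ) : ℂ := (2 : ℂ) ^ ((ν + 1) / 2) * (√Real.pi : ℂ) * recipGamma (-ν / 2)

theorem parabolicD_eq (ν x : ℂ) :
    parabolicD ν x = coefA ν * yEven ν x - coefB ν * yOdd ν x := rfl

theorem two_cpow_ne_zero (s : ℂ) : (2 : ℂ) ^ s ≠ 0 := by
  rw [Ne, Complex.cpow_eq_zero_iff]; simp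

theorem sqrt_pi_ne_zero : (√Real.pi : ℂ) ≠ 0 := by
  rw [Ne, Complex.ofReal_eq_zero, Real.sqrt_eq_zero Real.pi_pos.le]; exact Real.pi_ne_zero

theorem coefA_add_one (ν : ℂ) : coefA (ν + 1) = coefB ν := by
  rw [coefA, coefB, show -(ν + 1) / 2 + 1 / 2 = -ν / 2 by ring]

/-- The reciprocal functional equation `1/Γ(s) = s/Γ(s + 1)`, valid also at the poles. With
`coefA_add_one` it matches the ladder relations of the two series. -/
theorem coefB_add_one (ν : ℂ) : coefB (ν + 1) = -(1 + ν) * coefA ν := by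
  rw [coefA, coefB, recipGamma, Complex.one_div_Gamma_eq_self_mul_one_div_Gamma_add_one,
    show -(ν + 1) / 2 + 1 = -ν / 2 + 1 / 2 by ring, recipGamma,
    show (ν + 1 + 1) / 2 = ν / 2 + 1 by ring, Complex.cpow_add _ _ two_ne_zero, Complex.cpow_one]
  ring

theorem coefA_eq_zero_iff (ν : ℂ) : coefA ν = 0 ↔ ∃ m : ℕ, ν = 2 * m + 1 := by
  rw [coefA, mul_eq_zero, or_iff_right (mul_ne_zero (two_cpow_ne_zero _) sqrt_pi_ne_zero),
    recipGamma, inv_eq_zero, Complex.Gamma_eq_zero_iff]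
  refine exists_congr fun m => ⟨fun h => ?_, fun h => ?_⟩
  · linear_combination -2 * h
  · rw [h]; ring

theorem coefB_eq_zero_iff (ν : ℂ) : coefB ν = 0 ↔ ∃ m : ℕ, ν = 2 * m := by
  rw [coefB, mul_eq_zero, or_iff_right (mul_ne_zero (two_cpow_ne_zero _) sqrt_pi_ne_zero),
    recipGamma, inv_eq_zero, Complex.Gamma_eq_zero_iff]
  refine exists_congr fun m => ⟨fun h => ?_, fun h => ?_⟩
  · linear_combination -2 * h
  · rw [h]; ring

/-- One coefficient vanishes only at odd and the other only at even natural numbers, so `D_ν` is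
never the zero solution. -/
theorem coefA_ne_zero_or_coefB_ne_zero (ν : ℂ) : coefA ν ≠ 0 ∨ coefB ν ≠ 0 := by
  by_contra! h
  obtain ⟨m, hm⟩ := (coefA_eq_zero_iff ν).1 h.1
  obtain ⟨n, hn⟩ := (coefB_eq_zero_iff ν).1 h.2
  rw [hm] at hn
  have : 2 * m + 1 = 2 * n := by exact_mod_cast hn
  omega

/-- Legendre duplication at `-ν/2`. The poles need no exception: there both sides vanish. -/
theorem coefA_mul_coefB (ν : ℂ) :
    coefA ν * coefB ν = (√Real.pi : ℂ) / (√2 : ℂ) * recipGamma (-ν) := by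
  have h := Complex.Gamma_mul_Gamma_add_half (-ν / 2)
  have h2 : (√2 : ℂ) = (2 : ℂ) ^ (1 / 2 : ℂ) := by
    rw [Real.sqrt_eq_rpow, Complex.ofReal_cpow zero_le_two]; norm_num
  have h3 : (2 : ℂ) ^ (ν / 2) * (2 : ℂ) ^ ((ν + 1) / 2) * (2 : ℂ) ^ (1 / 2 : ℂ) =
      (2 : ℂ) ^ (1 - 2 * (-ν / 2)) := by
    rw [← Complex.cpow_add _ _ two_ne_zero, ← Complex.cpow_add _ _ two_ne_zero]
    congr 1; ring
  rw [show 2 * (-ν / 2) = -ν by ring] at h h3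
  have hA : coefA ν * coefB ν = (2 : ℂ) ^ (ν / 2) * (2 : ℂ) ^ ((ν + 1) / 2) *
      ((√Real.pi : ℂ) * (√Real.pi : ℂ)) *
      (Complex.Gamma (-ν / 2) * Complex.Gamma (-ν / 2 + 1 / 2))⁻¹ := by
    rw [coefA, coefB, recipGamma, recipGamma, mul_inv]; ring
  have hp := sqrt_pi_ne_zero
  have h4 := two_cpow_ne_zero (1 / 2)
  have h5 := two_cpow_ne_zero (ν / 2)
  have h6 := two_cpow_ne_zero ((ν + 1) / 2)
  rw [hA, h, h2, ← h3, recipGamma]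
  simp only [mul_inv]
  field_simp

theorem coefB_eq (ν : ℂ) : coefB ν = -ν * coefA (ν - 1) := by
  have := coefB_add_one (ν - 1)
  rw [sub_add_cancel] at this
  rw [this]; ring

theorem coefA_eq (ν : ℂ) : coefA ν = coefB (ν - 1) := by
  rw [← coefA_add_one, sub_add_cancel]

/-- The derivative of `parabolicD ν`. -/
def parabolicD' (ν x : ℂ) : ℂ := coefA ν * yEven' ν x - coefB ν * yOdd' ν x

/-- Reduces the decay of the derivative to the decay of `D_ν` and `D_{ν-1}`. -/
theorem parabolicD'_eq (ν x : ℂ) :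
    parabolicD' ν x = -(x / 2) * parabolicD ν x + ν * parabolicD (ν - 1) x := by
  rw [parabolicD', parabolicD_eq, parabolicD_eq, yEven', yOdd', ← coefA_eq]
  linear_combination -yEven (ν - 1) x * coefB_eq ν

theorem parabolicD_add_one (ν x : ℂ) :
    parabolicD (ν + 1) x = x * parabolicD ν x - ν * parabolicD (ν - 1) x := by
  rw [parabolicD_eq, parabolicD_eq, parabolicD_eq, coefA_add_one, coefB_add_one, ← coefA_eq]
  linear_combination coefB ν * mul_yOdd_sub ν x - coefA ν * mul_yEven_add ν x +
    yEven (ν - 1) x * coefB_eq ν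

/-! ### The integral representation -/

/-- The Gaussian moment `∫ t^{s-1} e^{-t²/2} dt` over `(0, ∞)`. -/
def gaussMoment (s : ℂ) : ℂ := (2 : ℂ) ^ (s / 2 - 1) * Complex.Gamma (s / 2)

/-- The substitution `u = t²` turns the moment into a Gamma integral. -/
theorem integral_cpow_mul_exp_neg_sq {s : ℂ} (hs : 0 < s.re) :
    ∫ t in Set.Ioi (0 : ℝ), (t : ℂ) ^ (s - 1) * (Real.exp (-(t ^ 2 / 2)) : ℂ) =
      gaussMoment s := by
  have h := mellin_comp_rpow (fun t : ℝ => (Real.exp (-(1 / 2 * t)) : ℂ)) s 2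
  have hs2 : 0 < (s / (2 : ℝ)).re := by
    rw [Complex.div_ofReal_re]; positivity
  have h1 := Complex.integral_cpow_mul_exp_neg_mul_Ioi hs2 (one_half_pos (α := ℝ))
  rw [mellin, mellin] at h
  have e1 : ∫ t in Set.Ioi (0 : ℝ), (t : ℂ) ^ (s - 1) * (Real.exp (-(t ^ 2 / 2)) : ℂ) =
      ∫ t in Set.Ioi (0 : ℝ), (t : ℂ) ^ (s - 1) • (Real.exp (-(1 / 2 * t ^ (2 : ℝ))) : ℂ) := by
    congr 1; ext t
    rw [smul_eq_mul, Real.rpow_two, one_div_mul_eq_div]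
  have e2 : ∫ t in Set.Ioi (0 : ℝ), (t : ℂ) ^ (s / (2 : ℝ) - 1) • (Real.exp (-(1 / 2 * t)) : ℂ) =
      (1 / ((1 / 2 : ℝ) : ℂ)) ^ (s / (2 : ℝ)) * Complex.Gamma (s / (2 : ℝ)) := by
    rw [← h1]
    congr 1; ext t
    rw [smul_eq_mul]; push_cast; rfl
  rw [e1, h, e2, gaussMoment, Complex.cpow_sub _ _ two_ne_zero, Complex.cpow_one]
  have : (1 / ((1 / 2 : ℝ) : ℂ)) = 2 := by push_cast; norm_num
  rw [this, abs_of_pos two_pos, Complex.real_smul]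
  push_cast
  ring

theorem gaussMoment_add_two {s : ℂ} (hs : s ≠ 0) : gaussMoment (s + 2) = s * gaussMoment s := by
  rw [gaussMoment, gaussMoment, show (s + 2) / 2 = s / 2 + 1 by ring,
    Complex.Gamma_add_one _ (div_ne_zero hs two_ne_zero), add_sub_cancel_right,
    Complex.cpow_sub _ _ two_ne_zero, Complex.cpow_one]
  ring

/-- Ratios of Gaussian moments are exactly the products in the even and odd series; this identifies
the Laplace integral below with those series. -/
theorem gaussMoment_add_two_mul {s : ℂ} (hs : 0 < s.re) (k : ℕ) :
    gaussMoment (s + 2 * k) = stepProd s k * gaussMoment s := by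
  induction k with
  | zero => simp [stepProd_zero]
  | succ k ih =>
    have hne : s + 2 * k ≠ 0 := fun h => by
      have := congrArg Complex.re h
      simp at this
      have hk : (0 : ℝ) ≤ k := k.cast_nonneg
      linarith
    rw [stepProd_succ, show s + 2 * ((k + 1 : ℕ) : ℂ) = s + 2 * k + 2 by push_cast; ring,
      gaussMoment_add_two hne, ih]
    ring

theorem integrableOn_gauss_weight {σ c : ℝ} (hσ : 0 < σ) (hc : 0 < c) :
    IntegrableOn (fun t : ℝ => t ^ (σ - 1) * Real.exp (-c * t ^ 2)) (Set.Ioi 0) :=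
  integrableOn_rpow_mul_exp_neg_mul_sq hc (by linarith)

theorem continuousOn_cpow_ofReal (s : ℂ) :
    ContinuousOn (fun t : ℝ => (t : ℂ) ^ s) (Set.Ioi 0) := fun t ht =>
  (Complex.continuousAt_ofReal_cpow_const t s (Or.inr (ne_of_gt ht))).continuousWithinAt

/-- Expand `e^{-xt}` and integrate termwise, dominated by the same series with `|x| t`, whose sum
the Gaussian still absorbs. -/
theorem hasSum_gaussLaplace {s : ℂ} (hs : 0 < s.re) (x : ℝ) :
    HasSum (fun n : ℕ => (-(x : ℂ)) ^ n / (n.factorial : ℂ) * gaussMoment (s + n))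
      (∫ t in Set.Ioi (0 : ℝ), (t : ℂ) ^ (s - 1) * (Real.exp (-(t ^ 2 / 2)) : ℂ) *
        Complex.exp (-(x : ℂ) * t)) := by
  let F : ℕ → ℝ → ℂ := fun n t => (t : ℂ) ^ (s - 1) * (Real.exp (-(t ^ 2 / 2)) : ℂ) *
    ((-(x : ℂ) * t) ^ n / (n.factorial : ℂ))
  let bd : ℕ → ℝ → ℝ := fun n t => t ^ (s.re - 1) * Real.exp (-(t ^ 2 / 2)) *
    ((|x| * t) ^ n / (n.factorial : ℝ))
  have hcont : ∀ n, ContinuousOn (F n) (Set.Ioi 0) := fun n => by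
    refine ((continuousOn_cpow_ofReal (s - 1)).mul ?_).mul ?_
    · exact Continuous.continuousOn (by fun_prop)
    · exact Continuous.continuousOn (by fun_prop)
  have hbs : ∀ t : ℝ, HasSum (fun n => bd n t)
      (t ^ (s.re - 1) * Real.exp (-(t ^ 2 / 2)) * Real.exp (|x| * t)) := fun t => by
    have h := NormedSpace.expSeries_div_hasSum_exp (|x| * t)
    rw [← Real.exp_eq_exp_ℝ] at h
    exact h.mul_left _
  have key := hasSum_integral_of_dominated_convergence (μ := volume.restrict (Set.Ioi 0))
    (F := F) (f := fun t : ℝ => (t : ℂ) ^ (s - 1) * (Real.exp (-(t ^ 2 / 2)) : ℂ) *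
        Complex.exp (-(x : ℂ) * t)) bd
    (fun n => (hcont n).aestronglyMeasurable measurableSet_Ioi) ?_ ?_ ?_ ?_
  · convert! key using 2 with n
    rw [← integral_cpow_mul_exp_neg_sq (s := s + n) (by
      simp only [Complex.add_re, Complex.natCast_re]
      positivity), ← integral_const_mul]
    refine setIntegral_congr_fun measurableSet_Ioi fun t ht => ?_
    have ht0 : (t : ℂ) ≠ 0 := by exact_mod_cast (ne_of_gt ht)
    simp only [F]
    rw [show s + n - 1 = (s - 1) + n by ring, Complex.cpow_add _ _ ht0, Complex.cpow_natCast,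
      mul_pow]
    ring
  · intro n
    filter_upwards [ae_restrict_mem measurableSet_Ioi] with t ht
    have ht' : (0 : ℝ) < t := ht
    simp only [F, bd]
    rw [norm_mul, norm_mul, Complex.norm_cpow_eq_rpow_re_of_pos ht', Complex.norm_real,
      Real.norm_of_nonneg (Real.exp_pos _).le, norm_div, norm_pow, norm_mul, norm_neg,
      Complex.norm_real, Complex.norm_real, Complex.norm_natCast, Real.norm_eq_abs,
      Real.norm_eq_abs, abs_of_pos ht']
    simp
  · exact Filter.Eventually.of_forall fun t => (hbs t).summable
  · simp_rw [fun t => (hbs t).tsum_eq]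
    refine Integrable.mono' ((integrableOn_gauss_weight hs (c := 1 / 4) (by norm_num)).const_mul
      (Real.exp (x ^ 2))) ?_ ?_
    · refine ContinuousOn.aestronglyMeasurable ?_ measurableSet_Ioi
      refine ((continuousOn_id.rpow_const fun t ht => Or.inl (ne_of_gt ht)).mul ?_).mul ?_
      · exact Continuous.continuousOn (by fun_prop)
      · exact Continuous.continuousOn (by fun_prop)
    · filter_upwards [ae_restrict_mem measurableSet_Ioi] with t ht
      have ht' : (0 : ℝ) < t := ht
      rw [Real.norm_of_nonneg (by positivity), mul_assoc, ← Real.exp_add, mul_left_comm,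
        ← Real.exp_add]
      refine mul_le_mul_of_nonneg_left (Real.exp_le_exp.2 ?_) (by positivity)
      -- The claim `|x| t - t²/2 ≤ x² - t²/4` is `(t/2 - |x|)² ≥ 0`: half of the Gaussian exponent
      -- absorbs `e^{|x|t}`.
      nlinarith [sq_nonneg (t / 2 - |x|), sq_abs x]
  · refine Filter.Eventually.of_forall fun t => ?_
    rw [Complex.exp_eq_exp_ℂ]
    exact (NormedSpace.expSeries_div_hasSum_exp (-(x : ℂ) * t)).mul_left _

theorem gaussLaplace_eq {s : ℂ} (hs : 0 < s.re) (x : ℝ) :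
    ∫ t in Set.Ioi (0 : ℝ), (t : ℂ) ^ (s - 1) * (Real.exp (-(t ^ 2 / 2)) : ℂ) *
        Complex.exp (-(x : ℂ) * t) =
      gaussMoment s * ∑' k, evenTerm (-s) x k - gaussMoment (s + 1) * ∑' k, oddTerm (-s) x k := by
  refine (hasSum_gaussLaplace hs x).unique ?_
  rw [sub_eq_add_neg, ← neg_mul]
  refine HasSum.even_add_odd ?_ ?_
  · convert! (hasSum_evenTerm (-s) x).mul_left (gaussMoment s) using 2 with k
    rw [Nat.cast_mul, Nat.cast_two, gaussMoment_add_two_mul hs, evenTerm, neg_neg,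
      Even.neg_pow ⟨k, by ring⟩]
    ring
  · convert! (hasSum_oddTerm (-s) x).mul_left (-gaussMoment (s + 1)) using 2 with k
    have hs1 : 0 < (s + 1).re := by simp only [Complex.add_re, Complex.one_re]; linarith
    rw [show s + ((2 * k + 1 : ℕ) : ℂ) = s + 1 + 2 * k by push_cast; ring,
      gaussMoment_add_two_mul hs1, oddTerm, neg_neg, Odd.neg_pow ⟨k, rfl⟩]
    ring

/-- By duplication at `s/2`, the normalisation of `D_ν` agrees with that of the Laplace integral;
`coefB_mul_Gamma` does the same for the odd part. -/
theorem coefA_mul_Gamma {s : ℂ} (hs : 0 < s.re) :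
    coefA (-s) * Complex.Gamma s = gaussMoment s := by
  have h := Complex.Gamma_mul_Gamma_add_half (s / 2)
  rw [show 2 * (s / 2) = s by ring] at h
  have hg : Complex.Gamma (s / 2 + 1 / 2) ≠ 0 := Complex.Gamma_ne_zero_of_re_pos (by
    simp; linarith)
  have h2 : (2 : ℂ) ^ (s / 2 - 1) * (2 : ℂ) ^ (1 - s) = (2 : ℂ) ^ (-s / 2) := by
    rw [← Complex.cpow_add _ _ two_ne_zero]; congr 1; ring
  have h3 : (2 : ℂ) ^ (s / 2 - 1) ≠ 0 := two_cpow_ne_zero _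
  rw [coefA, gaussMoment, recipGamma, neg_neg, ← h2]
  generalize Complex.Gamma (s / 2 + 1 / 2) = G at *
  field_simp
  linear_combination -h

theorem coefB_mul_Gamma {s : ℂ} (hs : 0 < s.re) :
    coefB (-s) * Complex.Gamma s = gaussMoment (s + 1) := by
  have h := Complex.Gamma_mul_Gamma_add_half (s / 2)
  rw [show 2 * (s / 2) = s by ring] at h
  have hg : Complex.Gamma (s / 2) ≠ 0 := Complex.Gamma_ne_zero_of_re_pos (by simpa using hs)
  have h2 : (2 : ℂ) ^ ((s + 1) / 2 - 1) * (2 : ℂ) ^ (1 - s) = (2 : ℂ) ^ ((-s + 1) / 2) := by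
    rw [← Complex.cpow_add _ _ two_ne_zero]; congr 1; ring
  have h3 : (2 : ℂ) ^ ((s + 1) / 2 - 1) ≠ 0 := two_cpow_ne_zero _
  rw [coefB, gaussMoment, recipGamma, neg_neg, ← h2, show (s + 1) / 2 = s / 2 + 1 / 2 by ring]
  rw [show (s + 1) / 2 = s / 2 + 1 / 2 by ring] at h3
  generalize Complex.Gamma (s / 2 + 1 / 2) = G at *
  field_simp
  linear_combination -h

/-- The classical integral representation. For `x ≥ 0` its integral is bounded independently of `x`,
so the prefactor gives the decay. -/
theorem parabolicD_mul_Gamma {ν : ℂ} (hν : ν.re < 0) (x : ℝ) :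
    parabolicD ν x * Complex.Gamma (-ν) = Complex.exp (-(x : ℂ) ^ 2 / 4) *
      ∫ t in Set.Ioi (0 : ℝ), (t : ℂ) ^ (-ν - 1) * (Real.exp (-(t ^ 2 / 2)) : ℂ) *
        Complex.exp (-(x : ℂ) * t) := by
  have hs : 0 < (-ν).re := by simpa using hν
  have hA := coefA_mul_Gamma hs
  have hB := coefB_mul_Gamma hs
  rw [neg_neg] at hA hB
  rw [gaussLaplace_eq hs, ← hA, ← hB, neg_neg, parabolicD_eq, yEven_eq, yOdd_eq]
  ring

/-! ### Decay at infinity -/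

/-- `g` decays at `+∞` faster than every power. -/
def RapidDecay (g : ℝ → ℂ) : Prop :=
  ∀ n : ℕ, (fun x : ℝ => (x : ℂ) ^ n * g x) =O[Filter.atTop] fun _ => (1 : ℝ)

theorem RapidDecay.add {g h : ℝ → ℂ} (hg : RapidDecay g) (hh : RapidDecay h) :
    RapidDecay fun x => g x + h x := fun n =>
  ((hg n).add (hh n)).congr_left fun x => by ring

theorem RapidDecay.const_mul {g : ℝ → ℂ} (hg : RapidDecay g) (c : ℂ) :
    RapidDecay fun x => c * g x := fun n =>
  ((hg n).const_mul_left c).congr_left fun x => by ring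

/-- Closure under multiplication by `x` is what lets this notion of decay pass through the
three-term recurrence. -/
theorem RapidDecay.ofReal_mul {g : ℝ → ℂ} (hg : RapidDecay g) :
    RapidDecay fun x => (x : ℂ) * g x := fun n =>
  (hg (n + 1)).congr_left fun x => by ring

theorem rapidDecay_of_norm_le {g : ℝ → ℂ} {C : ℝ}
    (h : ∀ x : ℝ, 0 ≤ x → ‖g x‖ ≤ C * Real.exp (-(1 / 4) * x ^ 2)) : RapidDecay g := by
  intro n
  have h0 := (rpow_mul_exp_neg_mul_sq_isLittleO_exp_neg (b := 1 / 4) (by norm_num) n).isBigO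
  have h1 : (fun x : ℝ => Real.exp (-(1 / 2) * x)) =O[Filter.atTop] fun _ => (1 : ℝ) := by
    refine Asymptotics.IsBigO.of_bound 1 ?_
    filter_upwards [Filter.eventually_ge_atTop 0] with x hx
    rw [Real.norm_of_nonneg (Real.exp_pos _).le, norm_one, mul_one, Real.exp_le_one_iff]
    linarith
  refine Asymptotics.IsBigO.trans (Asymptotics.IsBigO.of_bound C ?_) (h0.trans h1)
  filter_upwards [Filter.eventually_ge_atTop 0] with x hx
  rw [norm_mul, norm_pow, Complex.norm_real, Real.norm_of_nonneg hx, Real.rpow_natCast,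
    Real.norm_of_nonneg (by positivity), mul_left_comm]
  exact mul_le_mul_of_nonneg_left (h x hx) (by positivity)

theorem rapidDecay_parabolicD_of_neg {ν : ℂ} (hν : ν.re < 0) :
    RapidDecay fun x : ℝ => parabolicD ν x := by
  have hs : 0 < (-ν).re := by simpa using hν
  have hG : Complex.Gamma (-ν) ≠ 0 := Complex.Gamma_ne_zero_of_re_pos hs
  -- The integral of the absolute value of the integrand at `x = 0`, which is its largest value over
  -- `x ≥ 0`.
  let K : ℝ := ∫ t in Set.Ioi (0 : ℝ), t ^ ((-ν).re - 1) * Real.exp (-(1 / 2) * t ^ 2)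
  refine rapidDecay_of_norm_le (C := K * ‖(Complex.Gamma (-ν))⁻¹‖) fun x hx => ?_
  have h := parabolicD_mul_Gamma hν x
  have hD : parabolicD ν x = Complex.exp (-(x : ℂ) ^ 2 / 4) *
      (∫ t in Set.Ioi (0 : ℝ), (t : ℂ) ^ (-ν - 1) * (Real.exp (-(t ^ 2 / 2)) : ℂ) *
        Complex.exp (-(x : ℂ) * t)) * (Complex.Gamma (-ν))⁻¹ := by
    rw [← h, mul_assoc, mul_inv_cancel₀ hG, mul_one]
  have hI : ‖∫ t in Set.Ioi (0 : ℝ), (t : ℂ) ^ (-ν - 1) * (Real.exp (-(t ^ 2 / 2)) : ℂ) *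
        Complex.exp (-(x : ℂ) * t)‖ ≤ K := by
    refine norm_integral_le_of_norm_le (integrableOn_gauss_weight hs (by norm_num)) ?_
    filter_upwards [ae_restrict_mem measurableSet_Ioi] with t ht
    have ht' : (0 : ℝ) < t := ht
    rw [norm_mul, norm_mul, Complex.norm_cpow_eq_rpow_re_of_pos ht', Complex.norm_real,
      Real.norm_of_nonneg (Real.exp_pos _).le, Complex.norm_exp, Complex.sub_re, Complex.one_re,
      show -(1 / 2) * t ^ 2 = -(t ^ 2 / 2) by ring]
    refine mul_le_of_le_one_right (by positivity) ?_
    rw [Real.exp_le_one_iff]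
    simp only [Complex.mul_re, Complex.neg_re, Complex.ofReal_re, Complex.neg_im,
      Complex.ofReal_im, neg_zero, mul_zero, sub_zero]
    nlinarith
  have hE : ‖Complex.exp (-(x : ℂ) ^ 2 / 4)‖ = Real.exp (-(1 / 4) * x ^ 2) := by
    rw [show -(x : ℂ) ^ 2 / 4 = ((-(1 / 4) * x ^ 2 : ℝ) : ℂ) by push_cast; ring,
      ← Complex.ofReal_exp, Complex.norm_real, Real.norm_of_nonneg (Real.exp_pos _).le]
  rw [hD, norm_mul, norm_mul, hE]
  calc Real.exp (-(1 / 4) * x ^ 2) * ‖_‖ * ‖(Complex.Gamma (-ν))⁻¹‖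
      ≤ Real.exp (-(1 / 4) * x ^ 2) * K * ‖(Complex.Gamma (-ν))⁻¹‖ := by gcongr
    _ = _ := by ring

/-- Induction on a natural number above `Re ν`: the recurrence expresses `D_ν` through `D_{ν-1}` and
`D_{ν-2}`, which both fall under the previous bound. -/
theorem rapidDecay_parabolicD (ν : ℂ) : RapidDecay fun x : ℝ => parabolicD ν x := by
  have h : ∀ m : ℕ, ∀ ν : ℂ, ν.re < m → RapidDecay fun x : ℝ => parabolicD ν x := by
    intro m
    induction m with
    | zero => exact fun ν hν => rapidDecay_parabolicD_of_neg (by simpa using hν)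
    | succ m ih =>
      intro ν hν
      push_cast at hν
      have h1 := ih (ν - 1) (by simp only [Complex.sub_re, Complex.one_re]; linarith)
      have h2 := ih (ν - 1 - 1) (by simp only [Complex.sub_re, Complex.one_re]; linarith)
      have h3 := h1.ofReal_mul.add (h2.const_mul (-(ν - 1)))
      refine fun n => (h3 n).congr_left fun x => ?_
      have := parabolicD_add_one (ν - 1) x
      rw [sub_add_cancel] at this
      simp only [this]; ring
  obtain ⟨m, hm⟩ := exists_nat_gt ν.re
  exact h m ν hm

theorem rapidDecay_parabolicD' (ν : ℂ) : RapidDecay fun x : ℝ => parabolicD' ν x := by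
  have h := ((rapidDecay_parabolicD ν).ofReal_mul.const_mul (-(1 / 2))).add
    ((rapidDecay_parabolicD (ν - 1)).const_mul ν)
  refine fun n => (h n).congr_left fun x => ?_
  simp only [parabolicD'_eq]; ring

theorem RapidDecay.memLp {g : ℝ → ℂ} (hg : RapidDecay g) (hc : Continuous g) (a : ℝ) :
    MemLp g 2 (volume.restrict (Set.Ioi a)) := by
  rw [memLp_two_iff_integrable_sq_norm hc.aestronglyMeasurable]
  have hl : LocallyIntegrableOn (fun x => ‖g x‖ ^ 2) (Set.Ici a) :=
    (hc.norm.pow 2).locallyIntegrable.locallyIntegrableOn _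
  refine (hl.integrableOn_of_isBigO_atTop (g := fun x : ℝ => x ^ (-2 : ℝ)) ?_ ?_).mono_set
    Set.Ioi_subset_Ici_self
  -- One power of `x` suffices: `|g|² = O(x⁻²)`.
  · obtain ⟨C, hC⟩ := (hg 1).bound
    refine Asymptotics.IsBigO.of_bound (C ^ 2) ?_
    filter_upwards [hC, Filter.eventually_gt_atTop 0] with x hx h0
    rw [norm_one, mul_one, pow_one, norm_mul, Complex.norm_real, Real.norm_of_nonneg h0.le] at hx
    rw [Real.norm_of_nonneg (by positivity), Real.norm_of_nonneg (by positivity),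
      Real.rpow_neg h0.le, Real.rpow_two, ← div_eq_mul_inv, le_div_iff₀ (by positivity),
      ← mul_pow, mul_comm]
    gcongr
  · rw [integrableAtFilter_rpow_atTop_iff]; norm_num

/-! ### Integration by parts -/

theorem intervalIntegrable_of_locallyIntegrable {g : ℝ → ℂ} (hg : LocallyIntegrable g volume)
    (a c : ℝ) : IntervalIntegrable g volume a c :=
  (hg.integrableOn_isCompact isCompact_uIcc).intervalIntegrable

/-- A primitive of a merely locally integrable `g` is absolutely continuous, so this is integration
by parts for absolutely continuous functions. The next results pass to complex `g` and then to
complex `P` through real and imaginary parts. -/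
theorem integral_mul_primitive_real {P P' g : ℝ → ℝ} (hP : ∀ x, HasDerivAt P (P' x) x)
    (hP' : Continuous P') (hg : LocallyIntegrable g volume) (a c : ℝ) :
    ∫ x in a..c, P x * g x =
      P c * (∫ t in a..c, g t) - ∫ x in a..c, P' x * ∫ t in a..x, g t := by
  have hd : deriv P = P' := funext fun x => (hP x).deriv
  have hPc : ContDiff ℝ 1 P := by
    rw [contDiff_one_iff_deriv, hd]
    exact ⟨fun x => (hP x).differentiableAt, hP'⟩
  have hi : IntervalIntegrable g volume a c :=
    (hg.integrableOn_isCompact isCompact_uIcc).intervalIntegrable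
  have hU := hi.absolutelyContinuousOnInterval_intervalIntegral (c := a) Set.left_mem_uIcc
  have key := (hPc.contDiffOn.absolutelyContinuousOnInterval (a := a)
    (b := c)).integral_mul_deriv_eq_deriv_mul hU
  rw [intervalIntegral.integral_same, mul_zero, sub_zero, hd] at key
  rw [← key]
  apply intervalIntegral.integral_congr_ae
  filter_upwards [LocallyIntegrable.ae_hasDerivAt_integral hg] with x hx _
  rw [(hx a).deriv]

theorem integral_smul_primitive {P P' : ℝ → ℝ} {g : ℝ → ℂ} (hP : ∀ x, HasDerivAt P (P' x) x)
    (hP' : Continuous P') (hg : LocallyIntegrable g volume) (a c : ℝ) :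
    ∫ x in a..c, P x • g x =
      P c • (∫ t in a..c, g t) - ∫ x in a..c, P' x • ∫ t in a..x, g t := by
  have hPc : Continuous P := continuous_iff_continuousAt.2 fun x => (hP x).continuousAt
  have hi := intervalIntegrable_of_locallyIntegrable hg
  have hu : Continuous (fun x => ∫ t in a..x, g t) :=
    intervalIntegral.continuous_primitive hi a
  have i1 : IntervalIntegrable (fun x => P x • g x) volume a c :=
    (hi a c).continuousOn_smul hPc.continuousOn
  have i2 : IntervalIntegrable (fun x => P' x • ∫ t in a..x, g t) volume a c :=
    (hP'.smul hu).intervalIntegrable a c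
  have gen : ∀ L : ℂ →L[ℝ] ℝ, L (∫ x in a..c, P x • g x) =
      L (P c • (∫ t in a..c, g t) - ∫ x in a..c, P' x • ∫ t in a..x, g t) := by
    intro L
    have hLg : LocallyIntegrable (fun x => L (g x)) volume := by
      intro x
      obtain ⟨s, hs, hgs⟩ := hg x
      exact ⟨s, hs, L.integrable_comp hgs⟩
    rw [map_sub, map_smul, ← L.intervalIntegral_comp_comm i1, ← L.intervalIntegral_comp_comm i2,
      ← L.intervalIntegral_comp_comm (hi a c)]
    simp only [map_smul, smul_eq_mul]
    rw [integral_mul_primitive_real hP hP' hLg]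
    congr 2
    ext x
    rw [L.intervalIntegral_comp_comm (hi a x)]
  apply Complex.ext
  · exact gen Complex.reCLM
  · exact gen Complex.imCLM

/-- `G` is a primitive of the locally integrable function `g`. -/
structure IsPrimitive (G g : ℝ → ℂ) : Prop where
  locallyIntegrable : LocallyIntegrable g volume
  integral_eq : ∀ x y, ∫ t in x..y, g t = G y - G x

theorem IsPrimitive.conj {G g : ℝ → ℂ} (h : IsPrimitive G g) :
    IsPrimitive (fun x => conj (G x)) (fun x => conj (g x)) := by
  refine ⟨fun x => ?_, fun x y => ?_⟩
  · obtain ⟨s, hs, hgs⟩ := h.locallyIntegrable x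
    exact ⟨s, hs, Complex.conjCLE.toContinuousLinearMap.integrable_comp hgs⟩
  · rw [intervalIntegral.intervalIntegral_conj, h.integral_eq, map_sub]

theorem IsPrimitive.integral_mul_eq {G g P P' : ℝ → ℂ} (h : IsPrimitive G g)
    (hP : ∀ x, HasDerivAt P (P' x) x) (hP' : Continuous P') (a c : ℝ) :
    (∫ x in a..c, P x * g x) + ∫ x in a..c, P' x * G x = P c * G c - P a * G a := by
  have hi := intervalIntegrable_of_locallyIntegrable h.locallyIntegrable
  have hPc : Continuous P := continuous_iff_continuousAt.2 fun x => (hP x).continuousAt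
  have hu : Continuous (fun x => ∫ t in a..x, g t) := intervalIntegral.continuous_primitive hi a
  have hre := integral_smul_primitive
    (fun x => Complex.reCLM.hasFDerivAt.comp_hasDerivAt x (hP x))
    (Complex.continuous_re.comp hP') h.locallyIntegrable a c
  have him := integral_smul_primitive
    (fun x => Complex.imCLM.hasFDerivAt.comp_hasDerivAt x (hP x))
    (Complex.continuous_im.comp hP') h.locallyIntegrable a c
  simp only [Function.comp_apply, Complex.reCLM_apply, Complex.imCLM_apply,
    Complex.real_smul] at hre him
  have hsplit : ∀ w v : ℂ, w * v = (w.re : ℂ) * v + Complex.I * ((w.im : ℂ) * v) := fun w v => by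
    conv_lhs => rw [← Complex.re_add_im w]
    ring
  have hint : ∀ (Q : ℝ → ℝ), Continuous Q →
      IntervalIntegrable (fun x => (Q x : ℂ) * g x) volume a c := fun Q hQ =>
    (hi a c).continuousOn_mul (Complex.continuous_ofReal.comp hQ).continuousOn
  have hint' : ∀ (Q : ℝ → ℝ), Continuous Q →
      IntervalIntegrable (fun x => (Q x : ℂ) * ∫ t in a..x, g t) volume a c := fun Q hQ =>
    ((Complex.continuous_ofReal.comp hQ).mul hu).intervalIntegrable a c
  have e1 : ∫ x in a..c, P x * g x =
      P c * (∫ t in a..c, g t) - ∫ x in a..c, P' x * ∫ t in a..x, g t := by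
    simp_rw [fun x => hsplit (P x) (g x), fun x => hsplit (P' x) (∫ t in a..x, g t)]
    rw [intervalIntegral.integral_add (hint (fun x => (P x).re) (Complex.continuous_re.comp hPc))
        ((hint (fun x => (P x).im) (Complex.continuous_im.comp hPc)).const_mul _),
      intervalIntegral.integral_add (hint' (fun x => (P' x).re) (Complex.continuous_re.comp hP'))
        ((hint' (fun x => (P' x).im) (Complex.continuous_im.comp hP')).const_mul _),
      intervalIntegral.integral_const_mul, intervalIntegral.integral_const_mul, hre, him,
      hsplit (P c)]
    ring
  have e2 : ∫ x in a..c, P' x = P c - P a :=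
    intervalIntegral.integral_eq_sub_of_hasDerivAt (fun x _ => hP x) (hP'.intervalIntegrable a c)
  have e3 : ∫ x in a..c, P' x * G x =
      (∫ x in a..c, P' x * G a) + ∫ x in a..c, P' x * ∫ t in a..x, g t := by
    have j1 : IntervalIntegrable (fun x => P' x * G a) volume a c :=
      (hP'.mul continuous_const).intervalIntegrable a c
    have j2 : IntervalIntegrable (fun x => P' x * ∫ t in a..x, g t) volume a c :=
      (hP'.mul hu).intervalIntegrable a c
    rw [← intervalIntegral.integral_add j1 j2]
    congr 1; ext x
    rw [h.integral_eq]; ring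
  rw [e1, e3, intervalIntegral.integral_mul_const, e2, h.integral_eq]
  ring

/-- No limit at infinity is assumed. Convergence of the two integrals makes `P G` converge, and
since `P G` is integrable on a half-line its limit can only be 0. -/
theorem IsPrimitive.integral_Ioi_mul_eq {G g P P' : ℝ → ℂ} (h : IsPrimitive G g)
    (hP : ∀ x, HasDerivAt P (P' x) x) (hP' : Continuous P') {a : ℝ}
    (i1 : IntegrableOn (fun x => P x * g x) (Set.Ioi a))
    (i2 : IntegrableOn (fun x => P' x * G x) (Set.Ioi a))
    (i3 : IntegrableOn (fun x => P x * G x) (Set.Ioi a)) :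
    (∫ x in Set.Ioi a, P x * g x) + ∫ x in Set.Ioi a, P' x * G x = -(P a * G a) := by
  have t := (intervalIntegral_tendsto_integral_Ioi a i1 Filter.tendsto_id).add
    (intervalIntegral_tendsto_integral_Ioi a i2 Filter.tendsto_id)
  simp only [id, h.integral_mul_eq hP hP'] at t
  have t' := t.add_const (P a * G a)
  simp only [sub_add_cancel] at t'
  have h0 := IntegrableAtFilter.eq_zero_of_tendsto
    (⟨Set.Ioi a, Filter.Ioi_mem_atTop _, i3⟩ : IntegrableAtFilter _ Filter.atTop volume) (by
      intro s hs
      obtain ⟨c, hc⟩ := Filter.mem_atTop_sets.1 hs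
      rw [← top_le_iff, ← Real.volume_Ici (a := c)]
      exact measure_mono hc) t'
  exact eq_neg_of_add_eq_zero_left h0

theorem IsPrimitive.integral_Iic_mul_eq {G g P P' : ℝ → ℂ} (h : IsPrimitive G g)
    (hP : ∀ x, HasDerivAt P (P' x) x) (hP' : Continuous P') {a : ℝ}
    (i1 : IntegrableOn (fun x => P x * g x) (Set.Iic a))
    (i2 : IntegrableOn (fun x => P' x * G x) (Set.Iic a))
    (i3 : IntegrableOn (fun x => P x * G x) (Set.Iic a)) :
    (∫ x in Set.Iic a, P x * g x) + ∫ x in Set.Iic a, P' x * G x = P a * G a := by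
  have t := (intervalIntegral_tendsto_integral_Iic a i1 Filter.tendsto_id).add
    (intervalIntegral_tendsto_integral_Iic a i2 Filter.tendsto_id)
  simp only [id, h.integral_mul_eq hP hP'] at t
  have t' := t.const_sub (P a * G a)
  simp only [sub_sub_cancel] at t'
  have h0 := IntegrableAtFilter.eq_zero_of_tendsto
    (⟨Set.Iic a, Filter.Iic_mem_atBot _, i3⟩ : IntegrableAtFilter _ Filter.atBot volume) (by
      intro s hs
      obtain ⟨c, hc⟩ := Filter.mem_atBot_sets.1 hs
      rw [← top_le_iff, ← Real.volume_Iic (a := c)]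
      exact measure_mono hc) t'
  exact (sub_eq_zero.1 h0).symm

/-! ### Continuous representatives -/

/-- The fundamental theorem of calculus in `H¹`: subtracting a primitive of the weak derivative
leaves a function with zero weak derivative, hence a constant. -/
theorem isPrimitive_contRep {f : L2} (h : f ∈ sobolevH1) :
    IsPrimitive (contRep f) (weakDeriv f) := by
  have hg := hasWeakDeriv_weakDeriv h
  generalize weakDeriv f = g at hg ⊢
  have hgl := L2.locallyIntegrable g
  have hi := intervalIntegrable_of_locallyIntegrable hgl
  have hu : Continuous (fun x => ∫ t in (0 : ℝ)..x, g t) :=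
    intervalIntegral.continuous_primitive hi 0
  obtain ⟨c, hc⟩ := ae_const_of_weakDeriv_zero
    (v := fun x => f x - ∫ t in (0 : ℝ)..x, g t)
    ((L2.locallyIntegrable f).sub hu.locallyIntegrable) (by
      intro φ hφ hc
      have hd := continuous_deriv_of_smooth hφ
      have j : Integrable (fun x => deriv φ x • (∫ t in (0 : ℝ)..x, g t)) :=
        (hd.smul hu).integrable_of_hasCompactSupport hc.deriv.smul_right
      simp_rw [smul_sub]
      rw [integral_sub (L2.integrable_smul f hd hc.deriv) j, hg φ hφ hc,
        integral_deriv_smul_primitive hgl hφ hc, sub_self])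
  have hrep : contRep f = fun x => c + ∫ t in (0 : ℝ)..x, g t := by
    refine contRep_eq (continuous_const.add hu) ?_
    filter_upwards [hc] with x hx
    rw [← hx]; ring
  refine ⟨hgl, fun x y => ?_⟩
  rw [hrep, ← intervalIntegral.integral_add_adjacent_intervals (hi x 0) (hi 0 y),
    intervalIntegral.integral_symm 0 x]
  ring

theorem integral_deriv_of_hasCompactSupport {φ : ℝ → ℝ} (hφ : ContDiff ℝ ∞ φ)
    (hc : HasCompactSupport φ) : ∫ x, deriv φ x = 0 :=
  integral_eq_zero_of_hasDerivAt_of_integrable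
    (fun x => (hφ.differentiable (by simp) x).hasDerivAt)
    ((continuous_deriv_of_smooth hφ).integrable_of_hasCompactSupport hc.deriv)
    (hφ.continuous.integrable_of_hasCompactSupport hc)

theorem hasWeakDeriv_of_isPrimitive {f g : L2} {u v : ℝ → ℂ} (hf : f =ᵐ[volume] u)
    (hg : g =ᵐ[volume] v) (h : IsPrimitive u v) : HasWeakDeriv f g := by
  intro φ hφ hc
  have hd := continuous_deriv_of_smooth hφ
  have hi := intervalIntegrable_of_locallyIntegrable h.locallyIntegrable
  have hu : Continuous (fun x => ∫ t in (0 : ℝ)..x, v t) :=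
    intervalIntegral.continuous_primitive hi 0
  have e1 : ∫ x, deriv φ x • f x = ∫ x, (deriv φ x • u 0 + deriv φ x • ∫ t in (0 : ℝ)..x, v t) := by
    apply integral_congr_ae
    filter_upwards [hf] with x hx
    rw [hx, h.integral_eq, ← smul_add]; congr 1; ring
  have e2 : ∫ x, φ x • g x = ∫ x, φ x • v x := by
    apply integral_congr_ae
    filter_upwards [hg] with x hx
    rw [hx]
  have j : Integrable (fun x => deriv φ x • (∫ t in (0 : ℝ)..x, v t)) :=
    (hd.smul hu).integrable_of_hasCompactSupport hc.deriv.smul_right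
  have j0 : Integrable (fun x => deriv φ x • u 0) :=
    (hd.integrable_of_hasCompactSupport hc.deriv).smul_const _
  rw [e1, e2, integral_add j0 j, integral_deriv_smul_primitive h.locallyIntegrable hφ hc,
    integral_smul_const, integral_deriv_of_hasCompactSupport hφ hc, zero_smul, zero_add]

theorem contRep_add {f g : L2} (hf : f ∈ sobolevH1) (hg : g ∈ sobolevH1) :
    contRep (f + g) = contRep f + contRep g :=
  contRep_eq ((contRep_spec hf).1.add (contRep_spec hg).1)
    ((Lp.coeFn_add f g).trans ((contRep_spec hf).2.add (contRep_spec hg).2))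

theorem contRep_smul (a : ℂ) {f : L2} (hf : f ∈ sobolevH1) :
    contRep (a • f) = a • contRep f :=
  contRep_eq ((contRep_spec hf).1.const_smul a)
    ((Lp.coeFn_smul a f).trans ((contRep_spec hf).2.const_smul a))

/-- Cauchy–Schwarz against the indicator of the interval. -/
theorem norm_intervalIntegral_le (f : L2) {a c : ℝ} (h : a ≤ c) :
    ‖∫ x in a..c, f x‖ ≤ √(c - a) * ‖f‖ := by
  have hμ : volume (Set.Ioc a c) ≠ ⊤ := by simp
  rw [intervalIntegral.integral_of_le h,
    ← L2.inner_indicatorConstLp_one (𝕜 := ℂ) measurableSet_Ioc hμ f]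
  refine (norm_inner_le_norm _ _).trans_eq ?_
  rw [norm_indicatorConstLp (by norm_num) (by norm_num), norm_one, one_mul,
    Real.volume_real_Ioc_of_le h, Real.sqrt_eq_rpow]
  norm_num

/-- The point evaluation on `H¹(ℝ)` has relative bound zero. -/
theorem norm_contRep_le {f : L2} (h : f ∈ sobolevH1) (a : ℝ) {δ : ℝ} (hδ : 0 < δ) :
    δ * ‖contRep f a‖ ≤ √δ * ‖f‖ + δ * (√δ * ‖weakDeriv f‖) := by
  have hp := isPrimitive_contRep h
  have hle : a ≤ a + δ := by linarith
  have e1 : ∫ y in a..(a + δ), f y = ∫ y in a..(a + δ), contRep f y :=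
    intervalIntegral.integral_congr_ae (by
      filter_upwards [(contRep_spec h).2] with x hx _ using hx)
  have hc : Continuous fun y => ∫ t in a..y, weakDeriv f t :=
    intervalIntegral.continuous_primitive
      (intervalIntegrable_of_locallyIntegrable hp.locallyIntegrable) a
  have e2 : (∫ y in a..(a + δ), contRep f y) =
      (δ : ℂ) * contRep f a + ∫ y in a..(a + δ), ∫ t in a..y, weakDeriv f t := by
    have : (δ : ℂ) * contRep f a = ∫ _ in a..(a + δ), contRep f a := by simp
    rw [this, ← intervalIntegral.integral_add (by simp) (hc.intervalIntegrable _ _)]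
    congr 1; ext y
    rw [hp.integral_eq]; ring
  -- The value at `a` is averaged over `[a, a + δ]`. After division by `δ` the derivative carries
  -- the factor `√δ`, which can be made small.
  have e3 : (δ : ℂ) * contRep f a =
      (∫ y in a..(a + δ), f y) - ∫ y in a..(a + δ), ∫ t in a..y, weakDeriv f t := by
    rw [e1, e2]; ring
  have b1 := norm_intervalIntegral_le f hle
  have b2 : ‖∫ y in a..(a + δ), ∫ t in a..y, weakDeriv f t‖ ≤
      √δ * ‖weakDeriv f‖ * |a + δ - a| := by
    refine intervalIntegral.norm_integral_le_of_norm_le_const fun y hy => ?_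
    rw [Set.uIoc_of_le hle] at hy
    refine (norm_intervalIntegral_le _ hy.1.le).trans ?_
    gcongr
    linarith [hy.2]
  rw [add_sub_cancel_left] at b1 b2
  rw [abs_of_pos hδ] at b2
  have := norm_sub_le (∫ y in a..(a + δ), f y) (∫ y in a..(a + δ), ∫ t in a..y, weakDeriv f t)
  rw [← e3, norm_mul, Complex.norm_real, Real.norm_of_nonneg hδ.le] at this
  linarith

/-! ### The form domain as a Hilbert space -/

theorem continuous_integral_smul {ψ : ℝ → ℝ} (hψ : Continuous ψ) (hc : HasCompactSupport ψ) :
    Continuous fun f : L2 => ∫ x, ψ x • f x := by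
  have m : MemLp (fun x => (ψ x : ℂ)) 2 volume :=
    (Complex.continuous_ofReal.comp hψ).memLp_of_hasCompactSupport
      (hc.comp_left Complex.ofReal_zero)
  have h : (fun f : L2 => ∫ x, ψ x • f x) = fun f : L2 => inner ℂ (m.toLp _) f := by
    ext f
    rw [L2.inner_def]
    apply integral_congr_ae
    filter_upwards [m.coeFn_toLp] with x hx
    rw [hx, RCLike.inner_apply, Complex.conj_ofReal, Complex.real_smul, mul_comm]
  rw [h]
  exact continuous_const.inner continuous_id

/-- Each test function contributes an equality between `L²`-continuous functionals of `f` and `g`.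
-/
theorem isClosed_hasWeakDeriv : IsClosed {p : L2 × L2 | HasWeakDeriv p.1 p.2} := by
  have h : {p : L2 × L2 | HasWeakDeriv p.1 p.2} = ⋂ (φ : ℝ → ℝ) (_ : ContDiff ℝ ∞ φ)
      (_ : HasCompactSupport φ),
      {p : L2 × L2 | ∫ x, deriv φ x • p.1 x = -∫ x, φ x • p.2 x} := by
    ext p; simp [HasWeakDeriv]
  rw [h]
  refine isClosed_iInter fun φ => isClosed_iInter fun hφ => isClosed_iInter fun hc => ?_
  exact isClosed_eq
    ((continuous_integral_smul (continuous_deriv_of_smooth hφ) hc.deriv).comp continuous_fst)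
    ((continuous_integral_smul hφ.continuous hc).comp continuous_snd).neg

/-- Multiplication by `x` is unbounded, but tested against a compactly supported `φ` it moves onto
`φ`, and the condition becomes continuous in both functions. -/
theorem isClosed_ae_eq_ofReal_mul :
    IsClosed {p : L2 × L2 | p.2 =ᵐ[volume] fun x : ℝ => (x : ℂ) * p.1 x} := by
  have h : {p : L2 × L2 | p.2 =ᵐ[volume] fun x : ℝ => (x : ℂ) * p.1 x} =
      ⋂ (φ : ℝ → ℝ) (_ : ContDiff ℝ ∞ φ) (_ : HasCompactSupport φ),
      {p : L2 × L2 | ∫ x, φ x • p.2 x = ∫ x, (φ x * x) • p.1 x} := by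
    ext p
    have hsm : ∀ (φ : ℝ → ℝ) (x : ℝ), φ x • ((x : ℂ) * p.1 x) = (φ x * x) • p.1 x :=
      fun φ x => by simp only [Complex.real_smul]; push_cast; ring
    simp only [Set.mem_ofPred_eq, Set.mem_iInter]
    constructor
    · intro hp φ hφ hc
      simp_rw [← hsm]
      apply integral_congr_ae
      filter_upwards [hp] with x hx
      rw [hx]
    · intro hp
      refine ae_eq_of_integral_contDiff_smul_eq (L2.locallyIntegrable _) ?_ ?_
      · exact (L2.locallyIntegrable p.1).continuous_mul Complex.continuous_ofReal
      · intro φ hφ hc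
        simp_rw [hsm]
        exact hp φ hφ hc
  rw [h]
  refine isClosed_iInter fun φ => isClosed_iInter fun hφ => isClosed_iInter fun hc => ?_
  exact isClosed_eq ((continuous_integral_smul hφ.continuous hc).comp continuous_snd)
    ((continuous_integral_smul (hφ.continuous.mul continuous_id) hc.mul_right).comp continuous_fst)

/-- The triples `(f, f', x f)` with `f` in the form domain. -/
def tripleSpace : Submodule ℂ (PiLp 2 fun _ : Fin 3 => L2) where
  carrier := {v | HasWeakDeriv (v 0) (v 1) ∧ v 2 =ᵐ[volume] fun x : ℝ => (x : ℂ) * v 0 x}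
  zero_mem' := by
    refine ⟨hasWeakDeriv_zero, ?_⟩
    filter_upwards [Lp.coeFn_zero ℂ 2 (volume : Measure ℝ)] with x hx
    simp only [PiLp.zero_apply]
    rw [hx]; simp
  add_mem' := by
    rintro v w ⟨h, hm⟩ ⟨h', hm'⟩
    refine ⟨h.add h', ?_⟩
    filter_upwards [Lp.coeFn_add (v 0) (w 0), Lp.coeFn_add (v 2) (w 2), hm, hm'] with x h1 h2 h3 h4
    simp only [PiLp.add_apply]
    rw [h1, h2, Pi.add_apply, Pi.add_apply, h3, h4, mul_add]
  smul_mem' := by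
    rintro c v ⟨h, hm⟩
    refine ⟨h.smul c, ?_⟩
    filter_upwards [Lp.coeFn_smul c (v 0), Lp.coeFn_smul c (v 2), hm] with x h1 h2 h3
    simp only [PiLp.smul_apply]
    rw [h1, h2, Pi.smul_apply, Pi.smul_apply, h3, smul_eq_mul, smul_eq_mul, mul_left_comm]

/-- Closedness makes the form domain a Hilbert space for the norm `‖f‖² + ‖f'‖² + ‖x f‖²`, so
adjoints and the Lax–Milgram argument become available. -/
theorem isClosed_tripleSpace : IsClosed (tripleSpace : Set (PiLp 2 fun _ : Fin 3 => L2)) := by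
  have hc : ∀ i : Fin 3, Continuous fun v : PiLp 2 fun _ : Fin 3 => L2 => v i := fun i =>
    (PiLp.proj (𝕜 := ℂ) 2 (fun _ : Fin 3 => L2) i).continuous
  exact (isClosed_hasWeakDeriv.preimage ((hc 0).prodMk (hc 1))).inter
    (isClosed_ae_eq_ofReal_mul.preimage ((hc 0).prodMk (hc 2)))

instance : CompleteSpace tripleSpace := isClosed_tripleSpace.completeSpace_coe

/-- The coordinates of a triple. -/
def coord (i : Fin 3) : tripleSpace →L[ℂ] L2 :=
  (PiLp.proj (𝕜 := ℂ) 2 (fun _ : Fin 3 => L2) i).comp tripleSpace.subtypeL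

theorem norm_sq_tripleSpace (v : tripleSpace) :
    ‖v‖ ^ 2 = ‖coord 0 v‖ ^ 2 + ‖coord 1 v‖ ^ 2 + ‖coord 2 v‖ ^ 2 := by
  have := PiLp.norm_sq_eq_of_L2 (fun _ : Fin 3 => L2) (v : PiLp 2 fun _ : Fin 3 => L2)
  rw [Fin.sum_univ_three] at this
  exact this

theorem norm_coord_le (i : Fin 3) (v : tripleSpace) : ‖coord i v‖ ≤ ‖v‖ := by
  refine le_of_sq_le_sq ?_ (norm_nonneg _)
  have h := norm_sq_tripleSpace v
  have h0 := sq_nonneg ‖coord 0 v‖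
  have h1 := sq_nonneg ‖coord 1 v‖
  have h2 := sq_nonneg ‖coord 2 v‖
  fin_cases i <;> simp only [Fin.zero_eta, Fin.mk_one, Fin.reduceFinMk] <;> linarith

theorem hasWeakDeriv_coord (v : tripleSpace) : HasWeakDeriv (coord 0 v) (coord 1 v) := v.2.1

theorem coord_two_ae_eq (v : tripleSpace) :
    coord 2 v =ᵐ[volume] fun x : ℝ => (x : ℂ) * coord 0 v x := v.2.2

theorem coord_zero_mem_formDomain (v : tripleSpace) : coord 0 v ∈ formDomain :=
  ⟨⟨_, hasWeakDeriv_coord v⟩, (Lp.memLp (coord 2 v)).ae_eq (coord_two_ae_eq v)⟩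

theorem exists_tripleSpace {f : L2} (hf : f ∈ formDomain) : ∃ v : tripleSpace, coord 0 v = f :=
  ⟨⟨WithLp.toLp 2 ![f, weakDeriv f, hf.2.toLp _],
    hasWeakDeriv_weakDeriv hf.1, hf.2.coeFn_toLp⟩, rfl⟩

/-- Evaluation of the continuous representative at a point. -/
def evalAt (a : ℝ) : tripleSpace →L[ℂ] ℂ :=
  LinearMap.mkContinuous
    { toFun := fun v => contRep (coord 0 v) a
      map_add' := fun v w => by
        rw [map_add, contRep_add (coord_zero_mem_formDomain v).1 (coord_zero_mem_formDomain w).1,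
          Pi.add_apply]
      map_smul' := fun c v => by
        rw [map_smul, contRep_smul c (coord_zero_mem_formDomain v).1]; rfl } 2 fun v => by
    -- Taking `δ = 1` bounds the value by `‖f‖ + ‖f'‖`, hence the constant 2.
    have h := norm_contRep_le (coord_zero_mem_formDomain v).1 a one_pos
    rw [(hasWeakDeriv_coord v).weakDeriv_eq, Real.sqrt_one] at h
    have h0 := norm_coord_le 0 v
    have h1 := norm_coord_le 1 v
    simp only [LinearMap.coe_mk, AddHom.coe_mk]
    linarith

theorem evalAt_apply (a : ℝ) (v : tripleSpace) : evalAt a v = contRep (coord 0 v) a := rfl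

/-- The coefficient `2δ` is arbitrarily small, so the point interactions can be absorbed into
`‖f'‖²` however large `|z|` is. -/
theorem norm_sq_evalAt_le (a : ℝ) (v : tripleSpace) {δ : ℝ} (hδ : 0 < δ) :
    ‖evalAt a v‖ ^ 2 ≤ 2 / δ * ‖coord 0 v‖ ^ 2 + 2 * δ * ‖coord 1 v‖ ^ 2 := by
  have h := norm_contRep_le (coord_zero_mem_formDomain v).1 a hδ
  rw [(hasWeakDeriv_coord v).weakDeriv_eq, ← evalAt_apply] at h
  have hs := Real.sq_sqrt hδ.le
  have h2 : (δ * ‖evalAt a v‖) ^ 2 ≤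
      2 * (δ * ‖coord 0 v‖ ^ 2) + 2 * (δ ^ 2 * (δ * ‖coord 1 v‖ ^ 2)) := by
    calc (δ * ‖evalAt a v‖) ^ 2 ≤ (√δ * ‖coord 0 v‖ + δ * (√δ * ‖coord 1 v‖)) ^ 2 := by gcongr
      _ ≤ 2 * ((√δ * ‖coord 0 v‖) ^ 2 + (δ * (√δ * ‖coord 1 v‖)) ^ 2) := add_sq_le
      _ = _ := by simp only [mul_pow, hs]; ring
  have h3 : δ ^ 2 * ‖evalAt a v‖ ^ 2 ≤
      δ ^ 2 * (2 / δ * ‖coord 0 v‖ ^ 2 + 2 * δ * ‖coord 1 v‖ ^ 2) := by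
    rw [← mul_pow]
    refine h2.trans_eq ?_
    field_simp
  exact le_of_mul_le_mul_left h3 (by positivity)

/-! ### Multiplication by a bounded function -/

theorem memLp_mul_of_bounded {χ : ℝ → ℝ} (hχ : Continuous χ) {M : ℝ} (hM : ∀ x, |χ x| ≤ M)
    (f : L2) : MemLp (fun x => (χ x : ℂ) * f x) 2 volume := by
  refine (Lp.memLp f).of_le_mul (c := M)
    ((Complex.continuous_ofReal.comp hχ).aestronglyMeasurable.mul (Lp.aestronglyMeasurable f))
    (Filter.Eventually.of_forall fun x => ?_)
  rw [norm_mul, Complex.norm_real, Real.norm_eq_abs]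
  exact mul_le_mul_of_nonneg_right (hM x) (norm_nonneg _)

theorem exists_mulOperator {χ : ℝ → ℝ} (hχ : Continuous χ) {M : ℝ} (hM : ∀ x, |χ x| ≤ M) :
    ∃ K : L2 →L[ℂ] L2, ∀ f, K f =ᵐ[volume] fun x => (χ x : ℂ) * f x := by
  refine ⟨LinearMap.mkContinuous
    { toFun := fun f => (memLp_mul_of_bounded hχ hM f).toLp _
      map_add' := fun f g => ?_
      map_smul' := fun c f => ?_ } M fun f => ?_, fun f => ?_⟩
  · apply Lp.ext
    filter_upwards [(memLp_mul_of_bounded hχ hM (f + g)).coeFn_toLp,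
      Lp.coeFn_add ((memLp_mul_of_bounded hχ hM f).toLp _)
        ((memLp_mul_of_bounded hχ hM g).toLp _), (memLp_mul_of_bounded hχ hM f).coeFn_toLp,
      (memLp_mul_of_bounded hχ hM g).coeFn_toLp, Lp.coeFn_add f g] with x h1 h2 h3 h4 h5
    rw [h1, h2, Pi.add_apply, h3, h4, h5, Pi.add_apply, mul_add]
  · apply Lp.ext
    filter_upwards [(memLp_mul_of_bounded hχ hM (c • f)).coeFn_toLp,
      Lp.coeFn_smul c ((memLp_mul_of_bounded hχ hM f).toLp _),
      (memLp_mul_of_bounded hχ hM f).coeFn_toLp, Lp.coeFn_smul c f] with x h1 h2 h3 h4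
    rw [h1, RingHom.id_apply, h2, Pi.smul_apply, h3, h4, Pi.smul_apply, smul_eq_mul, smul_eq_mul,
      mul_left_comm]
  · refine Lp.norm_le_mul_norm_of_ae_le_mul ?_
    filter_upwards [(memLp_mul_of_bounded hχ hM f).coeFn_toLp] with x hx
    simp only [LinearMap.coe_mk, AddHom.coe_mk]
    rw [hx, norm_mul, Complex.norm_real, Real.norm_eq_abs]
    exact mul_le_mul_of_nonneg_right (hM x) (norm_nonneg _)
  · exact (memLp_mul_of_bounded hχ hM f).coeFn_toLp

theorem integrable_norm_sq (f : L2) : Integrable fun x => ‖f x‖ ^ 2 :=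
  (memLp_two_iff_integrable_sq_norm (Lp.aestronglyMeasurable f)).1 (Lp.memLp f)

theorem re_inner_mul {χ : ℝ → ℝ} {f k : L2} (hk : k =ᵐ[volume] fun x => (χ x : ℂ) * f x) :
    (inner ℂ f k).re = ∫ x, χ x * ‖f x‖ ^ 2 := by
  have h : inner ℂ f k = ((∫ x, χ x * ‖f x‖ ^ 2 : ℝ) : ℂ) := by
    rw [L2.inner_def, ← integral_complex_ofReal]
    apply integral_congr_ae
    filter_upwards [hk] with x hx
    rw [hx, RCLike.inner_apply, mul_assoc, Complex.mul_conj, Complex.normSq_eq_norm_sq]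
    push_cast; rfl
  rw [h, Complex.ofReal_re]

theorem norm_sq_eq_integral (f : L2) : ‖f‖ ^ 2 = ∫ x, ‖f x‖ ^ 2 := by
  have h := re_inner_mul (χ := fun _ => 1) (f := f) (k := f) (by simp)
  simp only [one_mul] at h
  rw [← h]
  exact (inner_self_eq_norm_sq (𝕜 := ℂ) f).symm

/-! ### The shifted operator -/

/-- The operator on `tripleSpace` that represents `t - ν + K`. -/
def formOperator (z : ℂ) (b : ℝ) (ν : ℂ) (K : L2 →L[ℂ] L2) : tripleSpace →L[ℂ] tripleSpace :=
  (coord 1).adjoint ∘L coord 1 + (1 / 4 : ℂ) • ((coord 2).adjoint ∘L coord 2)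
    - (1 / 2 + ν) • ((coord 0).adjoint ∘L coord 0) + (coord 0).adjoint ∘L (K ∘L coord 0)
    + z • ((evalAt b).adjoint ∘L evalAt b - (evalAt (-b)).adjoint ∘L evalAt (-b))

theorem inner_formOperator' (z : ℂ) (b : ℝ) (ν : ℂ) (K : L2 →L[ℂ] L2) (v w : tripleSpace) :
    inner ℂ w (formOperator z b ν K v) =
      inner ℂ (coord 1 w) (coord 1 v) + 1 / 4 * inner ℂ (coord 2 w) (coord 2 v)
        - (1 / 2 + ν) * inner ℂ (coord 0 w) (coord 0 v) + inner ℂ (coord 0 w) (K (coord 0 v))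
        + z * (evalAt b v * conj (evalAt b w) - evalAt (-b) v * conj (evalAt (-b) w)) := by
  have hs : ∀ (c : ℂ) (u : tripleSpace), inner ℂ w (c • u) = c * inner ℂ w u :=
    fun c u => inner_smul_right w u c
  simp only [formOperator, add_apply, sub_apply, smul_apply, ContinuousLinearMap.comp_apply,
    inner_add_right, inner_sub_right, hs, ContinuousLinearMap.adjoint_inner_right,
    RCLike.inner_apply]

/-- Hence the weak equation `(L - ν + K) f = h` becomes an equation in the Hilbert space: this
operator applied to the triple of `f` equals the adjoint of `coord 0` applied to `h`. -/
theorem inner_formOperator (z : ℂ) (b : ℝ) (ν : ℂ) (K : L2 →L[ℂ] L2) (v w : tripleSpace) :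
    inner ℂ w (formOperator z b ν K v) = form z b (coord 0 v) (coord 0 w)
      - ν * inner ℂ (coord 0 w) (coord 0 v) + inner ℂ (coord 0 w) (K (coord 0 v)) := by
  have h2 : inner ℂ (coord 2 w) (coord 2 v) =
      ∫ x : ℝ, ((x : ℂ) * coord 0 v x) * conj ((x : ℂ) * coord 0 w x) := by
    rw [L2.inner_def]
    apply integral_congr_ae
    filter_upwards [coord_two_ae_eq v, coord_two_ae_eq w] with x hv hw
    rw [hv, hw, RCLike.inner_apply]
  rw [inner_formOperator', form, (hasWeakDeriv_coord v).weakDeriv_eq,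
    (hasWeakDeriv_coord w).weakDeriv_eq, ← h2, evalAt_apply, evalAt_apply, evalAt_apply,
    evalAt_apply]
  ring

/-- A cutoff function that is `M` on `[-r, r]` and vanishes outside `[-(r + 1), r + 1]`. -/
def cutoff (M r x : ℝ) : ℝ := M * max 0 (min 1 (r + 1 - |x|))

theorem continuous_cutoff (M r : ℝ) : Continuous (cutoff M r) := by
  unfold cutoff; fun_prop

theorem abs_cutoff_le {M : ℝ} (hM : 0 ≤ M) (r x : ℝ) : |cutoff M r x| ≤ M := by
  rw [cutoff, abs_mul, abs_of_nonneg hM, abs_of_nonneg (le_max_left _ _)]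
  exact mul_le_of_le_one_right hM (max_le zero_le_one (min_le_left _ _))

theorem cutoff_nonneg {M : ℝ} (hM : 0 ≤ M) (r x : ℝ) : 0 ≤ cutoff M r x :=
  mul_nonneg hM (le_max_left _ _)

theorem cutoff_eq {M r x : ℝ} (h : |x| ≤ r) : cutoff M r x = M := by
  rw [cutoff, min_eq_left (by linarith), max_eq_right zero_le_one, mul_one]

theorem cutoff_eq_zero {M r x : ℝ} (h : r + 1 ≤ |x|) : cutoff M r x = 0 := by
  rw [cutoff, max_eq_left ((min_le_right _ _).trans (by linarith)), mul_zero]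

/-- Pointwise, `N ≤ x²/8 + χ(x)`: on `[-r, r]` the cutoff equals `N`, and outside `x²/8 ≥ r²/8 ≥ N`.
-/
theorem coercive_weight {N r : ℝ} (hN : 0 ≤ N) (hr : 0 ≤ r) (hr2 : 8 * N ≤ r ^ 2)
    {K : L2 →L[ℂ] L2} (hK : ∀ f, K f =ᵐ[volume] fun x => (cutoff N r x : ℂ) * f x)
    (v : tripleSpace) :
    N * ‖coord 0 v‖ ^ 2 ≤ 1 / 8 * ‖coord 2 v‖ ^ 2 + (inner ℂ (coord 0 v) (K (coord 0 v))).re := by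
  have i0 := integrable_norm_sq (coord 0 v)
  have i2 := integrable_norm_sq (coord 2 v)
  have i1 : Integrable fun x => cutoff N r x * ‖coord 0 v x‖ ^ 2 :=
    i0.bdd_mul (c := N) (continuous_cutoff N r).aestronglyMeasurable
      (Filter.Eventually.of_forall fun x => abs_cutoff_le hN r x)
  rw [re_inner_mul (hK (coord 0 v)), norm_sq_eq_integral, norm_sq_eq_integral,
    ← integral_const_mul, ← integral_const_mul, ← integral_add (i2.const_mul _) i1]
  refine integral_mono_ae (i0.const_mul _) ((i2.const_mul _).add i1) ?_
  filter_upwards [coord_two_ae_eq v] with x hx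
  rw [hx, norm_mul, Complex.norm_real, Real.norm_eq_abs, mul_pow, sq_abs, ← mul_assoc, ← add_mul]
  refine mul_le_mul_of_nonneg_right ?_ (sq_nonneg _)
  rcases le_total |x| r with h | h
  · rw [cutoff_eq h]; nlinarith [sq_nonneg x]
  · have h1 : r ^ 2 ≤ x ^ 2 := by rw [← sq_abs x]; gcongr
    have := cutoff_nonneg hN r x
    linarith

theorem exists_cutoff_isUnit (z : ℂ) (b : ℝ) (ν : ℂ) : ∃ χ : ℝ → ℝ, Continuous χ ∧
    (∃ r, ∀ x, r ≤ |x| → χ x = 0) ∧ ∃ K : L2 →L[ℂ] L2,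
      (∀ f, K f =ᵐ[volume] fun x => (χ x : ℂ) * f x) ∧ IsUnit (formOperator z b ν K) := by
  -- The two point evaluations together cost at most `4‖z‖δ ‖f'‖²`; this `δ` limits that to half of
  -- the kinetic term.
  obtain ⟨δ, hδ, hδz⟩ : ∃ δ : ℝ, 0 < δ ∧ 4 * ‖z‖ * δ ≤ 1 / 2 := by
    refine ⟨1 / (8 * (‖z‖ + 1)), by positivity, ?_⟩
    rw [mul_one_div, div_le_div_iff₀ (by positivity) two_pos]
    linarith [norm_nonneg z]
  -- Pays for the shift `1/2 + Re ν` and for the `‖f‖²` part of the evaluations, and leaves one full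
  -- `‖f‖²`.
  let N : ℝ := |1 / 2 + ν.re| + 4 * ‖z‖ / δ + 1
  have hN : 0 ≤ N := by positivity
  let r : ℝ := 8 * N + 1
  have hr2 : 8 * N ≤ r ^ 2 := by simp only [r]; nlinarith
  obtain ⟨K, hK⟩ := exists_mulOperator (continuous_cutoff N r) (abs_cutoff_le hN r)
  refine ⟨cutoff N r, continuous_cutoff N r, ⟨r + 1, fun x hx => cutoff_eq_zero hx⟩, K, hK, ?_⟩
  -- What survives is `‖f‖² + ‖f'‖²/2 + ‖x f‖²/8`, so `1/8` is a coercivity constant.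
  refine ContinuousLinearMap.isUnit_of_forall_le_norm_inner_map (c := 1 / 8) _ (by norm_num)
    fun v => ?_
  rw [norm_inner_symm]
  refine le_trans ?_ (Complex.re_le_norm _)
  have hw := coercive_weight hN (by positivity) hr2 hK v
  have hp := norm_sq_evalAt_le b v hδ
  have hm := norm_sq_evalAt_le (-b) v hδ
  have hself : ∀ f : L2, inner ℂ f f = ((‖f‖ ^ 2 : ℝ) : ℂ) := fun f => by
    rw [inner_self_eq_norm_sq_to_K]; push_cast; rfl
  have hev : ∀ w : ℂ, w * conj w = ((‖w‖ ^ 2 : ℝ) : ℂ) := fun w => by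
    rw [Complex.mul_conj, Complex.normSq_eq_norm_sq]
  have hz : -(‖z‖ * (‖evalAt b v‖ ^ 2 + ‖evalAt (-b) v‖ ^ 2)) ≤
      z.re * (‖evalAt b v‖ ^ 2 - ‖evalAt (-b) v‖ ^ 2) := by
    have h1 := neg_le_of_abs_le (Complex.abs_re_le_norm z)
    have h2 := Complex.re_le_norm z
    nlinarith [sq_nonneg ‖evalAt b v‖, sq_nonneg ‖evalAt (-b) v‖]
  have hre : (inner ℂ v (formOperator z b ν K v)).re = ‖coord 1 v‖ ^ 2 + 1 / 4 * ‖coord 2 v‖ ^ 2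
      - (1 / 2 + ν.re) * ‖coord 0 v‖ ^ 2 + (inner ℂ (coord 0 v) (K (coord 0 v))).re
      + z.re * (‖evalAt b v‖ ^ 2 - ‖evalAt (-b) v‖ ^ 2) := by
    rw [inner_formOperator', hself, hself, hself, hev, hev, ← Complex.ofReal_sub]
    simp only [Complex.add_re, Complex.sub_re, Complex.re_mul_ofReal, Complex.ofReal_re]
    norm_num
  rw [hre, norm_sq_tripleSpace]
  have hz2 : ‖z‖ * (‖evalAt b v‖ ^ 2 + ‖evalAt (-b) v‖ ^ 2) ≤
      4 * ‖z‖ / δ * ‖coord 0 v‖ ^ 2 + 4 * ‖z‖ * δ * ‖coord 1 v‖ ^ 2 := by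
    have := mul_le_mul_of_nonneg_left (add_le_add hp hm) (norm_nonneg z)
    refine this.trans_eq ?_
    field_simp; ring
  have hz3 : 4 * ‖z‖ * δ * ‖coord 1 v‖ ^ 2 ≤ 1 / 2 * ‖coord 1 v‖ ^ 2 := by gcongr
  have hν : (1 / 2 + ν.re) * ‖coord 0 v‖ ^ 2 ≤ |1 / 2 + ν.re| * ‖coord 0 v‖ ^ 2 := by
    gcongr; exact le_abs_self _
  have hNe : N * ‖coord 0 v‖ ^ 2 = |1 / 2 + ν.re| * ‖coord 0 v‖ ^ 2 +
      4 * ‖z‖ / δ * ‖coord 0 v‖ ^ 2 + ‖coord 0 v‖ ^ 2 := by simp only [N]; ring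
  have h0 := sq_nonneg ‖coord 0 v‖
  have h1 := sq_nonneg ‖coord 1 v‖
  have h2 := sq_nonneg ‖coord 2 v‖
  have hc : ((1 / 8 : NNReal) : ℝ) = 1 / 8 := by norm_num
  rw [hc]
  linarith

/-- The equation `(L - ν + χ) f = h` is uniquely solvable for a suitable cutoff function `χ`,
with bounded solution operator `S`. -/
theorem exists_cutoff_resolvent (z : ℂ) (b : ℝ) (ν : ℂ) : ∃ χ : ℝ → ℝ, Continuous χ ∧
    (∃ r, ∀ x, r ≤ |x| → χ x = 0) ∧ ∃ K S : L2 →L[ℂ] L2,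
      (∀ f, K f =ᵐ[volume] fun x => (χ x : ℂ) * f x) ∧
      (∀ h, (S h, h + ν • S h - K (S h)) ∈ operatorGraph z b) ∧
      (∀ f h, (f, h) ∈ operatorGraph z b → f = S (h - ν • f + K f)) := by
  obtain ⟨χ, hχ, hr, K, hK, ⟨T, hT⟩⟩ := exists_cutoff_isUnit z b ν
  have hTi : ∀ v, T.1 (T.2 v) = v := fun v =>
    congrArg (fun A : tripleSpace →L[ℂ] tripleSpace => A v) T.val_inv
  have hiT : ∀ v, T.2 (T.1 v) = v := fun v =>
    congrArg (fun A : tripleSpace →L[ℂ] tripleSpace => A v) T.inv_val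
  -- The operator `S` sends `h` to the first coordinate of the solution `v` of `T v = (coord 0)* h`.
  refine ⟨χ, hχ, hr, K, coord 0 ∘L (T.2 ∘L (coord 0).adjoint), hK, fun h => ?_, fun f h hf => ?_⟩
  · refine ⟨coord_zero_mem_formDomain _, fun g hg => ?_⟩
    obtain ⟨w, rfl⟩ := exists_tripleSpace hg
    have key := inner_formOperator z b ν K (T.2 ((coord 0).adjoint h)) w
    rw [← hT, hTi, ContinuousLinearMap.adjoint_inner_right] at key
    simp only [ContinuousLinearMap.comp_apply, inner_add_right, inner_sub_right, inner_smul_right]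
    rw [key]; ring
  · obtain ⟨v, rfl⟩ := exists_tripleSpace hf.1
    have hv : T.1 v = (coord 0).adjoint (h - ν • coord 0 v + K (coord 0 v)) := by
      refine ext_inner_left ℂ fun w => ?_
      rw [hT, inner_formOperator, ContinuousLinearMap.adjoint_inner_right,
        hf.2 _ (coord_zero_mem_formDomain w)]
      simp only [inner_add_right, inner_sub_right, inner_smul_right]
    rw [ContinuousLinearMap.comp_apply, ContinuousLinearMap.comp_apply, ← hv, hiT]

/-! ### Piecewise solutions -/

/-- `u` solves `u'' = (x² / 4 - 1 / 2 - ν) u - h` on the line, with derivative `v`. -/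
structure IsSolution (ν : ℂ) (h u v : ℝ → ℂ) : Prop where
  hasDerivAt : ∀ x : ℝ, HasDerivAt u (v x) x
  hasDerivAt' : ∀ x : ℝ, HasDerivAt v (((x : ℂ) ^ 2 / 4 - 1 / 2 - ν) * u x - h x) x

theorem IsSolution.continuous {ν : ℂ} {h u v : ℝ → ℂ} (hs : IsSolution ν h u v) : Continuous u :=
  continuous_iff_continuousAt.2 fun x => (hs.hasDerivAt x).continuousAt

theorem IsSolution.continuous' {ν : ℂ} {h u v : ℝ → ℂ} (hs : IsSolution ν h u v) : Continuous v :=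
  continuous_iff_continuousAt.2 fun x => (hs.hasDerivAt' x).continuousAt

/-- The function that is `fl` on `(-∞, -b]`, `fm` on `(-b, b]` and `fr` on `(b, ∞)`. -/
def glue (b : ℝ) (fl fm fr : ℝ → ℂ) (x : ℝ) : ℂ :=
  if x ≤ -b then fl x else if x ≤ b then fm x else fr x

section Glue

variable {b : ℝ} {fl fm fr : ℝ → ℂ}

theorem glue_left {x : ℝ} (hx : x ≤ -b) : glue b fl fm fr x = fl x := if_pos hx

theorem glue_mid {x : ℝ} (hx : -b < x) (hx' : x ≤ b) : glue b fl fm fr x = fm x := by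
  rw [glue, if_neg (not_le.2 hx), if_pos hx']

theorem glue_right (hb : 0 < b) {x : ℝ} (hx : b < x) : glue b fl fm fr x = fr x := by
  rw [glue, if_neg (by linarith), if_neg (not_le.2 hx)]

theorem continuous_glue (hl : Continuous fl) (hm : Continuous fm) (hr : Continuous fr)
    (h1 : fl (-b) = fm (-b)) (h2 : fm b = fr b) (hb : 0 < b) : Continuous (glue b fl fm fr) := by
  refine Continuous.if_le hl (Continuous.if_le hm hr continuous_id continuous_const ?_)
    continuous_id continuous_const ?_
  · rintro x rfl; exact h2
  · rintro x (rfl : x = -b)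
    rw [if_pos (by linarith)]; exact h1

theorem memLp_glue (hb : 0 < b) (hl : MemLp fl 2 (volume.restrict (Set.Iic (-b))))
    (hm : Continuous fm) (hr : MemLp fr 2 (volume.restrict (Set.Ioi b))) :
    MemLp (glue b fl fm fr) 2 volume := by
  have hm' : MemLp fm 2 (volume.restrict (Set.Ioc (-b) b)) := by
    rw [memLp_two_iff_integrable_sq_norm hm.aestronglyMeasurable]
    exact (hm.norm.pow 2).integrableOn_Ioc
  rw [← memLp_indicator_iff_restrict measurableSet_Iic] at hl
  rw [← memLp_indicator_iff_restrict measurableSet_Ioi] at hr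
  rw [← memLp_indicator_iff_restrict measurableSet_Ioc] at hm'
  convert! (hl.add hm').add hr using 1
  ext x
  simp only [Pi.add_apply, Set.indicator_apply, Set.mem_Iic, Set.mem_Ioc, Set.mem_Ioi]
  rcases le_or_gt x (-b) with h | h
  · rw [glue_left h, if_pos h, if_neg (fun h' => not_lt.2 h h'.1), if_neg (by linarith)]; simp
  · rcases le_or_gt x b with h' | h'
    · rw [glue_mid h h', if_neg (by linarith), if_pos ⟨h, h'⟩, if_neg (by linarith)]; simp
    · rw [glue_right hb h', if_neg (by linarith), if_neg (fun h'' => not_le.2 h' h''.2),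
        if_pos h']; simp

end Glue

theorem integral_eq_add_add {F : ℝ → ℂ} (hF : Integrable F) (b : ℝ) :
    ∫ x, F x = (∫ x in Set.Iic (-b), F x) + (∫ x in (-b)..b, F x) + ∫ x in Set.Ioi b, F x := by
  rw [← intervalIntegral.integral_Iic_add_Ioi (b := b) hF.integrableOn hF.integrableOn,
    ← intervalIntegral.integral_Iic_sub_Iic (a := -b) (b := b) hF.integrableOn hF.integrableOn]
  ring

/-- A function glued from solutions that satisfy the jump conditions at `±b` lies in the domain
of the operator. -/
theorem mem_operatorGraph_of_glue {z ν : ℂ} {b : ℝ} (hb : 0 < b)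
    {h ul vl um vm ur vr : ℝ → ℂ} (hh : Continuous h) (sl : IsSolution ν h ul vl)
    (sm : IsSolution ν h um vm) (sr : IsSolution ν h ur vr)
    (cr : ur b = um b) (cl : ul (-b) = um (-b)) (jr : vr b - vm b = z * um b)
    (jl : vm (-b) - vl (-b) = -(z * um (-b)))
    (mur : MemLp ur 2 (volume.restrict (Set.Ioi b)))
    (mvr : MemLp vr 2 (volume.restrict (Set.Ioi b)))
    (mxr : MemLp (fun x : ℝ => (x : ℂ) * ur x) 2 (volume.restrict (Set.Ioi b)))
    (mul : MemLp ul 2 (volume.restrict (Set.Iic (-b))))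
    (mvl : MemLp vl 2 (volume.restrict (Set.Iic (-b))))
    (mxl : MemLp (fun x : ℝ => (x : ℂ) * ul x) 2 (volume.restrict (Set.Iic (-b))))
    {H : L2} (hH : H =ᵐ[volume] h) :
    ∃ f : L2, (f, H + ν • f) ∈ operatorGraph z b ∧ contRep f = glue b ul um ur := by
  set U := glue b ul um ur with hU
  set V := glue b vl vm vr with hV
  have mU : MemLp U 2 volume := memLp_glue hb mul sm.continuous mur
  have mV : MemLp V 2 volume := memLp_glue hb mvl sm.continuous' mvr
  have mX : MemLp (fun x : ℝ => (x : ℂ) * U x) 2 volume := by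
    convert! memLp_glue hb mxl (Complex.continuous_ofReal.mul sm.continuous) mxr using 1
    ext x
    simp only [hU, glue, mul_ite]; rfl
  have cU : Continuous U :=
    continuous_glue sl.continuous sm.continuous sr.continuous cl cr.symm hb
  have hp : IsPrimitive U V := by
    have hl := mV.locallyIntegrable (by norm_num)
    refine ⟨hl, fun x y => ?_⟩
    -- `U` is continuous and differentiable off `{-b, b}`, so the jumps of `V` contribute nothing to
    -- its integral.
    refine integral_eq_of_hasDerivAt_off_countable U V (s := {-b, b})
      ((Set.finite_singleton b).insert (-b)).countable cU.continuousOn ?_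
      (intervalIntegrable_of_locallyIntegrable hl x y)
    rintro t ⟨-, ht⟩
    simp only [Set.mem_insert_iff, Set.mem_singleton_iff, not_or] at ht
    rcases lt_or_gt_of_ne ht.1 with h1 | h1
    · rw [hV, glue_left h1.le]
      refine (sl.hasDerivAt t).congr_of_eventuallyEq ?_
      filter_upwards [Iio_mem_nhds h1] with s hs using glue_left (le_of_lt hs)
    · rcases lt_or_gt_of_ne ht.2 with h2 | h2
      · rw [hV, glue_mid h1 h2.le]
        refine (sm.hasDerivAt t).congr_of_eventuallyEq ?_
        filter_upwards [Ioo_mem_nhds h1 h2] with s hs using glue_mid hs.1 hs.2.le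
      · rw [hV, glue_right hb h2]
        refine (sr.hasDerivAt t).congr_of_eventuallyEq ?_
        filter_upwards [Ioi_mem_nhds h2] with s hs using glue_right hb hs
  have wd : HasWeakDeriv (mU.toLp U) (mV.toLp V) :=
    hasWeakDeriv_of_isPrimitive mU.coeFn_toLp mV.coeFn_toLp hp
  have hrep : contRep (mU.toLp U) = U := contRep_eq cU mU.coeFn_toLp
  refine ⟨mU.toLp U, ⟨⟨⟨_, wd⟩, ?_⟩, fun g hg => ?_⟩, hrep⟩
  · refine mX.ae_eq ?_
    filter_upwards [mU.coeFn_toLp] with x hx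
    rw [hx]
  obtain ⟨cG, aG⟩ := contRep_spec hg.1
  have hG := (isPrimitive_contRep hg.1).conj
  set G := contRep g
  set g' := weakDeriv g
  have mG : MemLp G 2 volume := (Lp.memLp g).ae_eq aG
  have mxG : MemLp (fun x : ℝ => (x : ℂ) * G x) 2 volume := hg.2.ae_eq (by
    filter_upwards [aG] with x hx
    rw [hx])
  have mh : MemLp h 2 volume := (Lp.memLp H).ae_eq hH
  have mg' : MemLp g' 2 volume := Lp.memLp g'
  have iX : Integrable fun x : ℝ => ((x : ℂ) * U x) * conj ((x : ℂ) * G x) :=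
    mX.integrable_mul mxG.star
  have iU : Integrable fun x => U x * conj (G x) := mU.integrable_mul mG.star
  have ih : Integrable fun x => h x * conj (G x) := mh.integrable_mul mG.star
  have i1 : Integrable fun x => V x * conj (g' x) := mV.integrable_mul mg'.star
  have i3 : Integrable fun x => V x * conj (G x) := mV.integrable_mul mG.star
  have hQ : ∀ x : ℝ, (((x : ℂ) ^ 2 / 4 - 1 / 2 - ν) * U x - h x) * conj (G x) =
      1 / 4 * (((x : ℂ) * U x) * conj ((x : ℂ) * G x)) - (1 / 2 + ν) * (U x * conj (G x))
        - h x * conj (G x) := fun x => by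
    rw [map_mul, Complex.conj_ofReal]; ring
  have i2 : Integrable fun x : ℝ =>
      (((x : ℂ) ^ 2 / 4 - 1 / 2 - ν) * U x - h x) * conj (G x) := by
    simp_rw [hQ]
    exact ((iX.const_mul _).sub (iU.const_mul _)).sub ih
  have e2 : ∫ x : ℝ, (((x : ℂ) ^ 2 / 4 - 1 / 2 - ν) * U x - h x) * conj (G x) =
      1 / 4 * (∫ x : ℝ, ((x : ℂ) * U x) * conj ((x : ℂ) * G x))
        - (1 / 2 + ν) * (∫ x, U x * conj (G x)) - ∫ x, h x * conj (G x) := by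
    have j : Integrable fun x : ℝ => 1 / 4 * (((x : ℂ) * U x) * conj ((x : ℂ) * G x)) -
        (1 / 2 + ν) * (U x * conj (G x)) := (iX.const_mul _).sub (iU.const_mul _)
    simp_rw [hQ]
    rw [integral_sub j ih, integral_sub (iX.const_mul _) (iU.const_mul _), integral_const_mul,
      integral_const_mul]
  have hcont : ∀ u : ℝ → ℂ, Continuous u →
      Continuous fun x : ℝ => ((x : ℂ) ^ 2 / 4 - 1 / 2 - ν) * u x - h x := fun u hu => by
    have := Complex.continuous_ofReal
    fun_prop
  have er : Set.EqOn V vr (Set.Ioi b) := fun x hx => glue_right hb hx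
  have eru : Set.EqOn U ur (Set.Ioi b) := fun x hx => glue_right hb hx
  have el : Set.EqOn V vl (Set.Iic (-b)) := fun x hx => glue_left hx
  have elu : Set.EqOn U ul (Set.Iic (-b)) := fun x hx => glue_left hx
  -- Integrate by parts on the three pieces separately, moving the derivative from `conj G` onto the
  -- derivative of the solution.
  have pr := hG.integral_Ioi_mul_eq sr.hasDerivAt' (hcont _ sr.continuous) (a := b)
    (i1.integrableOn.congr_fun (fun x hx => by simp only [er hx]) measurableSet_Ioi)
    (i2.integrableOn.congr_fun (fun x hx => by simp only [eru hx]) measurableSet_Ioi)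
    (i3.integrableOn.congr_fun (fun x hx => by simp only [er hx]) measurableSet_Ioi)
  have pl := hG.integral_Iic_mul_eq sl.hasDerivAt' (hcont _ sl.continuous) (a := -b)
    (i1.integrableOn.congr_fun (fun x hx => by simp only [el hx]) measurableSet_Iic)
    (i2.integrableOn.congr_fun (fun x hx => by simp only [elu hx]) measurableSet_Iic)
    (i3.integrableOn.congr_fun (fun x hx => by simp only [el hx]) measurableSet_Iic)
  have pm := hG.integral_mul_eq sm.hasDerivAt' (hcont _ sm.continuous) (-b) b
  have m1 : ∫ x in (-b)..b, V x * conj (g' x) = ∫ x in (-b)..b, vm x * conj (g' x) := by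
    rw [intervalIntegral.integral_of_le (by linarith), intervalIntegral.integral_of_le (by linarith)]
    exact setIntegral_congr_fun measurableSet_Ioc fun x hx => by
      simp only [hV, glue_mid hx.1 hx.2]
  have m2 : ∫ x in (-b)..b, (((x : ℂ) ^ 2 / 4 - 1 / 2 - ν) * U x - h x) * conj (G x) =
      ∫ x in (-b)..b, (((x : ℂ) ^ 2 / 4 - 1 / 2 - ν) * um x - h x) * conj (G x) := by
    rw [intervalIntegral.integral_of_le (by linarith), intervalIntegral.integral_of_le (by linarith)]
    exact setIntegral_congr_fun measurableSet_Ioc fun x hx => by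
      simp only [hU, glue_mid hx.1 hx.2]
  have r1 : ∫ x in Set.Ioi b, V x * conj (g' x) = ∫ x in Set.Ioi b, vr x * conj (g' x) :=
    setIntegral_congr_fun measurableSet_Ioi fun x hx => by simp only [er hx]
  have r2 : ∫ x in Set.Ioi b, (((x : ℂ) ^ 2 / 4 - 1 / 2 - ν) * U x - h x) * conj (G x) =
      ∫ x in Set.Ioi b, (((x : ℂ) ^ 2 / 4 - 1 / 2 - ν) * ur x - h x) * conj (G x) :=
    setIntegral_congr_fun measurableSet_Ioi fun x hx => by simp only [eru hx]
  have l1 : ∫ x in Set.Iic (-b), V x * conj (g' x) = ∫ x in Set.Iic (-b), vl x * conj (g' x) :=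
    setIntegral_congr_fun measurableSet_Iic fun x hx => by simp only [el hx]
  have l2 : ∫ x in Set.Iic (-b), (((x : ℂ) ^ 2 / 4 - 1 / 2 - ν) * U x - h x) * conj (G x) =
      ∫ x in Set.Iic (-b), (((x : ℂ) ^ 2 / 4 - 1 / 2 - ν) * ul x - h x) * conj (G x) :=
    setIntegral_congr_fun measurableSet_Iic fun x hx => by simp only [elu hx]
  -- The boundary terms at `±b` combine into the jumps of the derivative, which produce the delta
  -- terms of the form.
  have total : (∫ x, V x * conj (g' x)) +
      ∫ x : ℝ, (((x : ℂ) ^ 2 / 4 - 1 / 2 - ν) * U x - h x) * conj (G x) =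
      -(z * (um b * conj (G b) - um (-b) * conj (G (-b)))) := by
    rw [integral_eq_add_add i1 b, integral_eq_add_add i2 b, m1, m2, r1, r2, l1, l2]
    linear_combination pr + pl + pm - conj (G b) * jr - conj (G (-b)) * jl
  have f1 : inner ℂ g' (mV.toLp V) = ∫ x, V x * conj (g' x) := by
    rw [L2.inner_def]
    apply integral_congr_ae
    filter_upwards [mV.coeFn_toLp] with x hx
    rw [hx, RCLike.inner_apply]
  have f2 : inner ℂ g (mU.toLp U) = ∫ x, U x * conj (G x) := by
    rw [L2.inner_def]
    apply integral_congr_ae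
    filter_upwards [mU.coeFn_toLp, aG] with x hx hx'
    rw [hx, hx', RCLike.inner_apply]
  have f3 : inner ℂ g H = ∫ x, h x * conj (G x) := by
    rw [L2.inner_def]
    apply integral_congr_ae
    filter_upwards [hH, aG] with x hx hx'
    rw [hx, hx', RCLike.inner_apply]
  have f4 : ∫ x : ℝ, ((x : ℂ) * (mU.toLp U : L2) x) * conj ((x : ℂ) * g x) =
      ∫ x : ℝ, ((x : ℂ) * U x) * conj ((x : ℂ) * G x) := by
    apply integral_congr_ae
    filter_upwards [mU.coeFn_toLp, aG] with x hx hx'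
    rw [hx, hx']
  have Ub : U b = um b := glue_mid (by linarith) le_rfl
  have Ul : U (-b) = um (-b) := (glue_left le_rfl).trans cl
  change form z b (mU.toLp U) g = inner ℂ g (H + ν • mU.toLp U)
  rw [form, wd.weakDeriv_eq, hrep, f1, f2, f4, inner_add_right, inner_smul_right, f2, f3, Ub, Ul]
  rw [e2] at total
  linear_combination total

/-! ### Variation of parameters -/

theorem hasDerivAt_yEven_ofReal (ν : ℂ) (x : ℝ) :
    HasDerivAt (fun x : ℝ => yEven ν x) (yEven' ν x) x := (hasDerivAt_yEven ν x).comp_ofReal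

theorem hasDerivAt_yOdd_ofReal (ν : ℂ) (x : ℝ) :
    HasDerivAt (fun x : ℝ => yOdd ν x) (yOdd' ν x) x := (hasDerivAt_yOdd ν x).comp_ofReal

theorem hasDerivAt_yEven'_ofReal (ν : ℂ) (x : ℝ) : HasDerivAt (fun x : ℝ => yEven' ν x)
    (((x : ℂ) ^ 2 / 4 - 1 / 2 - ν) * yEven ν x) x := (hasDerivAt_yEven' ν x).comp_ofReal

theorem hasDerivAt_yOdd'_ofReal (ν : ℂ) (x : ℝ) : HasDerivAt (fun x : ℝ => yOdd' ν x)
    (((x : ℂ) ^ 2 / 4 - 1 / 2 - ν) * yOdd ν x) x := (hasDerivAt_yOdd' ν x).comp_ofReal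

theorem continuous_yEven_ofReal (ν : ℂ) : Continuous fun x : ℝ => yEven ν x :=
  continuous_iff_continuousAt.2 fun x => (hasDerivAt_yEven_ofReal ν x).continuousAt

theorem continuous_yOdd_ofReal (ν : ℂ) : Continuous fun x : ℝ => yOdd ν x :=
  continuous_iff_continuousAt.2 fun x => (hasDerivAt_yOdd_ofReal ν x).continuousAt

theorem continuous_yEven'_ofReal (ν : ℂ) : Continuous fun x : ℝ => yEven' ν x :=
  continuous_iff_continuousAt.2 fun x => (hasDerivAt_yEven'_ofReal ν x).continuousAt

theorem continuous_yOdd'_ofReal (ν : ℂ) : Continuous fun x : ℝ => yOdd' ν x :=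
  continuous_iff_continuousAt.2 fun x => (hasDerivAt_yOdd'_ofReal ν x).continuousAt

/-- The moment `∫ h yOdd` over `(0, x)`. -/
def oddMoment (ν : ℂ) (h : ℝ → ℂ) (x : ℝ) : ℂ := ∫ t in (0 : ℝ)..x, yOdd ν t * h t

/-- The moment `∫ h yEven` over `(0, x)`. -/
def evenMoment (ν : ℂ) (h : ℝ → ℂ) (x : ℝ) : ℂ := ∫ t in (0 : ℝ)..x, yEven ν t * h t

theorem hasDerivAt_oddMoment (ν : ℂ) {h : ℝ → ℂ} (hh : Continuous h) (x : ℝ) :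
    HasDerivAt (oddMoment ν h) (yOdd ν x * h x) x := by
  have hc : Continuous fun t : ℝ => yOdd ν t * h t := (continuous_yOdd_ofReal ν).mul hh
  exact intervalIntegral.integral_hasDerivAt_right (hc.intervalIntegrable _ _)
    (hc.stronglyMeasurableAtFilter _ _) hc.continuousAt

theorem hasDerivAt_evenMoment (ν : ℂ) {h : ℝ → ℂ} (hh : Continuous h) (x : ℝ) :
    HasDerivAt (evenMoment ν h) (yEven ν x * h x) x := by
  have hc : Continuous fun t : ℝ => yEven ν t * h t := (continuous_yEven_ofReal ν).mul hh
  exact intervalIntegral.integral_hasDerivAt_right (hc.intervalIntegrable _ _)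
    (hc.stronglyMeasurableAtFilter _ _) hc.continuousAt

/-- The solution of the inhomogeneous equation with data `α`, `β` at the origin. -/
def varSol (ν : ℂ) (h : ℝ → ℂ) (α β : ℂ) (x : ℝ) : ℂ :=
  (α + oddMoment ν h x) * yEven ν x + (β - evenMoment ν h x) * yOdd ν x

/-- The derivative of `varSol`. -/
def varSol' (ν : ℂ) (h : ℝ → ℂ) (α β : ℂ) (x : ℝ) : ℂ :=
  (α + oddMoment ν h x) * yEven' ν x + (β - evenMoment ν h x) * yOdd' ν x

/-- In the first derivative the terms from differentiating the moments cancel; in the second they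
add up to `-h` times the Wronskian. -/
theorem isSolution_varSol (ν : ℂ) {h : ℝ → ℂ} (hh : Continuous h) (α β : ℂ) :
    IsSolution ν h (varSol ν h α β) (varSol' ν h α β) where
  hasDerivAt x := by
    refine ((((hasDerivAt_oddMoment ν hh x).const_add α).mul (hasDerivAt_yEven_ofReal ν x)).add
      (((hasDerivAt_evenMoment ν hh x).const_sub β).mul (hasDerivAt_yOdd_ofReal ν x))).congr_deriv ?_
    rw [varSol']; ring
  hasDerivAt' x := by
    refine ((((hasDerivAt_oddMoment ν hh x).const_add α).mul (hasDerivAt_yEven'_ofReal ν x)).add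
      (((hasDerivAt_evenMoment ν hh x).const_sub β).mul (hasDerivAt_yOdd'_ofReal ν x))).congr_deriv ?_
    rw [varSol]
    linear_combination -h x * wronskian_yEven_yOdd ν x

theorem intervalIntegral_eq_of_eq_zero {F : ℝ → ℂ} (hF : Continuous F) {r x : ℝ}
    (h : ∀ t ∈ Set.uIcc r x, F t = 0) : ∫ t in (0 : ℝ)..x, F t = ∫ t in (0 : ℝ)..r, F t := by
  rw [← intervalIntegral.integral_add_adjacent_intervals (hF.intervalIntegrable 0 r)
    (hF.intervalIntegrable r x), intervalIntegral.integral_congr (g := fun _ => 0) h]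
  simp

/-- Beyond the support of the source the moments are frozen, so `varSol` is there a fixed
combination of `yEven` and `yOdd`. -/
theorem oddMoment_eq (ν : ℂ) {h : ℝ → ℂ} (hh : Continuous h) {r x : ℝ}
    (h0 : ∀ t ∈ Set.uIcc r x, h t = 0) : oddMoment ν h x = oddMoment ν h r :=
  intervalIntegral_eq_of_eq_zero ((continuous_yOdd_ofReal ν).mul hh)
    fun t ht => by simp [h0 t ht]

theorem evenMoment_eq (ν : ℂ) {h : ℝ → ℂ} (hh : Continuous h) {r x : ℝ}
    (h0 : ∀ t ∈ Set.uIcc r x, h t = 0) : evenMoment ν h x = evenMoment ν h r :=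
  intervalIntegral_eq_of_eq_zero ((continuous_yEven_ofReal ν).mul hh)
    fun t ht => by simp [h0 t ht]

/-! ### Square integrability of solutions proportional to the parabolic cylinder function -/

/-- With `A, B` the coefficients of `D_ν`, the hypothesis says that `α yEven + β yOdd` has zero
Wronskian with `D_ν`; the conclusion makes it a multiple of `D_ν`. -/
theorem exists_eq_mul_of_mul_add_mul_eq_zero {A B α β : ℂ} (hAB : A ≠ 0 ∨ B ≠ 0)
    (h : A * β + B * α = 0) : ∃ κ, α = κ * A ∧ β = -(κ * B) := by
  rcases hAB with hA | hB
  · refine ⟨α / A, by field_simp, ?_⟩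
    field_simp
    linear_combination h
  · refine ⟨-β / B, ?_, by field_simp⟩
    field_simp
    linear_combination h

theorem RapidDecay.congr {g k : ℝ → ℂ} (hg : RapidDecay g) {r : ℝ} (h : ∀ x, r ≤ x → k x = g x) :
    RapidDecay k := fun n => by
  refine (hg n).congr' ?_ Filter.EventuallyEq.rfl
  filter_upwards [Filter.eventually_ge_atTop r] with x hx
  rw [h x hx]

theorem memLp_Iic_of_comp_neg {g : ℝ → ℂ} {b : ℝ}
    (h : MemLp (fun x => g (-x)) 2 (volume.restrict (Set.Ioi b))) :
    MemLp g 2 (volume.restrict (Set.Iic (-b))) := by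
  have hp : MeasurePreserving (Neg.neg : ℝ → ℝ) (volume.restrict (Set.Iio (-b)))
      (volume.restrict (Set.Ioi b)) := by
    have := (Measure.measurePreserving_neg (volume : Measure ℝ)).restrict_preimage
      (s := Set.Ioi b) measurableSet_Ioi
    have e : (Neg.neg : ℝ → ℝ) ⁻¹' Set.Ioi b = Set.Iio (-b) := by
      ext x; simp
    rwa [e] at this
  have h2 := h.comp_measurePreserving hp
  rw [← restrict_Iio_eq_restrict_Iic]
  convert! h2 using 1
  ext x
  simp

theorem continuous_parabolicD_ofReal (ν : ℂ) : Continuous fun x : ℝ => parabolicD ν x := by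
  simp only [parabolicD_eq]
  exact ((continuous_yEven_ofReal ν).const_mul _).sub ((continuous_yOdd_ofReal ν).const_mul _)

theorem continuous_parabolicD'_ofReal (ν : ℂ) : Continuous fun x : ℝ => parabolicD' ν x := by
  simp only [parabolicD']
  exact ((continuous_yEven'_ofReal ν).const_mul _).sub ((continuous_yOdd'_ofReal ν).const_mul _)

/-- The left hand side of the matching condition at `+∞` for the solution with data `α`, `β` at
the origin. -/
def matchRight (z ν : ℂ) (b : ℝ) (α β : ℂ) : ℂ :=
  (coefB ν + z * parabolicD ν b * yEven ν b) * α + (coefA ν + z * parabolicD ν b * yOdd ν b) * β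

/-- The left hand side of the matching condition at `-∞` for the solution with data `α`, `β` at
the origin. -/
def matchLeft (z ν : ℂ) (b : ℝ) (α β : ℂ) : ℂ :=
  (-coefB ν + z * parabolicD ν b * yEven ν b) * α + (coefA ν - z * parabolicD ν b * yOdd ν b) * β

/-- The two hypotheses say that, beyond the support of `h`, the outer pieces are proportional to
`D_ν(x)` and `D_ν(-x)`, with the moments of `h` moved to the right-hand side. -/
theorem exists_mem_operatorGraph {z ν : ℂ} {b : ℝ} (hb : 0 < b) {h : ℝ → ℂ} (hh : Continuous h)
    {r : ℝ} (h0 : ∀ x, r ≤ |x| → h x = 0) {H : L2} (hH : H =ᵐ[volume] h) {α β : ℂ}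
    (h1 : matchRight z ν b α β = coefA ν * evenMoment ν h r - coefB ν * oddMoment ν h r
      - z * parabolicD ν b * (oddMoment ν h b * yEven ν b - evenMoment ν h b * yOdd ν b))
    (h2 : matchLeft z ν b α β = coefA ν * evenMoment ν h (-r) + coefB ν * oddMoment ν h (-r)
      - z * parabolicD ν b * (oddMoment ν h (-b) * yEven ν b + evenMoment ν h (-b) * yOdd ν b)) :
    ∃ f : L2, (f, H + ν • f) ∈ operatorGraph z b ∧
      ∀ x, -b < x → x ≤ b → contRep f x = varSol ν h α β x := by
  let cp := varSol ν h α β b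
  let cm := varSol ν h α β (-b)
  -- The added solution vanishes at `b` and has derivative `z * cp` there, since the Wronskian is 1;
  -- the left data arise in the same way at `-b`.
  let αr := α - z * cp * yOdd ν b
  let βr := β + z * cp * yEven ν b
  let αl := α + z * cm * yOdd ν b
  let βl := β + z * cm * yEven ν b
  have W := wronskian_yEven_yOdd ν b
  have pe : yEven ν ((-b : ℝ) : ℂ) = yEven ν b := by rw [Complex.ofReal_neg, yEven_neg]
  have po : yOdd ν ((-b : ℝ) : ℂ) = -yOdd ν b := by rw [Complex.ofReal_neg, yOdd_neg]
  have pe' : yEven' ν ((-b : ℝ) : ℂ) = -yEven' ν b := by rw [Complex.ofReal_neg, yEven'_neg]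
  have po' : yOdd' ν ((-b : ℝ) : ℂ) = yOdd' ν b := by rw [Complex.ofReal_neg, yOdd'_neg]
  have sl := isSolution_varSol ν hh αl βl
  have sr := isSolution_varSol ν hh αr βr
  obtain ⟨κ, hκ1, hκ2⟩ := exists_eq_mul_of_mul_add_mul_eq_zero
    (α := αr + oddMoment ν h r) (β := βr - evenMoment ν h r)
    (coefA_ne_zero_or_coefB_ne_zero ν) (by
      simp only [αr, βr, cp, varSol]
      rw [matchRight, parabolicD_eq] at h1
      linear_combination h1)
  -- Reflection `x ↦ -x` reverses the odd coefficient, which accounts for the sign on `β`.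
  obtain ⟨κ', hκ1', hκ2'⟩ := exists_eq_mul_of_mul_add_mul_eq_zero
    (α := αl + oddMoment ν h (-r)) (β := -(βl - evenMoment ν h (-r)))
    (coefA_ne_zero_or_coefB_ne_zero ν) (by
      simp only [αl, βl, cm, varSol, pe, po]
      rw [matchLeft, parabolicD_eq] at h2
      linear_combination -h2)
  have mr : ∀ x, r ≤ x → oddMoment ν h x = oddMoment ν h r ∧ evenMoment ν h x = evenMoment ν h r :=
    fun x hx => by
      have : ∀ t ∈ Set.uIcc r x, h t = 0 := fun t ht => by
        rw [Set.uIcc_of_le hx] at ht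
        exact h0 t (ht.1.trans (le_abs_self t))
      exact ⟨oddMoment_eq ν hh this, evenMoment_eq ν hh this⟩
  have ml : ∀ x, r ≤ x → oddMoment ν h (-x) = oddMoment ν h (-r) ∧
      evenMoment ν h (-x) = evenMoment ν h (-r) := fun x hx => by
    have : ∀ t ∈ Set.uIcc (-r) (-x), h t = 0 := fun t ht => by
      rw [Set.uIcc_of_ge (by linarith)] at ht
      exact h0 t ((by linarith [ht.2] : r ≤ -t).trans (neg_le_abs t))
    exact ⟨oddMoment_eq ν hh this, evenMoment_eq ν hh this⟩
  have dr : RapidDecay (varSol ν h αr βr) :=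
    ((rapidDecay_parabolicD ν).const_mul κ).congr (r := r) fun x hx => by
      rw [varSol, (mr x hx).1, (mr x hx).2, hκ1, hκ2, parabolicD_eq]; ring
  have dr' : RapidDecay (varSol' ν h αr βr) :=
    ((rapidDecay_parabolicD' ν).const_mul κ).congr (r := r) fun x hx => by
      rw [varSol', (mr x hx).1, (mr x hx).2, hκ1, hκ2, parabolicD']; ring
  have dl : RapidDecay fun x => varSol ν h αl βl (-x) :=
    ((rapidDecay_parabolicD ν).const_mul κ').congr (r := r) fun x hx => by
      rw [varSol, (ml x hx).1, (ml x hx).2, hκ1', parabolicD_eq, Complex.ofReal_neg, yEven_neg,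
        yOdd_neg]
      linear_combination yOdd ν x * hκ2'
  have dl' : RapidDecay fun x => varSol' ν h αl βl (-x) :=
    ((rapidDecay_parabolicD' ν).const_mul (-κ')).congr (r := r) fun x hx => by
      rw [varSol', (ml x hx).1, (ml x hx).2, hκ1', parabolicD', Complex.ofReal_neg, yEven'_neg,
        yOdd'_neg]
      linear_combination -yOdd' ν x * hκ2'
  obtain ⟨f, hf, hrep⟩ := mem_operatorGraph_of_glue (z := z) hb hh sl (isSolution_varSol ν hh α β) sr
    (by simp only [αr, βr, varSol]; ring)
    (by simp only [αl, βl, varSol, pe, po]; ring)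
    (by
      change _ = z * cp
      simp only [αr, βr, varSol']
      linear_combination z * cp * W)
    (by
      change _ = -(z * cm)
      simp only [αl, βl, varSol', pe', po']
      linear_combination -(z * cm) * W)
    (dr.memLp sr.continuous b) (dr'.memLp sr.continuous' b)
    (dr.ofReal_mul.memLp (Complex.continuous_ofReal.mul sr.continuous) b)
    (memLp_Iic_of_comp_neg (dl.memLp (sl.continuous.comp continuous_neg) b))
    (memLp_Iic_of_comp_neg (dl'.memLp (sl.continuous'.comp continuous_neg) b))
    (memLp_Iic_of_comp_neg (g := fun x : ℝ => (x : ℂ) * varSol ν h αl βl x) (by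
      have := ((dl.ofReal_mul).memLp
        (Complex.continuous_ofReal.mul (sl.continuous.comp continuous_neg)) b).neg
      convert! this using 1
      ext x; simp)) hH
  refine ⟨f, hf, fun x hx hx' => ?_⟩
  rw [hrep, glue_mid hx hx']

/-! ### Eigenfunctions -/

/-- The coefficient of `yEven` in the expansion of the pair `(F, P)`. -/
def coeffEven (ν : ℂ) (F P : ℝ → ℂ) (x : ℝ) : ℂ := F x * yOdd' ν x - P x * yOdd ν x

/-- The coefficient of `yOdd` in the expansion of the pair `(F, P)`. -/
def coeffOdd (ν : ℂ) (F P : ℝ → ℂ) (x : ℝ) : ℂ := yEven ν x * P x - yEven' ν x * F x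

/-- Cramer's rule with Wronskian 1. -/
theorem eq_coeff (ν : ℂ) (F P : ℝ → ℂ) (x : ℝ) :
    F x = coeffEven ν F P x * yEven ν x + coeffOdd ν F P x * yOdd ν x := by
  rw [coeffEven, coeffOdd]
  linear_combination -F x * wronskian_yEven_yOdd ν x

/-- The coefficients of a solution of the homogeneous equation on an interval are constant. -/
theorem coeff_eq {ν : ℂ} {F P : ℝ → ℂ} (hF : Continuous F)
    (hP : ∀ x : ℝ, HasDerivAt P (((x : ℂ) ^ 2 / 4 - 1 / 2 - ν) * F x) x) {a c : ℝ} (hac : a ≤ c)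
    (hFP : ∀ x ∈ Set.Icc a c, F x = F a + ∫ t in a..x, P t) :
    coeffEven ν F P c = coeffEven ν F P a ∧ coeffOdd ν F P c = coeffOdd ν F P a := by
  have cP : Continuous P := continuous_iff_continuousAt.2 fun x => (hP x).continuousAt
  -- The derivative of `F` may jump at an endpoint, so only right derivatives inside the interval
  -- are used.
  have hd : ∀ x ∈ Set.Ico a c, HasDerivWithinAt F (P x) (Set.Ici x) x := fun x hx => by
    have h1 : HasDerivAt (fun x => F a + ∫ t in a..x, P t) (P x) x :=
      (intervalIntegral.integral_hasDerivAt_right (cP.intervalIntegrable _ _)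
        (cP.stronglyMeasurableAtFilter _ _) cP.continuousAt).const_add _
    refine h1.hasDerivWithinAt.congr_of_eventuallyEq ?_ (hFP x ⟨hx.1, hx.2.le⟩)
    filter_upwards [self_mem_nhdsWithin, mem_nhdsWithin_of_mem_nhds (Iio_mem_nhds hx.2)] with y h2 h3
    exact hFP y ⟨hx.1.trans h2, le_of_lt h3⟩
  constructor
  · refine constant_of_has_deriv_right_zero (f := coeffEven ν F P) (a := a) (b := c) ?_
      (fun x hx => ?_) c ⟨hac, le_rfl⟩
    · exact ((hF.mul (continuous_yOdd'_ofReal ν)).sub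
        (cP.mul (continuous_yOdd_ofReal ν))).continuousOn
    · refine (((hd x hx).mul (hasDerivAt_yOdd'_ofReal ν x).hasDerivWithinAt).sub
        ((hP x).hasDerivWithinAt.mul (hasDerivAt_yOdd_ofReal ν x).hasDerivWithinAt)).congr_deriv ?_
      ring
  · refine constant_of_has_deriv_right_zero (f := coeffOdd ν F P) (a := a) (b := c) ?_
      (fun x hx => ?_) c ⟨hac, le_rfl⟩
    · exact (((continuous_yEven_ofReal ν).mul cP).sub
        ((continuous_yEven'_ofReal ν).mul hF)).continuousOn
    · refine (((hasDerivAt_yEven_ofReal ν x).hasDerivWithinAt.mul (hP x).hasDerivWithinAt).sub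
        ((hasDerivAt_yEven'_ofReal ν x).hasDerivWithinAt.mul (hd x hx))).congr_deriv ?_
      ring

/-- Against real test functions the form becomes a distributional expression in the weak derivative
and the continuous representative, from which the equation for `f'` is read off. -/
theorem form_test {z : ℂ} {b : ℝ} {f : L2} (hf : f ∈ formDomain) {φ : ℝ → ℝ}
    (hφ : ContDiff ℝ ∞ φ) (hc : HasCompactSupport φ) : ∃ g ∈ formDomain,
      (∀ k : L2, inner ℂ g k = ∫ x, φ x • k x) ∧
      form z b f g = (∫ x, deriv φ x • weakDeriv f x) +
        (∫ x : ℝ, φ x • (((x : ℂ) ^ 2 / 4 - 1 / 2) * contRep f x)) +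
        z * (contRep f b * φ b - contRep f (-b) * φ (-b)) := by
  obtain ⟨g, hg, hgφ⟩ := exists_mem_formDomain hφ hc
  have hd := continuous_deriv_of_smooth hφ
  have m1 : MemLp (fun x => ((deriv φ x : ℝ) : ℂ)) 2 volume :=
    (Complex.continuous_ofReal.comp hd).memLp_of_hasCompactSupport
      (hc.deriv.comp_left Complex.ofReal_zero)
  have hp : IsPrimitive (fun x => (φ x : ℂ)) fun x => ((deriv φ x : ℝ) : ℂ) := by
    refine ⟨m1.locallyIntegrable (by norm_num), fun x y => ?_⟩
    refine intervalIntegral.integral_eq_sub_of_hasDerivAt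
      (fun t _ => ((hφ.differentiable (by simp) t).hasDerivAt).ofReal_comp)
      ((Complex.continuous_ofReal.comp hd).intervalIntegrable _ _)
  have wd := (hasWeakDeriv_of_isPrimitive hgφ m1.coeFn_toLp hp).weakDeriv_eq
  have hrep : contRep g = fun x => (φ x : ℂ) :=
    contRep_eq (Complex.continuous_ofReal.comp hφ.continuous) hgφ
  have hin : ∀ (g k : L2) (ψ : ℝ → ℝ), (g =ᵐ[volume] fun x => (ψ x : ℂ)) →
      inner ℂ g k = ∫ x, ψ x • k x := fun g k ψ hψ => by
    rw [L2.inner_def]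
    apply integral_congr_ae
    filter_upwards [hψ] with x hx
    rw [hx, RCLike.inner_apply, Complex.conj_ofReal, Complex.real_smul, mul_comm]
  refine ⟨g, hg, fun k => hin g k φ hgφ, ?_⟩
  obtain ⟨cF, aF⟩ := contRep_spec hf.1
  have e1 : ∫ x : ℝ, ((x : ℂ) * f x) * conj ((x : ℂ) * g x) =
      ∫ x : ℝ, φ x • ((x : ℂ) ^ 2 * contRep f x) := by
    apply integral_congr_ae
    filter_upwards [hgφ, aF] with x hx hx'
    rw [hx, hx', map_mul, Complex.conj_ofReal, Complex.conj_ofReal, Complex.real_smul]; ring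
  have e2 : ∫ x, φ x • f x = ∫ x, φ x • contRep f x := by
    apply integral_congr_ae
    filter_upwards [aF] with x hx
    rw [hx]
  have i1 : Integrable fun x : ℝ => φ x • ((x : ℂ) ^ 2 * contRep f x) :=
    (hφ.continuous.smul ((Complex.continuous_ofReal.pow 2).mul cF)).integrable_of_hasCompactSupport
      hc.smul_right
  have i2 : Integrable fun x : ℝ => φ x • contRep f x :=
    (hφ.continuous.smul cF).integrable_of_hasCompactSupport hc.smul_right
  have e3 : ∫ x : ℝ, φ x • (((x : ℂ) ^ 2 / 4 - 1 / 2) * contRep f x) =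
      1 / 4 * (∫ x : ℝ, φ x • ((x : ℂ) ^ 2 * contRep f x)) - 1 / 2 * ∫ x, φ x • contRep f x := by
    rw [← integral_const_mul, ← integral_const_mul,
      ← integral_sub (i1.const_mul _) (i2.const_mul _)]
    congr 1; ext x
    simp only [Complex.real_smul]; ring
  rw [form, wd, hin _ _ _ m1.coeFn_toLp, hin _ _ _ hgφ, e1, e2, e3, hrep]
  simp only [Complex.conj_ofReal]
  ring

/-- The derivative of an eigenfunction is piecewise smooth, with jumps at `±b`. -/
theorem exists_weakDeriv_ae_eq {z ν : ℂ} {b : ℝ} (hb : 0 < b) {f : L2}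
    (hf : (f, ν • f) ∈ operatorGraph z b) : ∃ P : ℝ → ℂ,
      (∀ x : ℝ, HasDerivAt P (((x : ℂ) ^ 2 / 4 - 1 / 2 - ν) * contRep f x) x) ∧
      weakDeriv f =ᵐ[volume] glue b (fun x => P x + z * contRep f (-b)) P
        (fun x => P x + z * contRep f b) := by
  have hfd : f ∈ formDomain := hf.1
  obtain ⟨cF, aF⟩ := contRep_spec hfd.1
  set F := contRep f with hFdef
  have cQ : Continuous fun x : ℝ => ((x : ℂ) ^ 2 / 4 - 1 / 2 - ν) * F x := by
    have := Complex.continuous_ofReal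
    fun_prop
  let I : ℝ → ℂ := fun x => ∫ t in (0 : ℝ)..x, ((t : ℂ) ^ 2 / 4 - 1 / 2 - ν) * F t
  have hI : ∀ x : ℝ, HasDerivAt I (((x : ℂ) ^ 2 / 4 - 1 / 2 - ν) * F x) x := fun x =>
    intervalIntegral.integral_hasDerivAt_right (cQ.intervalIntegrable _ _)
      (cQ.stronglyMeasurableAtFilter _ _) cQ.continuousAt
  have cI : Continuous I := continuous_iff_continuousAt.2 fun x => (hI x).continuousAt
  -- The distributional derivative of `J` is `z F(b) δ_b - z F(-b) δ_{-b}`, so `f' - I - J` has zero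
  -- weak derivative. The steps are placed so that `J` vanishes on the middle interval.
  let J : ℝ → ℂ := fun x => (Set.Ioi b).indicator (fun _ => z * F b) x +
    (Set.Iic (-b)).indicator (fun _ => z * F (-b)) x
  have lJ : LocallyIntegrable J volume :=
    ((locallyIntegrable_const _).indicator measurableSet_Ioi).add
      ((locallyIntegrable_const _).indicator measurableSet_Iic)
  have lp := L2.locallyIntegrable (weakDeriv f)
  obtain ⟨c, hc⟩ := ae_const_of_weakDeriv_zero (v := fun x => weakDeriv f x - (I x + J x))
    (lp.sub (cI.locallyIntegrable.add lJ)) (by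
      intro φ hφ hc
      have hd := continuous_deriv_of_smooth hφ
      have jI : Integrable fun x => deriv φ x • I x :=
        (hd.smul cI).integrable_of_hasCompactSupport hc.deriv.smul_right
      have jJ : Integrable fun x => deriv φ x • J x :=
        lJ.integrable_smul_left_of_hasCompactSupport hd hc.deriv
      have jp := L2.integrable_smul (weakDeriv f) hd hc.deriv
      have eJ : ∫ x, deriv φ x • J x = -(φ b : ℂ) * (z * F b) + (φ (-b) : ℂ) * (z * F (-b)) := by
        have h1 : ∀ x, deriv φ x • J x =
            (Set.Ioi b).indicator (fun x => deriv φ x • (z * F b)) x +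
            (Set.Iic (-b)).indicator (fun x => deriv φ x • (z * F (-b))) x := fun x => by
          simp only [J, smul_add, Set.indicator_smul_apply]
        have jc : ∀ w : ℂ, Integrable fun x => deriv φ x • w := fun w =>
          (hd.integrable_of_hasCompactSupport hc.deriv).smul_const w
        simp_rw [h1]
        rw [integral_add ((jc _).indicator measurableSet_Ioi) ((jc _).indicator measurableSet_Iic),
          integral_indicator measurableSet_Ioi, integral_indicator measurableSet_Iic,
          integral_smul_const, integral_smul_const,
          hc.integral_Ioi_deriv_eq (hφ.of_le (by simp)),
          hc.integral_Iic_deriv_eq (hφ.of_le (by simp)), Complex.real_smul, Complex.real_smul]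
        push_cast; rfl
      have eI : ∫ x, deriv φ x • I x =
          -∫ x : ℝ, φ x • (((x : ℂ) ^ 2 / 4 - 1 / 2 - ν) * F x) :=
        integral_deriv_smul_primitive cQ.locallyIntegrable hφ hc
      obtain ⟨g, hg, hgk, hform⟩ := form_test (z := z) (b := b) hfd hφ hc
      have key : form z b f g = inner ℂ g (ν • f) := hf.2 g hg
      have e2 : ∫ x, φ x • f x = ∫ x, φ x • F x := by
        apply integral_congr_ae
        filter_upwards [aF] with x hx
        rw [hx]
      rw [hform, inner_smul_right, hgk, e2, ← hFdef] at key
      have i1 : Integrable fun x : ℝ => φ x • (((x : ℂ) ^ 2 / 4 - 1 / 2) * F x) := by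
        refine Continuous.integrable_of_hasCompactSupport ?_ hc.smul_right
        have := Complex.continuous_ofReal
        have := hφ.continuous
        fun_prop
      have i2 : Integrable fun x : ℝ => φ x • F x :=
        (hφ.continuous.smul cF).integrable_of_hasCompactSupport hc.smul_right
      have e3 : ∫ x : ℝ, φ x • (((x : ℂ) ^ 2 / 4 - 1 / 2 - ν) * F x) =
          (∫ x : ℝ, φ x • (((x : ℂ) ^ 2 / 4 - 1 / 2) * F x)) - ν * ∫ x, φ x • F x := by
        rw [← integral_const_mul, ← integral_sub i1 (i2.const_mul _)]
        congr 1; ext x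
        simp only [Complex.real_smul]; ring
      have jIJ : Integrable fun x => deriv φ x • (I x + J x) := by
        simp_rw [smul_add]; exact jI.add jJ
      simp_rw [smul_sub]
      rw [integral_sub jp jIJ]
      simp_rw [smul_add]
      rw [integral_add jI jJ, eJ, eI, e3]
      linear_combination key)
  refine ⟨fun x => c + I x, fun x => (hI x).const_add c, ?_⟩
  filter_upwards [hc] with x hx
  have hx' : weakDeriv f x = c + (I x + J x) := by rw [← hx]; ring
  rw [hx']
  simp only [J, Set.indicator_apply, Set.mem_Ioi, Set.mem_Iic]
  rcases le_or_gt x (-b) with h | h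
  · rw [glue_left h, if_neg (by linarith), if_pos h]; ring
  · rcases le_or_gt x b with h' | h'
    · rw [glue_mid h h', if_neg (by linarith), if_neg (by linarith)]; ring
    · rw [glue_right hb h', if_pos h', if_neg (by linarith)]; ring

theorem eq_zero_of_integrableOn_const {κ : ℂ} {s : Set ℝ} (hs : volume s = ⊤)
    (h : IntegrableOn (fun _ : ℝ => κ) s) : κ = 0 := by
  rw [integrableOn_const_iff (by simp)] at h
  rcases h with h | h
  · simpa using h
  · exact absurd hs h.ne

/-- On each outer half-line the Wronskian of `f` with the decaying solution is constant, and it is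
integrable as a sum of products of `L²` functions, so it is zero. These two equations are the
matching conditions for the middle coefficients. -/
theorem eq_zero_of_mem_operatorGraph {z ν : ℂ} {b : ℝ} (hb : 0 < b)
    (hdet : ∀ α β, matchRight z ν b α β = 0 → matchLeft z ν b α β = 0 → α = 0 ∧ β = 0)
    {f : L2} (hf : (f, ν • f) ∈ operatorGraph z b) : f = 0 := by
  have hfd : f ∈ formDomain := hf.1
  obtain ⟨cF, aF⟩ := contRep_spec hfd.1
  obtain ⟨P, hP, hpP⟩ := exists_weakDeriv_ae_eq hb hf
  have hprim := isPrimitive_contRep hfd.1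
  set F := contRep f with hFdef
  set p := weakDeriv f
  let Pr : ℝ → ℂ := fun x => P x + z * F b
  let Pl : ℝ → ℂ := fun x => P x + z * F (-b)
  have hPr : ∀ x : ℝ, HasDerivAt Pr (((x : ℂ) ^ 2 / 4 - 1 / 2 - ν) * F x) x :=
    fun x => (hP x).add_const _
  have hPl : ∀ x : ℝ, HasDerivAt Pl (((x : ℂ) ^ 2 / 4 - 1 / 2 - ν) * F x) x :=
    fun x => (hP x).add_const _
  have gen : ∀ (R : ℝ → ℂ) (a c : ℝ), (∀ᵐ x, x ∈ Set.Ioc a c → p x = R x) →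
      ∀ x ∈ Set.Icc a c, F x = F a + ∫ t in a..x, R t := fun R a c hR x hx => by
    have : ∫ t in a..x, R t = ∫ t in a..x, p t := by
      refine intervalIntegral.integral_congr_ae ?_
      filter_upwards [hR] with t ht h
      rw [Set.uIoc_of_le hx.1] at h
      exact (ht ⟨h.1, h.2.trans hx.2⟩).symm
    rw [this, hprim.integral_eq]; ring
  have hr : ∀ x, b ≤ x → coeffEven ν F Pr x = coeffEven ν F Pr b ∧
      coeffOdd ν F Pr x = coeffOdd ν F Pr b := fun x hx =>
    coeff_eq cF hPr hx (gen Pr b x (by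
      filter_upwards [hpP] with t ht h
      rw [ht, glue_right hb h.1]))
  have hm : coeffEven ν F P b = coeffEven ν F P (-b) ∧ coeffOdd ν F P b = coeffOdd ν F P (-b) :=
    coeff_eq cF hP (by linarith) (gen P (-b) b (by
      filter_upwards [hpP] with t ht h
      rw [ht, glue_mid h.1 h.2]))
  have hm' : ∀ x, -b ≤ x → x ≤ b → coeffEven ν F P x = coeffEven ν F P (-b) ∧
      coeffOdd ν F P x = coeffOdd ν F P (-b) := fun x hx hx' =>
    coeff_eq cF hP hx (gen P (-b) x (by
      filter_upwards [hpP] with t ht h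
      rw [ht, glue_mid h.1 (h.2.trans hx')]))
  have hl : ∀ x, x ≤ -b → coeffEven ν F Pl (-b) = coeffEven ν F Pl x ∧
      coeffOdd ν F Pl (-b) = coeffOdd ν F Pl x := fun x hx =>
    coeff_eq cF hPl hx (gen Pl x (-b) (by
      filter_upwards [hpP] with t ht h
      rw [ht, glue_left h.2]))
  have mF : MemLp F 2 volume := (Lp.memLp f).ae_eq aF
  have mPr : MemLp Pr 2 (volume.restrict (Set.Ioi b)) := by
    refine ((Lp.memLp p).restrict (Set.Ioi b)).ae_eq ?_
    filter_upwards [ae_restrict_of_ae hpP, ae_restrict_mem measurableSet_Ioi] with x hx h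
    rw [hx, glue_right hb h]
  have mPl : MemLp Pl 2 (volume.restrict (Set.Iic (-b))) := by
    refine ((Lp.memLp p).restrict (Set.Iic (-b))).ae_eq ?_
    filter_upwards [ae_restrict_of_ae hpP, ae_restrict_mem measurableSet_Iic] with x hx h
    rw [hx, glue_left h]
  have mD := (rapidDecay_parabolicD ν).memLp (continuous_parabolicD_ofReal ν) b
  have mD' := (rapidDecay_parabolicD' ν).memLp (continuous_parabolicD'_ofReal ν) b
  -- The left-hand side is the Wronskian `D_ν F' - D_ν' F` on `(b, ∞)`, with `Pr` in the role of
  -- `F'`.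
  have wr : coefA ν * coeffOdd ν F Pr b + coefB ν * coeffEven ν F Pr b = 0 := by
    refine eq_zero_of_integrableOn_const (Real.volume_Ioi (a := b)) ?_
    refine IntegrableOn.congr_fun
      ((mD.integrable_mul mPr).sub (mD'.integrable_mul (mF.restrict (Set.Ioi b)))) ?_
      measurableSet_Ioi
    intro x hx
    simp only [Pi.sub_apply, Pi.mul_apply]
    rw [← (hr x (le_of_lt hx)).1, ← (hr x (le_of_lt hx)).2, coeffEven, coeffOdd, parabolicD_eq,
      parabolicD']
    ring
  -- The same with `D_ν(-x)`, whose derivative is `-D_ν'(-x)`; hence a sum of the two products.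
  have wl : coefA ν * coeffOdd ν F Pl (-b) - coefB ν * coeffEven ν F Pl (-b) = 0 := by
    have nD : MemLp (fun x : ℝ => parabolicD ν ((-x : ℝ) : ℂ)) 2
        (volume.restrict (Set.Iic (-b))) := memLp_Iic_of_comp_neg (by simpa using mD)
    have nD' : MemLp (fun x : ℝ => parabolicD' ν ((-x : ℝ) : ℂ)) 2
        (volume.restrict (Set.Iic (-b))) := memLp_Iic_of_comp_neg (by simpa using mD')
    refine eq_zero_of_integrableOn_const (Real.volume_Iic (a := -b)) ?_
    refine IntegrableOn.congr_fun
      ((nD.integrable_mul mPl).add (nD'.integrable_mul (mF.restrict (Set.Iic (-b))))) ?_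
      measurableSet_Iic
    intro x hx
    simp only [Pi.add_apply, Pi.mul_apply]
    rw [(hl x hx).1, (hl x hx).2, coeffEven, coeffOdd, parabolicD_eq, parabolicD',
      Complex.ofReal_neg, yEven_neg, yOdd_neg, yEven'_neg, yOdd'_neg]
    ring
  have pe : yEven ν ((-b : ℝ) : ℂ) = yEven ν b := by rw [Complex.ofReal_neg, yEven_neg]
  have po : yOdd ν ((-b : ℝ) : ℂ) = -yOdd ν b := by rw [Complex.ofReal_neg, yOdd_neg]
  have Fb := eq_coeff ν F P b
  have Fmb := eq_coeff ν F P (-b)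
  rw [hm.1, hm.2] at Fb
  rw [pe, po] at Fmb
  have rE : coeffEven ν F Pr b = coeffEven ν F P (-b) - z * F b * yOdd ν b := by
    rw [← hm.1]; simp only [coeffEven, Pr]; ring
  have rO : coeffOdd ν F Pr b = coeffOdd ν F P (-b) + z * F b * yEven ν b := by
    rw [← hm.2]; simp only [coeffOdd, Pr]; ring
  have lE : coeffEven ν F Pl (-b) = coeffEven ν F P (-b) + z * F (-b) * yOdd ν b := by
    simp only [coeffEven, Pl, po]; ring
  have lO : coeffOdd ν F Pl (-b) = coeffOdd ν F P (-b) + z * F (-b) * yEven ν b := by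
    simp only [coeffOdd, Pl, pe]; ring
  rw [rE, rO] at wr
  rw [lE, lO] at wl
  obtain ⟨hα, hβ⟩ := hdet (coeffEven ν F P (-b)) (coeffOdd ν F P (-b))
    (by rw [matchRight, parabolicD_eq]
        linear_combination wr - z * (coefA ν * yEven ν b - coefB ν * yOdd ν b) * Fb)
    (by rw [matchLeft, parabolicD_eq]
        linear_combination wl - z * (coefA ν * yEven ν b - coefB ν * yOdd ν b) * Fmb)
  have Fb0 : F b = 0 := by rw [Fb, hα, hβ]; ring
  have Fmb0 : F (-b) = 0 := by rw [Fmb, hα, hβ]; ring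
  have hF0 : ∀ x, F x = 0 := by
    intro x
    rcases le_total x (-b) with h | h
    · rw [eq_coeff ν F Pl x, ← (hl x h).1, ← (hl x h).2, lE, lO, hα, hβ, Fmb0]; ring
    · rcases le_total x b with h' | h'
      · rw [eq_coeff ν F P x, (hm' x h h').1, (hm' x h h').2, hα, hβ]; ring
      · rw [eq_coeff ν F Pr x, (hr x h').1, (hr x h').2, rE, rO, hα, hβ, Fb0]; ring
  apply Lp.ext
  filter_upwards [aF, Lp.coeFn_zero ℂ 2 (volume : Measure ℝ)] with x hx hx'
  rw [hx, hx', hF0]; rfl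

/-! ### The spectrum -/

/-- The determinant of the matching conditions. -/
def matchDet (z ν : ℂ) (b : ℝ) : ℂ :=
  coefA ν * coefB ν - z ^ 2 * parabolicD ν b ^ 2 * yEven ν b * yOdd ν b

/-- Elimination; the determinant of the system is `2 * matchDet`, hence the factor 2. -/
theorem matchDet_eq_zero {z ν : ℂ} {b : ℝ} (hd : matchDet z ν b ≠ 0) {α β : ℂ}
    (h1 : matchRight z ν b α β = 0) (h2 : matchLeft z ν b α β = 0) : α = 0 ∧ β = 0 := by
  rw [matchRight] at h1
  rw [matchLeft] at h2
  rw [matchDet] at hd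
  constructor
  · have : 2 * (coefA ν * coefB ν - z ^ 2 * parabolicD ν b ^ 2 * yEven ν b * yOdd ν b) * α = 0 := by
      linear_combination (coefA ν - z * parabolicD ν b * yOdd ν b) * h1 -
        (coefA ν + z * parabolicD ν b * yOdd ν b) * h2
    simpa [hd] using this
  · have : 2 * (coefA ν * coefB ν - z ^ 2 * parabolicD ν b ^ 2 * yEven ν b * yOdd ν b) * β = 0 := by
      linear_combination (coefB ν + z * parabolicD ν b * yEven ν b) * h2 -
        (-coefB ν + z * parabolicD ν b * yEven ν b) * h1
    simpa [hd] using this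

theorem exists_match {z ν : ℂ} {b : ℝ} (hd : matchDet z ν b ≠ 0) (r₁ r₂ : ℂ) :
    ∃ α β, matchRight z ν b α β = r₁ ∧ matchLeft z ν b α β = r₂ := by
  refine ⟨((coefA ν - z * parabolicD ν b * yOdd ν b) * r₁ -
      (coefA ν + z * parabolicD ν b * yOdd ν b) * r₂) / (2 * matchDet z ν b),
    ((coefB ν + z * parabolicD ν b * yEven ν b) * r₂ -
      (-coefB ν + z * parabolicD ν b * yEven ν b) * r₁) / (2 * matchDet z ν b), ?_, ?_⟩
  · rw [matchRight]
    field_simp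
    rw [matchDet]; ring
  · rw [matchLeft]
    field_simp
    rw [matchDet]; ring

/-- A nonzero row `(p, q)` of a singular matrix gives the kernel vector `(q, -p)`; if both rows
vanish, any vector will do. -/
theorem exists_match_of_eq_zero {z ν : ℂ} {b : ℝ} (hd : matchDet z ν b = 0) :
    ∃ α β, (α ≠ 0 ∨ β ≠ 0) ∧ matchRight z ν b α β = 0 ∧ matchLeft z ν b α β = 0 := by
  rw [matchDet] at hd
  set A := coefA ν
  set B := coefB ν
  set u := z * parabolicD ν b * yEven ν b with hu
  set w := z * parabolicD ν b * yOdd ν b with hw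
  have hd' : A * B - u * w = 0 := by rw [hu, hw]; linear_combination hd
  by_cases h1 : A + w = 0 ∧ B + u = 0
  · by_cases h2 : A - w = 0 ∧ -B + u = 0
    · refine ⟨1, 0, Or.inl one_ne_zero, ?_, ?_⟩
      · rw [matchRight]; linear_combination h1.2
      · rw [matchLeft]; linear_combination h2.2
    · refine ⟨A - w, -(-B + u), ?_, ?_, ?_⟩
      · rw [not_and_or] at h2
        exact h2.imp id fun h => neg_ne_zero.2 h
      · rw [matchRight]; linear_combination 2 * hd'
      · rw [matchLeft]; ring
  · refine ⟨A + w, -(B + u), ?_, ?_, ?_⟩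
    · rw [not_and_or] at h1
      exact h1.imp id fun h => neg_ne_zero.2 h
    · rw [matchRight]; ring
    · rw [matchLeft]; linear_combination -2 * hd'

theorem varSol_zero_eq (ν α β : ℂ) (x : ℝ) :
    varSol ν (fun _ => 0) α β x = α * yEven ν x + β * yOdd ν x := by
  simp [varSol, oddMoment, evenMoment]

theorem exists_eigenfunction {z ν : ℂ} {b : ℝ} (hb : 0 < b) (hd : matchDet z ν b = 0) :
    ∃ f : L2, f ≠ 0 ∧ (f, ν • f) ∈ operatorGraph z b := by
  obtain ⟨α, β, hne, h1, h2⟩ := exists_match_of_eq_zero hd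
  have hH : (0 : L2) =ᵐ[volume] fun _ => (0 : ℂ) := Lp.coeFn_zero ℂ 2 (volume : Measure ℝ)
  obtain ⟨f, hf, hrep⟩ := exists_mem_operatorGraph (z := z) (ν := ν) hb
    (h := fun _ => 0) continuous_const (r := 0) (fun _ _ => rfl) hH (α := α) (β := β)
    (by rw [h1]; simp [oddMoment, evenMoment]) (by rw [h2]; simp [oddMoment, evenMoment])
  refine ⟨f, ?_, by simpa using hf⟩
  rintro rfl
  have h0 : contRep (0 : L2) = fun _ => 0 := contRep_eq continuous_const hH
  rw [h0] at hrep
  -- The origin lies inside the middle interval, where `f(0) = α` and `f'(0) = β`, so `f = 0` would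
  -- force both data to vanish.
  have hα : α = 0 := by
    have := hrep 0 (by linarith) hb.le
    rw [varSol_zero_eq, Complex.ofReal_zero, yEven_zero, yOdd_zero] at this
    simpa using this.symm
  have hβ : β = 0 := by
    have hder := (isSolution_varSol ν (h := fun _ => 0) continuous_const α β).hasDerivAt 0
    have hz : HasDerivAt (varSol ν (fun _ => 0) α β) 0 0 := by
      refine (hasDerivAt_const (0 : ℝ) (0 : ℂ)).congr_of_eventuallyEq ?_
      filter_upwards [Ioo_mem_nhds (by linarith : -b < 0) hb] with x hx
      exact (hrep x hx.1 hx.2.le).symm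
    have := hder.unique hz
    simpa [varSol', oddMoment, evenMoment, hα, yOdd', yEven_zero, yOdd_zero] using this
  rcases hne with h | h
  · exact h hα
  · exact h hβ

/-- `S h` solves the equation up to the error `χ S h`, which is continuous with compact support; a
glued solution with that source corrects it. -/
theorem exists_solution {z ν : ℂ} {b : ℝ} (hb : 0 < b) (hd : matchDet z ν b ≠ 0) (h : L2) :
    ∃ f : L2, (f, h + ν • f) ∈ operatorGraph z b := by
  obtain ⟨χ, hχ, ⟨r, hr⟩, K, S, hK, hS, -⟩ := exists_cutoff_resolvent z b ν
  have hS0 := hS h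
  have hSd : S h ∈ formDomain := hS0.1
  obtain ⟨cF, aF⟩ := contRep_spec hSd.1
  have hKS : K (S h) =ᵐ[volume] fun x => (χ x : ℂ) * contRep (S h) x := by
    filter_upwards [hK (S h), aF] with x h1 h2
    rw [h1, h2]
  -- The right-hand sides are left open and are fixed by the use of `h1` and `h2` just below.
  obtain ⟨α, β, h1, h2⟩ := exists_match hd _ _
  obtain ⟨f, hf, -⟩ := exists_mem_operatorGraph (z := z) (ν := ν) hb
    ((Complex.continuous_ofReal.comp hχ).mul cF) (r := r)
    (fun x hx => by simp [hr x hx]) hKS h1 h2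
  refine ⟨S h + f, ?_⟩
  have := (operatorGraph z b).add_mem hS0 hf
  convert! this using 1
  rw [Prod.mk_add_mk, smul_add]
  congr 1
  abel

theorem mem_operatorGraph_unique {z ν : ℂ} {b : ℝ} (hb : 0 < b) (hd : matchDet z ν b ≠ 0)
    {f g h : L2} (hf : (f, h + ν • f) ∈ operatorGraph z b)
    (hg : (g, h + ν • g) ∈ operatorGraph z b) : f = g := by
  refine sub_eq_zero.1 (eq_zero_of_mem_operatorGraph (z := z) (ν := ν) hb
    (fun _ _ => matchDet_eq_zero hd) ?_)
  have := (operatorGraph z b).sub_mem hf hg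
  convert! this using 1
  rw [Prod.mk_sub_mk, smul_sub, add_sub_add_left_eq_sub]

/-- Uniqueness makes the solution map linear, and the closed graph theorem makes it bounded, so no
estimate of Green's function is needed. -/
theorem exists_resolvent {z ν : ℂ} {b : ℝ} (hb : 0 < b) (hd : matchDet z ν b ≠ 0) :
    ∃ R : L2 →L[ℂ] L2, ∀ h, (R h, h + ν • R h) ∈ operatorGraph z b := by
  choose R hR using exists_solution (z := z) hb hd
  let Rl : L2 →ₗ[ℂ] L2 :=
    { toFun := R
      map_add' := fun h k => mem_operatorGraph_unique hb hd (hR (h + k)) (by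
        have := (operatorGraph z b).add_mem (hR h) (hR k)
        convert! this using 1
        rw [Prod.mk_add_mk, smul_add]
        congr 1
        abel)
      map_smul' := fun c h => mem_operatorGraph_unique hb hd (hR (c • h)) (by
        have := (operatorGraph z b).smul_mem c (hR h)
        convert! this using 1
        rw [Prod.smul_mk, smul_add, RingHom.id_apply, smul_comm ν c]) }
  obtain ⟨χ, hχ, -, K, S, hK, hS, hS'⟩ := exists_cutoff_resolvent z b ν
  have hclosed : ∀ (u : ℕ → L2) (x y : L2), Filter.Tendsto u Filter.atTop (nhds x) →
      Filter.Tendsto (Rl ∘ u) Filter.atTop (nhds y) → y = Rl x := by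
    intro u x y hu hy
    -- This fixed-point identity involves only the bounded operators `S` and `K`, so it passes to
    -- the limit and gives closedness of the graph.
    have e : ∀ n, (Rl ∘ u) n = S (u n + K ((Rl ∘ u) n)) := fun n => by
      have := hS' _ _ (hR (u n))
      rwa [add_sub_cancel_right] at this
    have t : Filter.Tendsto (fun n => S (u n + K ((Rl ∘ u) n))) Filter.atTop
        (nhds (S (x + K y))) :=
      (S.continuous.tendsto _).comp (hu.add ((K.continuous.tendsto y).comp hy))
    have hyS : y = S (x + K y) := tendsto_nhds_unique hy (t.congr fun n => (e n).symm)
    refine mem_operatorGraph_unique hb hd ?_ (hR x)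
    have := hS (x + K y)
    rw [← hyS] at this
    convert! this using 1
    congr 1
    abel
  exact ⟨ContinuousLinearMap.ofSeqClosedGraph hclosed, hR⟩

theorem mem_resolventSet_of_matchDet_ne_zero {z ν : ℂ} {b : ℝ} (hb : 0 < b)
    (hd : matchDet z ν b ≠ 0) : ν ∈ resolventSet (pcOperator z b) := by
  obtain ⟨R, hR⟩ := exists_resolvent hb hd
  refine ⟨R, fun h => ?_, fun f => ?_⟩
  · have := hR h
    rw [← pcOperator_graph, LinearPMap.mem_graph_iff] at this
    obtain ⟨⟨y, hy⟩, h1, h2⟩ := this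
    simp only at h1 h2
    subst h1
    exact ⟨hy, by rw [h2, add_sub_cancel_right]⟩
  · refine mem_operatorGraph_unique hb hd (hR _) ?_
    rw [sub_add_cancel, ← pcOperator_graph]
    exact (pcOperator z b).mem_graph f

theorem notMem_resolventSet_of_matchDet_eq_zero {z ν : ℂ} {b : ℝ} (hb : 0 < b)
    (hd : matchDet z ν b = 0) : ν ∉ resolventSet (pcOperator z b) := by
  rintro ⟨R, -, hR⟩
  obtain ⟨f, hf0, hf⟩ := exists_eigenfunction hb hd
  rw [← pcOperator_graph, LinearPMap.mem_graph_iff] at hf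
  obtain ⟨y, h1, h2⟩ := hf
  have h3 := hR y
  simp only at h1 h2
  rw [h2, h1, sub_self, map_zero] at h3
  exact hf0 h3.symm

end

end OddPair

theorem mainTheorem2 (z : ℂ) (b : ℝ) (hb : 0 < b) (ν : ℂ) :
    ν ∈ OddPair.opSpectrum (OddPair.pcOperator z b) ↔
      (√Real.pi : ℂ) / (√2 : ℂ) * OddPair.recipGamma (-ν)
        - z ^ 2 * OddPair.parabolicD ν b ^ 2 * OddPair.yEven ν b * OddPair.yOdd ν b = 0 := by
  rw [← OddPair.coefA_mul_coefB]
  change ν ∉ OddPair.resolventSet (OddPair.pcOperator z b) ↔ OddPair.matchDet z ν b = 0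
  constructor
  · intro h
    by_contra hd
    exact h (OddPair.mem_resolventSet_of_matchDet_ne_zero hb hd)
  · exact OddPair.notMem_resolventSet_of_matchDet_eq_zero hb
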